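/- **Setting.** For $\theta<1$ put $q_+=\frac{1+\sqrt{1-\theta}}{6}$ and, for $\lambda>0$ and $Q=(q_1,q_2,q_3)\in H^1(-1,1)^3$, $$E_\lambda(Q)=\int_{-1}^1\Big(\frac{3(q_1')^2+(q_2')^2+(q_3')^2}{\lambda^2}+f(Q)\Big)\,dx,$$ $$f(Q)=\frac{\theta}{3}(3q_1^2+q_2^2+q_3^2)+4q_1(q_1^2-q_2^2-q_3^2)+\frac12(3q_1^2+q_2^2+q_3^2)^2+c(\theta),$$ with $c(\theta)$ chosen such that $\min f=0$. Let $\mathcal H$ be the affine space of $Q\in H^1(-1,1)^3$ with $q_1(\pm1)=q_+$, $q_2(\pm 1)=\mp 3q_+$, $q_3(\pm1)=0$. An *eigenvalue exchange solution* is a critical point of $E_\lambda$ in $\mathcal H$ (i.e. the derivative of $E_\lambda$ vanishes in all directions of $H^1_0(-1,1)^3$) with $q_3\equiv0$. For $\chi\in\mathcal H$ with $q_3\equiv 0$ put $$\nu(\lambda,\chi)=\inf_{(h_1,h_2)\in H^1_0(-1,1)^2\setminus\{0\}}\frac{D^2E_\lambda(\chi)[(h_1,h_2,0)]}{\int_{-1}^1(h_1^2+h_2^2)\,dx},\qquad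 \mu(\lambda,\chi)=\inf_{h\in H^1_0(-1,1)\setminus\{0\}}\frac{D^2E_\lambda(\chi)[(0,0,h)]}{\int_{-1}^1h^2\,dx},$$ the first eigenvalues of the second variation on symmetry-preserving and on symmetry-breaking perturbations. Let $\lambda_*\in[0,+\infty]$ be the supremum of all $L$ for which there is a smooth ($C^\infty$, with values in $H^1(-1,1)^3$) branch $(0,L)\ni\lambda\mapsto\chi_\lambda$ of eigenvalue exchange solutions with $\nu(\lambda,\chi_\lambda)>0$ for all $\lambda\in(0,L)$. **Theorem.** Let $\theta=-8$ (so that $q_+=2/3$). Then $\lambda_*=+\infty$, and there is a smooth branch of eigenvalue exchange solutions $(0,+\infty)\to\mathcal H$, $\lambda\mapsto\chi_\lambda$, such that: 1. there is $\lambda_0>0$ such that, for all $\lambda\in(0,\lambda_0)$, $\chi_\lambda$ is the unique critical point of $E_\lambda$ in $\mathcal H$; 2. every smooth branch of eigenvalue exchange solutions defined on an interval $(0,L)$, $0<L\le+\infty$, coincides there with $\lambda\mapsto\chi_\lambda$; 3. $\nu(\lambda):=\nu(\lambda,\chi_\lambda)>0$ for all $\lambda>0$; 4. for all $\lambda>0$,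 $\chi_\lambda=(2/3,q_{2,\lambda},0)$, where $q_2=q_{2,\lambda}$ is a classical solution of $\frac1{\lambda^2}q_2''=(q_2^2-4)q_2$ on $[-1,1]$, $q_2(-1)=2$, $q_2(1)=-2$; 5. $\mu(\lambda):=\mu(\lambda,\chi_\lambda)$ is differentiable with $\mu'(\lambda)<0$ for all $\lambda>0$; 6. $\lim_{\lambda\to+\infty}\mu(\lambda)$ exists, is finite, and is negative; 7. there is a unique $\lambda_c>0$ such that $\mu(\lambda)>0$ for all $\lambda\in(0,\lambda_c)$, $\mu(\lambda_c)=0$ and $\mu'(\lambda_c)<0$. -/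

import Mathlib

open MeasureTheory Set Filter Topology
open scoped ContDiff

noncomputable section

namespace Nematic

/-- Lebesgue measure on the interval `(-1, 1)`. -/
abbrev cell : Measure ℝ := volume.restrict (Ioo (-1) 1)

/-- The real Hilbert space `L²(-1, 1)`. -/
abbrev L2 : Type := Lp ℝ 2 cell

/-- `v` is the weak derivative of `u` on `(-1, 1)`. -/
def IsWeakDeriv (u v : L2) : Prop :=
  ∀ φ : ℝ → ℝ, ContDiff ℝ ∞ φ → HasCompactSupport φ → tsupport φ ⊆ Ioo (-1) 1 →
    ∫ x, u x * deriv φ x ∂cell = -∫ x, v x * φ x ∂cell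

lemma integrable_mul_of_continuous (u : L2) {φ : ℝ → ℝ} (hφ : Continuous φ)
    (hc : HasCompactSupport φ) : Integrable (fun x => u x * φ x) cell := by
  have hu : Integrable (fun x => u x) cell := (Lp.memLp u).integrable (by norm_num)
  obtain ⟨C, hC⟩ := hφ.bounded_above_of_compact_support hc
  exact hu.mul_bdd hφ.aestronglyMeasurable (ae_of_all _ hC)

lemma IsWeakDeriv.add {u v u' v' : L2} (h : IsWeakDeriv u v) (h' : IsWeakDeriv u' v') :
    IsWeakDeriv (u + u') (v + v') := by
  intro φ h1 h2 h3
  have hd : Continuous (deriv φ) := h1.continuous_deriv (by simp)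
  have e1 : ∫ x, (u + u') x * deriv φ x ∂cell
      = ∫ x, u x * deriv φ x ∂cell + ∫ x, u' x * deriv φ x ∂cell := by
    rw [← integral_add (integrable_mul_of_continuous u hd h2.deriv)
      (integrable_mul_of_continuous u' hd h2.deriv)]
    refine integral_congr_ae ?_
    filter_upwards [Lp.coeFn_add u u'] with x hx
    rw [hx, Pi.add_apply, add_mul]
  have e2 : ∫ x, (v + v') x * φ x ∂cell
      = ∫ x, v x * φ x ∂cell + ∫ x, v' x * φ x ∂cell := by
    rw [← integral_add (integrable_mul_of_continuous v h1.continuous h2)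
      (integrable_mul_of_continuous v' h1.continuous h2)]
    refine integral_congr_ae ?_
    filter_upwards [Lp.coeFn_add v v'] with x hx
    rw [hx, Pi.add_apply, add_mul]
  rw [e1, e2, h φ h1 h2 h3, h' φ h1 h2 h3]
  ring

lemma IsWeakDeriv.smul (c : ℝ) {u v : L2} (h : IsWeakDeriv u v) :
    IsWeakDeriv (c • u) (c • v) := by
  intro φ h1 h2 h3
  have e1 : ∫ x, (c • u) x * deriv φ x ∂cell = c * ∫ x, u x * deriv φ x ∂cell := by
    rw [← integral_const_mul]
    refine integral_congr_ae ?_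
    filter_upwards [Lp.coeFn_smul c u] with x hx
    simp [hx, mul_assoc]
  have e2 : ∫ x, (c • v) x * φ x ∂cell = c * ∫ x, v x * φ x ∂cell := by
    rw [← integral_const_mul]
    refine integral_congr_ae ?_
    filter_upwards [Lp.coeFn_smul c v] with x hx
    simp [hx, mul_assoc]
  rw [e1, e2, h φ h1 h2 h3]
  ring

/-- The Sobolev space `H¹(-1, 1)`: the pairs `(u, u')` in `L² × L²` whose second entry is the
weak derivative of the first, with the norm `(‖u‖² + ‖u'‖²)^(1/2)`. -/
def H1 : Submodule ℝ (WithLp 2 (L2 × L2)) where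
  carrier := {w | IsWeakDeriv w.fst w.snd}
  add_mem' := fun ha hb => IsWeakDeriv.add ha hb
  zero_mem' := by
    have h : IsWeakDeriv ((0 : ℝ) • (0 : L2)) ((0 : ℝ) • (0 : L2)) := by
      intro φ _ _ _
      have e : ∀ g : ℝ → ℝ, ∫ x, ((0 : ℝ) • (0 : L2)) x * g x ∂cell = 0 := by
        intro g
        rw [zero_smul]
        refine integral_eq_zero_of_ae ?_
        filter_upwards [Lp.coeFn_zero ℝ 2 cell] with x hx
        rw [hx, Pi.zero_apply, zero_mul]
      rw [e, e, neg_zero]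
    simpa using h
  smul_mem' := fun c _ h => IsWeakDeriv.smul c h

/-- The function underlying an element of `H¹(-1, 1)` (defined almost everywhere). -/
def val (u : H1) : ℝ → ℝ := u.1.fst

/-- The weak derivative of an element of `H¹(-1, 1)` (defined almost everywhere). -/
def der (u : H1) : ℝ → ℝ := u.1.snd

/-- The continuous representative of `u` on `[-1, 1]` takes the values `a` at `-1` and
`b` at `1`. -/
def HasBoundaryValues (u : H1) (a b : ℝ) : Prop :=
  ∃ g : ℝ → ℝ, ContinuousOn g (Icc (-1) 1) ∧ val u =ᵐ[cell] g ∧ g (-1) = a ∧ g 1 = b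

/-- Membership in `H¹₀(-1, 1)`. -/
def IsH10 (u : H1) : Prop := HasBoundaryValues u 0 0

/-- Triples `(q₁, q₂, q₃)` in `H¹(-1, 1)³`, identified with the maps
`Q = [[-2q₁, 0, 0], [0, q₁ - q₂, q₃], [0, q₃, q₁ + q₂]]` into traceless symmetric matrices. -/
abbrev Config : Type := H1 × H1 × H1

/-- The number `q₊`, given by `6 q₊ = 1 + √(1 - θ)`. -/
def qPlus (θ : ℝ) : ℝ := (1 + Real.sqrt (1 - θ)) / 6

/-- The bulk energy density, up to its additive constant:
`(θ/6)|Q|² - (2/3) tr(Q³) + (1/8)|Q|⁴` in terms of `q₁, q₂, q₃`. -/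
def bulk₀ (θ q₁ q₂ q₃ : ℝ) : ℝ :=
  θ / 3 * (3 * q₁ ^ 2 + q₂ ^ 2 + q₃ ^ 2) + 4 * q₁ * (q₁ ^ 2 - q₂ ^ 2 - q₃ ^ 2)
    + 1 / 2 * (3 * q₁ ^ 2 + q₂ ^ 2 + q₃ ^ 2) ^ 2

/-- The bulk energy density, normalized to have minimum `0`. -/
def bulk (θ q₁ q₂ q₃ : ℝ) : ℝ :=
  bulk₀ θ q₁ q₂ q₃ - ⨅ p : ℝ × ℝ × ℝ, bulk₀ θ p.1 p.2.1 p.2.2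

/-- The reduced free energy `∫ (|Q'|² / (2λ²) + f(Q)) dx`, where
`|Q'|² = 2 (3 q₁'² + q₂'² + q₃'²)`. -/
def energy (θ lam : ℝ) (Q : Config) : ℝ :=
  ∫ x, ((3 * der Q.1 x ^ 2 + der Q.2.1 x ^ 2 + der Q.2.2 x ^ 2) / lam ^ 2
    + bulk θ (val Q.1 x) (val Q.2.1 x) (val Q.2.2 x)) ∂cell

/-- The affine space of admissible configurations. -/
def IsAdmissible (θ : ℝ) (Q : Config) : Prop :=
  HasBoundaryValues Q.1 (qPlus θ) (qPlus θ) ∧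
  HasBoundaryValues Q.2.1 (3 * qPlus θ) (-(3 * qPlus θ)) ∧
  HasBoundaryValues Q.2.2 0 0

/-- The space `H¹₀(-1, 1)³` of perturbations. -/
def IsPerturbation (H : Config) : Prop := IsH10 H.1 ∧ IsH10 H.2.1 ∧ IsH10 H.2.2

/-- `Q` is a critical point of the free energy among admissible configurations. -/
def IsCriticalPoint (θ lam : ℝ) (Q : Config) : Prop :=
  IsAdmissible θ Q ∧
  ∀ H : Config, IsPerturbation H → HasDerivAt (fun t : ℝ => energy θ lam (Q + t • H)) 0 0

/-- Eigenvalue exchange configurations: those with `q₃ ≡ 0`. -/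
def IsEE (Q : Config) : Prop := Q.2.2 = 0

/-- The second variation `D²E_λ(Q)[H]` of the free energy (as a quadratic form). -/
def secondVariation (θ lam : ℝ) (Q H : Config) : ℝ :=
  iteratedDeriv 2 (fun t : ℝ => energy θ lam (Q + t • H)) 0

/-- The first eigenvalue of the second variation at `Q` restricted to symmetry-preserving
perturbations `(h₁, h₂, 0)`. -/
def nu (θ lam : ℝ) (Q : Config) : ℝ :=
  sInf {r | ∃ h₁ h₂ : H1, IsH10 h₁ ∧ IsH10 h₂ ∧ (h₁, h₂) ≠ 0 ∧
    r = secondVariation θ lam Q (h₁, h₂, 0) / ∫ x, (val h₁ x ^ 2 + val h₂ x ^ 2) ∂cell}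

/-- The first eigenvalue of the second variation at `Q` restricted to symmetry-breaking
perturbations `(0, 0, h)`. -/
def mu (θ lam : ℝ) (Q : Config) : ℝ :=
  sInf {r | ∃ h : H1, IsH10 h ∧ h ≠ 0 ∧
    r = secondVariation θ lam Q (0, 0, h) / ∫ x, val h x ^ 2 ∂cell}

/-- `χ` is a smooth branch, defined on `(0, L)` with `L` possibly infinite, of eigenvalue exchange
solutions. -/
def IsEEBranch (θ : ℝ) (L : EReal) (χ : ℝ → Config) : Prop :=
  ContDiffOn ℝ ∞ χ {lam : ℝ | 0 < lam ∧ (lam : EReal) < L} ∧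
  ∀ lam : ℝ, 0 < lam → (lam : EReal) < L → IsCriticalPoint θ lam (χ lam) ∧ IsEE (χ lam)

/-- The maximal length `λ_*` of a smooth branch of eigenvalue exchange solutions, starting from
`λ = 0`, along which the first symmetry-preserving eigenvalue stays positive. -/
def lambdaStar (θ : ℝ) : EReal :=
  sSup {L : EReal | ∃ χ : ℝ → Config, IsEEBranch θ L χ ∧
    ∀ lam : ℝ, 0 < lam → (lam : EReal) < L → 0 < nu θ lam (χ lam)}

/-- `u` is (a.e. equal to) a classical solution on `[-1, 1]` of
`u'' / λ² = (u² - 4) u`, `u(-1) = 2`, `u(1) = -2`. -/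
def SolvesScalarBVP (lam : ℝ) (u : H1) : Prop :=
  ∃ y y' y'' : ℝ → ℝ, val u =ᵐ[cell] y ∧
    (∀ x ∈ Icc (-1 : ℝ) 1, HasDerivWithinAt y (y' x) (Icc (-1) 1) x) ∧
    (∀ x ∈ Icc (-1 : ℝ) 1, HasDerivWithinAt y' (y'' x) (Icc (-1) 1) x) ∧
    (∀ x ∈ Icc (-1 : ℝ) 1, 1 / lam ^ 2 * y'' x = (y x ^ 2 - 4) * y x) ∧
    y (-1) = 2 ∧ y 1 = -2

end Nematic

end

/-!
# The branch of eigenvalue exchange solutions at `θ = -8`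

At `θ = -8` the bulk force in the direction of `q₁` vanishes at `q₁ = 2/3`, `q₃ = 0`, whatever the
value of `q₂`. Hence `(2/3, y, 0)` is a critical point exactly when `y'' = λ² (y² - 4) y`
(`isCriticalPoint_scalar`). The decreasing solution is `y = -2 u`, where `u` increases from `-1` to
`1` and has a first integral `c`: `u'² = 2 λ² ((1 - u²)² + c)`. The travel time between the two end
points fixes `c = firstIntegral λ`, which is a decreasing function of `λ` with negative derivative.
At these configurations the second variation is diagonal.

*Symmetry breaking.* The second variation in the direction of `q₃` is
`∫ (2/λ²) h'² + 8 (u² - 1) h²`. Taking the value `v = u(x)` as the new coordinate and substituting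
`h = √u' g(u)`, one finds that its lowest eigenvalue is `4 E(c) - 4`, where `E(c) = ampEig c` is the
lowest eigenvalue of `∫ ((1 - v²)² + c) g'² - c v² / ((1 - v²)² + c) g²` (`IsProfile.lowest_eq`). So
`λ` enters only through `c`. A Riccati (Hardy type) inequality shows that this form grows at least
at rate `1/2` in `c` (`ampForm_mono`). In one dimension the lowest eigenvalue is simple, so that
first-order perturbation theory gives its differentiability (`exists_hasDerivAt_lowest`), and
`μ' = 4 E'(c) c'(λ) < 0` follows. By monotonicity `μ` has a limit, which is finite because the
potential is bounded below, and negative because `E(1/10) < 1` by a trial function. The Poincaré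
inequality makes `μ` positive for small `λ`, whence a unique zero.

*Symmetry preservation.* The function `u'` is a positive solution of the linearized scalar equation,
and the Riccati inequality for a perturbation of `-u''/u'` has a gap (`IsProfile.exists_gap`). This
gives `ν > 0`, the invertibility of the linearization (by the Lax–Milgram theorem), the smoothness of
the branch (by the implicit function theorem, `contDiffAt_branchDer`), and the local uniqueness of
eigenvalue exchange solutions (`eventuallyEq_branch`).

*Uniqueness.* The bulk gradient is one-sided Lipschitz, so for small `λ` the Dirichlet energy
dominates and there is only one critical point (`eq_branch_of_small`). Local uniqueness continues
the coincidence of two branches from small parameters to the whole interval.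

Elements of `H¹(-1, 1)` are handled through their derivatives: `prim f` is the primitive of `f`
vanishing at `-1`, and `H¹₀(-1, 1)` is the image of the mean-zero functions `Y`.
-/

noncomputable section

namespace Nematic

/-! ### Integrals over the cell and primitives of square-integrable functions -/

lemma integral_cell (F : ℝ → ℝ) : ∫ x, F x ∂cell = ∫ x in (-1 : ℝ)..1, F x := by
  rw [intervalIntegral.integral_of_le (by norm_num), integral_Ioc_eq_integral_Ioo]

lemma ae_cell {p : ℝ → Prop} (h : ∀ x ∈ Ioo (-1 : ℝ) 1, p x) : ∀ᵐ x ∂cell, p x :=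
  (ae_restrict_iff' measurableSet_Ioo).2 (ae_of_all _ h)

lemma cell_univ : cell univ = 2 := by
  rw [Measure.restrict_apply_univ, Real.volume_Ioo]; norm_num

lemma aestronglyMeasurable_cell {α : ℝ → ℝ} (hα : ContinuousOn α (Icc (-1) 1)) :
    AEStronglyMeasurable α cell :=
  (hα.mono Ioo_subset_Icc_self).aestronglyMeasurable measurableSet_Ioo

lemma exists_bound_cell {α : ℝ → ℝ} (hα : ContinuousOn α (Icc (-1) 1)) :
    ∃ C, 0 < C ∧ ∀ x ∈ Icc (-1 : ℝ) 1, |α x| ≤ C := by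
  obtain ⟨C, hC⟩ := isCompact_Icc.exists_bound_of_continuousOn hα
  exact ⟨max C 1, by positivity, fun x hx => (hC x hx).trans (le_max_left _ _)⟩

lemma memLp_cell {α : ℝ → ℝ} (hα : ContinuousOn α (Icc (-1) 1)) (p : ENNReal) :
    MemLp α p cell := by
  obtain ⟨C, -, hC⟩ := exists_bound_cell hα
  exact MemLp.of_bound (aestronglyMeasurable_cell hα) C
    (ae_cell fun x hx => hC x (Ioo_subset_Icc_self hx))

lemma integrable_cell {α : ℝ → ℝ} (hα : ContinuousOn α (Icc (-1) 1)) : Integrable α cell :=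
  memLp_one_iff_integrable.1 (memLp_cell hα 1)

lemma integrable_coe (f : L2) : Integrable f cell := (Lp.memLp f).integrable (by norm_num)

lemma integrable_mul_coe (f g : L2) : Integrable (fun x => f x * g x) cell :=
  (Lp.memLp f).integrable_mul (Lp.memLp g)

lemma integrable_cont_mul {α F : ℝ → ℝ} (hα : ContinuousOn α (Icc (-1) 1))
    (hF : Integrable F cell) : Integrable (fun x => α x * F x) cell := by
  obtain ⟨C, -, hC⟩ := exists_bound_cell hα
  exact hF.bdd_mul (aestronglyMeasurable_cell hα)
    (ae_cell fun x hx => hC x (Ioo_subset_Icc_self hx))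

lemma norm_sq_eq (f : L2) : ‖f‖ ^ 2 = ∫ x, f x ^ 2 ∂cell := by
  rw [← real_inner_self_eq_norm_sq, L2.inner_def]
  simp [sq]

lemma inner_eq (f g : L2) : inner ℝ f g = ∫ x, f x * g x ∂cell := by
  rw [L2.inner_def]; simp [mul_comm]

/-- The class in `L²(-1, 1)` of a function that is continuous on `[-1, 1]`. -/
def ofCont (α : ℝ → ℝ) (hα : ContinuousOn α (Icc (-1) 1)) : L2 := (memLp_cell hα 2).toLp α

lemma coe_ofCont {α : ℝ → ℝ} (hα : ContinuousOn α (Icc (-1) 1)) : ofCont α hα =ᵐ[cell] α :=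
  MemLp.coeFn_toLp _

lemma abs_setIntegral_le (f : L2) {s : Set ℝ} (hs : MeasurableSet s) :
    |∫ x in s, f x ∂cell| ≤ √(cell.real s) * ‖f‖ := by
  have hs' : cell s ≠ ⊤ := measure_ne_top _ _
  rw [← L2.inner_indicatorConstLp_one (𝕜 := ℝ) hs hs' f]
  refine (abs_real_inner_le_norm _ _).trans ?_
  gcongr
  rw [norm_indicatorConstLp (by norm_num) (by norm_num), Real.sqrt_eq_rpow]
  simp

/-- The primitive of `f` vanishing at `-1`. Since `f` is integrated against the Lebesgue measure
of the cell, it is defined on the whole line and constant outside `(-1, 1)`. -/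
def primFun (f : L2) (x : ℝ) : ℝ := ∫ t in Iic x, f t ∂cell

lemma cell_real_le (s : Set ℝ) : cell.real s ≤ 2 := by
  have : cell.real s ≤ cell.real univ := measureReal_mono (subset_univ _)
  rwa [show cell.real univ = 2 by rw [Measure.real, cell_univ]; norm_num] at this

lemma abs_primFun_le (f : L2) (x : ℝ) : |primFun f x| ≤ √2 * ‖f‖ := by
  refine (abs_setIntegral_le f measurableSet_Iic).trans ?_
  gcongr
  exact cell_real_le _

lemma abs_primFun_sub_le (f : L2) (x y : ℝ) :
    |primFun f x - primFun f y| ≤ √|x - y| * ‖f‖ := by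
  wlog h : y ≤ x generalizing x y
  · rw [abs_sub_comm, abs_sub_comm x]; exact this y x (le_of_not_ge h)
  have : primFun f x - primFun f y = ∫ t in Ioc y x, f t ∂cell := by
    rw [primFun, primFun, intervalIntegral.integral_Iic_sub_Iic (integrable_coe f).integrableOn
      (integrable_coe f).integrableOn, intervalIntegral.integral_of_le h]
  rw [this]
  refine (abs_setIntegral_le f measurableSet_Ioc).trans ?_
  gcongr
  have h1 : cell.real (Ioc y x) ≤ volume.real (Ioc y x) :=
    ENNReal.toReal_mono (by simp) (Measure.restrict_apply_le _ _)
  rw [Real.volume_real_Ioc_of_le h] at h1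
  exact h1.trans (le_abs_self _)

lemma continuous_primFun (f : L2) : Continuous (primFun f) := by
  rw [continuous_iff_continuousAt]
  intro y
  rw [ContinuousAt, tendsto_iff_norm_sub_tendsto_zero]
  have h : Tendsto (fun x => √|x - y| * ‖f‖) (𝓝 y) (𝓝 0) := by
    have : Continuous fun x => √|x - y| * ‖f‖ := by fun_prop
    simpa using this.tendsto y
  exact squeeze_zero (fun _ => norm_nonneg _) (fun x => abs_primFun_sub_le f x y) h

/-- The primitive vanishing at `-1`, as a bounded operator from `L²(-1, 1)` to bounded continuous
functions. -/
def prim : L2 →L[ℝ] BoundedContinuousFunction ℝ ℝ :=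
  LinearMap.mkContinuous
    { toFun := fun f => BoundedContinuousFunction.ofNormedAddCommGroup (primFun f)
        (continuous_primFun f) (√2 * ‖f‖) (abs_primFun_le f)
      map_add' := by
        intro f g
        ext x
        simp only [BoundedContinuousFunction.coe_ofNormedAddCommGroup,
          BoundedContinuousFunction.coe_add, Pi.add_apply, primFun]
        rw [← integral_add (integrable_coe f).integrableOn (integrable_coe g).integrableOn]
        refine integral_congr_ae (ae_restrict_of_ae ?_)
        filter_upwards [Lp.coeFn_add f g] with t ht
        rw [ht, Pi.add_apply]
      map_smul' := by
        intro c f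
        ext x
        simp only [BoundedContinuousFunction.coe_ofNormedAddCommGroup,
          BoundedContinuousFunction.coe_smul, primFun, RingHom.id_apply]
        rw [smul_eq_mul, ← integral_const_mul]
        refine integral_congr_ae (ae_restrict_of_ae ?_)
        filter_upwards [Lp.coeFn_smul c f] with t ht
        rw [ht, Pi.smul_apply, smul_eq_mul] } (√2)
    (fun f => BoundedContinuousFunction.norm_ofNormedAddCommGroup_le _ (by positivity)
      (abs_primFun_le f))

lemma prim_apply (f : L2) (x : ℝ) : prim f x = ∫ t in Iic x, f t ∂cell := rfl

lemma abs_prim_le (f : L2) (x : ℝ) : |prim f x| ≤ √2 * ‖f‖ := abs_primFun_le f x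

lemma prim_sq_le (f : L2) (x : ℝ) : prim f x ^ 2 ≤ 2 * ‖f‖ ^ 2 := by
  have h := abs_prim_le f x
  rw [← sq_abs]
  calc |prim f x| ^ 2 ≤ (√2 * ‖f‖) ^ 2 := by gcongr
    _ = 2 * ‖f‖ ^ 2 := by rw [mul_pow, Real.sq_sqrt (by norm_num)]

lemma prim_eq_interval (f : L2) {x : ℝ} (hx : x ∈ Icc (-1 : ℝ) 1) :
    prim f x = ∫ t in (-1 : ℝ)..x, f t := by
  rw [prim_apply, intervalIntegral.integral_of_le hx.1, Measure.restrict_restrict measurableSet_Iic]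
  rcases hx.2.lt_or_eq with h | h
  · congr 2
    ext t
    simp only [mem_inter_iff, mem_Iic, mem_Ioo, mem_Ioc]
    constructor
    · rintro ⟨a, b, c⟩; exact ⟨b, a⟩
    · rintro ⟨a, b⟩; exact ⟨b, a, by linarith⟩
  · rw [integral_Ioc_eq_integral_Ioo, h]
    congr 2
    ext t
    simp only [mem_inter_iff, mem_Iic, mem_Ioo]
    constructor
    · rintro ⟨a, b, c⟩; exact ⟨b, c⟩
    · rintro ⟨a, b⟩; exact ⟨b.le, a, b⟩

lemma prim_neg_one (f : L2) : prim f (-1) = 0 := by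
  rw [prim_eq_interval f (by norm_num), intervalIntegral.integral_same]

lemma prim_one (f : L2) : prim f 1 = ∫ x, f x ∂cell := by
  rw [prim_eq_interval f (by norm_num), integral_cell]

/-- `g` is continuous on `[-1, 1]` and has the derivative `g'` inside, where `g'` is continuous up to
the end points. -/
structure IsC1 (g g' : ℝ → ℝ) : Prop where
  cont : ContinuousOn g (Icc (-1) 1)
  cont' : ContinuousOn g' (Icc (-1) 1)
  deriv : ∀ x ∈ Ioo (-1 : ℝ) 1, HasDerivAt g (g' x) x

lemma integral_coe_congr {f : L2} {α : ℝ → ℝ} (h : f =ᵐ[cell] α) {x : ℝ}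
    (hx : x ∈ Icc (-1 : ℝ) 1) : prim f x = ∫ t in (-1 : ℝ)..x, α t := by
  rw [prim_eq_interval f hx, intervalIntegral.integral_of_le hx.1,
    intervalIntegral.integral_of_le hx.1, integral_Ioc_eq_integral_Ioo,
    integral_Ioc_eq_integral_Ioo]
  exact integral_congr_ae (ae_restrict_of_ae_restrict_of_subset
    (Ioo_subset_Ioo_right hx.2) h)

lemma IsC1.prim_eq {g g' : ℝ → ℝ} (h : IsC1 g g') {f : L2} (hf : f =ᵐ[cell] g') {x : ℝ}
    (hx : x ∈ Icc (-1 : ℝ) 1) : prim f x = g x - g (-1) := by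
  have hs : Icc (-1) x ⊆ Icc (-1 : ℝ) 1 := Icc_subset_Icc_right hx.2
  rw [integral_coe_congr hf hx]
  refine intervalIntegral.integral_eq_sub_of_hasDerivAt_of_le hx.1 (h.cont.mono hs)
    (fun y hy => h.deriv y ⟨hy.1, hy.2.trans_le hx.2⟩) ?_
  exact (h.cont'.mono hs).intervalIntegrable_of_Icc hx.1

/-- A continuous representative makes the primitive continuously differentiable. -/
lemma isC1_prim {f : L2} {α : ℝ → ℝ} (hα : ContinuousOn α (Icc (-1) 1)) (h : f =ᵐ[cell] α) :
    IsC1 (prim f) α where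
  cont := (prim f).continuous.continuousOn
  cont' := hα
  deriv := by
    intro x hx
    have hmem : Icc (-1 : ℝ) 1 ∈ 𝓝 x := Icc_mem_nhds hx.1 hx.2
    have h1 : HasDerivAt (fun y => ∫ t in (-1 : ℝ)..y, α t) (α x) x := by
      refine intervalIntegral.integral_hasDerivAt_right ?_ ?_ (hα.continuousAt hmem)
      · exact (hα.mono (Icc_subset_Icc_right hx.2.le)).intervalIntegrable_of_Icc hx.1.le
      · exact ⟨_, hmem, hα.aestronglyMeasurable measurableSet_Icc⟩
    refine h1.congr_of_eventuallyEq ?_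
    filter_upwards [hmem] with y hy using integral_coe_congr h hy

lemma denseRange_toLp :
    DenseRange (BoundedContinuousFunction.toLp (E := ℝ) (α := ℝ) 2 cell ℝ) :=
  BoundedContinuousFunction.toLp_denseRange ℝ cell ℝ (by norm_num)

/-- A closed property of `L²` functions holds as soon as it holds for those with a continuous
representative. -/
lemma induction_cont {p : L2 → Prop} (hp : IsClosed {f | p f})
    (h : ∀ (f : L2) (α : ℝ → ℝ), ContinuousOn α (Icc (-1) 1) → f =ᵐ[cell] α → p f) (f : L2) :
    p f :=
  denseRange_toLp.induction_on f hp fun φ =>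
    h _ φ φ.continuous.continuousOn (BoundedContinuousFunction.coeFn_toLp 2 cell ℝ φ)

lemma continuous_integral_mul {α : ℝ → ℝ} (hα : ContinuousOn α (Icc (-1) 1)) :
    Continuous fun f : L2 => ∫ x, α x * f x ∂cell := by
  have : (fun f : L2 => ∫ x, α x * f x ∂cell) = fun f => inner ℝ (ofCont α hα) f := by
    ext f
    rw [inner_eq]
    refine integral_congr_ae ?_
    filter_upwards [coe_ofCont hα] with x hx
    rw [hx]
  rw [this]; fun_prop

/-- The primitive as an operator on `L²(-1, 1)`. -/
def primL : L2 →L[ℝ] L2 := (BoundedContinuousFunction.toLp (E := ℝ) 2 cell ℝ).comp prim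

lemma coe_primL (f : L2) : primL f =ᵐ[cell] prim f :=
  BoundedContinuousFunction.coeFn_toLp 2 cell ℝ _

/-- Integration by parts against a primitive of a square-integrable function. -/
lemma integral_by_parts {G G' : ℝ → ℝ} (hG : IsC1 G G') (f : L2) :
    ∫ x, G x * f x ∂cell + ∫ x, G' x * prim f x ∂cell = G 1 * prim f 1 := by
  revert f
  apply induction_cont
  · have h1 := continuous_integral_mul hG.cont
    have h2 : Continuous fun f : L2 => ∫ x, G' x * prim f x ∂cell := by
      have : (fun f : L2 => ∫ x, G' x * prim f x ∂cell)
          = fun f => ∫ x, G' x * primL f x ∂cell := by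
        ext f
        refine integral_congr_ae ?_
        filter_upwards [coe_primL f] with x hx
        rw [hx]
      rw [this]
      exact (continuous_integral_mul hG.cont').comp primL.continuous
    have h3 : Continuous fun f : L2 => prim f 1 :=
      (BoundedContinuousFunction.evalCLM ℝ (1 : ℝ)).continuous.comp prim.continuous
    exact isClosed_eq (h1.add h2) (continuous_const.mul h3)
  · intro f α hα hf
    have hP := isC1_prim hα hf
    have e1 : ∫ x, G x * f x ∂cell = ∫ x, G x * α x ∂cell := by
      refine integral_congr_ae ?_
      filter_upwards [hf] with x hx
      rw [hx]
    have i1 : Integrable (fun x => G x * α x) cell := integrable_cell (hG.cont.mul hα)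
    have i2 : Integrable (fun x => G' x * prim f x) cell := integrable_cell (hG.cont'.mul hP.cont)
    rw [e1, ← integral_add i1 i2, integral_cell]
    have := intervalIntegral.integral_deriv_mul_eq_sub_of_hasDerivAt (a := -1) (b := 1)
      (u := G) (v := prim f) (u' := G') (v' := α)
      (by rw [uIcc_of_le (by norm_num)]; exact hG.cont)
      (by rw [uIcc_of_le (by norm_num)]; exact hP.cont)
      (by simpa using hG.deriv) (by simpa using hP.deriv)
      (hG.cont'.intervalIntegrable_of_Icc (by norm_num))
      (hα.intervalIntegrable_of_Icc (by norm_num))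
    rw [prim_neg_one, mul_zero, sub_zero] at this
    rw [← this]
    refine intervalIntegral.integral_congr fun x _ => ?_
    ring

/-! ### The structure of `H¹(-1, 1)` -/

lemma isWeakDeriv_primL (f : L2) : IsWeakDeriv (primL f) f := by
  intro φ h1 h2 h3
  have hd : Continuous (deriv φ) := h1.continuous_deriv (by simp)
  have hφ : IsC1 φ (deriv φ) :=
    ⟨h1.continuous.continuousOn, hd.continuousOn, fun x _ =>
      (h1.differentiable (by simp)).differentiableAt.hasDerivAt⟩
  have h0 : φ 1 = 0 := by
    refine image_eq_zero_of_notMem_tsupport fun h => ?_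
    have := (h3 h).2
    exact lt_irrefl _ this
  have h := integral_by_parts hφ f
  rw [h0, zero_mul] at h
  have e1 : ∫ x, primL f x * deriv φ x ∂cell = ∫ x, deriv φ x * prim f x ∂cell := by
    refine integral_congr_ae ?_
    filter_upwards [coe_primL f] with x hx
    rw [hx, mul_comm]
  have e2 : ∫ x, f x * φ x ∂cell = ∫ x, φ x * f x ∂cell := by simp only [mul_comm]
  rw [e1, e2]
  linarith

lemma integral_cell_eq_of_tsupport {φ : ℝ → ℝ} (h : tsupport φ ⊆ Ioo (-1) 1) :
    ∫ x, φ x ∂cell = ∫ x, φ x :=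
  setIntegral_eq_integral_of_forall_compl_eq_zero fun _ hx =>
    image_eq_zero_of_notMem_tsupport fun h' => hx (h h')

/-- A test function with vanishing integral is the derivative of a test function. -/
lemma exists_deriv_eq {ψ : ℝ → ℝ} (h1 : ContDiff ℝ ∞ ψ) (h2 : HasCompactSupport ψ)
    (h3 : tsupport ψ ⊆ Ioo (-1) 1) (h4 : ∫ x, ψ x = 0) :
    ∃ φ : ℝ → ℝ, ContDiff ℝ ∞ φ ∧ HasCompactSupport φ ∧ tsupport φ ⊆ Ioo (-1) 1 ∧
      deriv φ = ψ := by
  obtain ⟨a, b, ha, hb, hab⟩ : ∃ a b : ℝ, -1 < a ∧ b < 1 ∧ tsupport ψ ⊆ Icc a b := by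
    rcases (tsupport ψ).eq_empty_or_nonempty with he | hne
    · exact ⟨0, 0, by norm_num, by norm_num, by simp [he]⟩
    · obtain ⟨a, ha, ha'⟩ := h2.isCompact.exists_isMinOn hne continuousOn_id
      obtain ⟨b, hb, hb'⟩ := h2.isCompact.exists_isMaxOn hne continuousOn_id
      exact ⟨a, b, (h3 ha).1, (h3 hb).2, fun x hx => ⟨ha' hx, hb' hx⟩⟩
  have hz : ∀ x ∉ Icc a b, ψ x = 0 := fun x hx =>
    image_eq_zero_of_notMem_tsupport fun h => hx (hab h)
  have hint : Integrable ψ := h1.continuous.integrable_of_hasCompactSupport h2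
  set φ : ℝ → ℝ := fun x => ∫ t in Iic x, ψ t with hφ
  have hd : ∀ x, HasDerivAt φ (ψ x) x := by
    intro x
    have e : φ = fun y => (∫ t in Iic (0 : ℝ), ψ t) + ∫ t in (0 : ℝ)..y, ψ t := by
      ext y
      rw [← intervalIntegral.integral_Iic_sub_Iic hint.integrableOn hint.integrableOn]
      simp [hφ]
    rw [e]
    exact (intervalIntegral.integral_hasDerivAt_right hint.intervalIntegrable
      h1.continuous.stronglyMeasurable.stronglyMeasurableAtFilter
      h1.continuous.continuousAt).const_add _
  have hderiv : deriv φ = ψ := funext fun x => (hd x).deriv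
  have hφz : ∀ x ∉ Icc a b, φ x = 0 := by
    intro x hx
    rcases lt_or_ge x a with hxa | hxa
    · refine setIntegral_eq_zero_of_forall_eq_zero fun t ht => hz t fun h => ?_
      have := h.1; have : t ≤ x := ht; linarith
    · have hxb : b < x := by
        by_contra h; exact hx ⟨hxa, not_lt.1 h⟩
      rw [← h4]
      refine setIntegral_eq_integral_of_forall_compl_eq_zero fun t ht => hz t fun h => ?_
      have := h.2; have : ¬ t ≤ x := ht; linarith
  have hsub : tsupport φ ⊆ Icc a b :=
    closure_minimal (fun x hx => by by_contra h; exact hx (hφz x h)) isClosed_Icc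
  refine ⟨φ, ?_, HasCompactSupport.of_support_subset_isCompact isCompact_Icc
    ((subset_tsupport φ).trans hsub), hsub.trans fun x hx => ⟨by linarith [hx.1],
      by linarith [hx.2]⟩, hderiv⟩
  rw [contDiff_infty_iff_deriv]
  exact ⟨fun x => (hd x).differentiableAt, hderiv ▸ h1⟩

/-- A function on the cell whose weak derivative vanishes is constant. -/
lemma ae_const_of_weakDeriv_zero {w : ℝ → ℝ} (hw : Integrable w cell)
    (h : ∀ φ : ℝ → ℝ, ContDiff ℝ ∞ φ → HasCompactSupport φ → tsupport φ ⊆ Ioo (-1) 1 →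
      ∫ x, w x * deriv φ x ∂cell = 0) : ∃ C : ℝ, ∀ᵐ x ∂cell, w x = C := by
  let η : ContDiffBump (0 : ℝ) := ⟨1 / 4, 1 / 2, by norm_num, by norm_num⟩
  set e : ℝ → ℝ := η.normed volume with he
  have he1 : ContDiff ℝ ∞ e := η.contDiff_normed
  have he2 : HasCompactSupport e := η.hasCompactSupport_normed
  have he3 : tsupport e ⊆ Ioo (-1) 1 := by
    rw [he, η.tsupport_normed_eq, Real.closedBall_eq_Icc]
    intro x hx
    have h1 := hx.1; have h2 := hx.2
    simp only [η] at h1 h2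
    constructor <;> linarith
  have he4 : ∫ x, e x = 1 := η.integral_normed
  have imul : ∀ φ : ℝ → ℝ, Continuous φ → Integrable (fun x => w x * φ x) cell := by
    intro φ hφ
    simpa only [mul_comm] using integrable_cont_mul hφ.continuousOn hw
  refine ⟨∫ x, w x * e x ∂cell, ?_⟩
  set C := ∫ x, w x * e x ∂cell with hC
  have key : ∀ᵐ x ∂cell, x ∈ Ioo (-1 : ℝ) 1 → w x - C = 0 := by
    have hloc : Integrable (fun x => w x - C) cell := hw.sub (integrable_const C)
    refine IsOpen.ae_eq_zero_of_integral_contDiff_smul_eq_zero isOpen_Ioo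
      (hloc.locallyIntegrable.locallyIntegrableOn _) ?_
    intro ψ h1 h2 h3
    set m := ∫ x, ψ x with hm
    have c1 : ContDiff ℝ ∞ (fun x => ψ x - m * e x) := h1.sub (contDiff_const.mul he1)
    have hsupp : tsupport (fun x => ψ x - m * e x) ⊆ tsupport ψ ∪ tsupport e := by
      refine closure_minimal (fun x hx => ?_)
        ((isClosed_tsupport _).union (isClosed_tsupport _))
      by_contra hn
      rw [mem_union, not_or] at hn
      apply hx
      simp [image_eq_zero_of_notMem_tsupport hn.1, image_eq_zero_of_notMem_tsupport hn.2]
    have c2 : HasCompactSupport (fun x => ψ x - m * e x) :=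
      HasCompactSupport.of_support_subset_isCompact (h2.isCompact.union he2.isCompact)
        ((subset_tsupport _).trans hsupp)
    have c4 : ∫ x, (ψ x - m * e x) = 0 := by
      rw [integral_sub (h1.continuous.integrable_of_hasCompactSupport h2)
        ((he1.continuous.integrable_of_hasCompactSupport he2).const_mul m),
        integral_const_mul, he4, hm]
      ring
    obtain ⟨φ, p1, p2, p3, p4⟩ := exists_deriv_eq c1 c2
      (hsupp.trans (union_subset h3 he3)) c4
    have hφ := h φ p1 p2 p3
    rw [p4] at hφ
    have e1 : ∫ x, w x * (ψ x - m * e x) ∂cell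
        = ∫ x, w x * ψ x ∂cell - m * C := by
      rw [hC, ← integral_const_mul, ← integral_sub (imul ψ h1.continuous)
        ((imul e he1.continuous).const_mul m)]
      refine integral_congr_ae (ae_of_all _ fun x => ?_)
      ring
    have e2 : ∫ x, ψ x • (w x - C) ∂cell = ∫ x, w x * ψ x ∂cell - m * C := by
      rw [hm, ← integral_cell_eq_of_tsupport h3, mul_comm _ C, ← integral_const_mul,
        ← integral_sub (imul ψ h1.continuous)
        ((integrable_cell h1.continuous.continuousOn).const_mul C)]
      refine integral_congr_ae (ae_of_all _ fun x => ?_)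
      simp only [smul_eq_mul]; ring
    rw [e2, ← e1, hφ]
  filter_upwards [key, ae_restrict_mem measurableSet_Ioo] with x hx hx'
  linarith [hx hx']

/-- The constant function `1` in `H¹(-1, 1)`. -/
def oneH : H1 := ⟨WithLp.toLp 2 (ofCont (fun _ => 1) continuousOn_const, 0), by
  intro φ h1 h2 h3
  have hd : Continuous (deriv φ) := h1.continuous_deriv (by simp)
  have h0 : ∀ x : ℝ, x ∉ Ioo (-1 : ℝ) 1 → φ x = 0 := fun x hx =>
    image_eq_zero_of_notMem_tsupport fun h => hx (h3 h)
  have e1 : ∫ x, ofCont (fun _ => 1) continuousOn_const x * deriv φ x ∂cell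
      = ∫ x, deriv φ x ∂cell := by
    refine integral_congr_ae ?_
    filter_upwards [coe_ofCont (α := fun _ => 1) continuousOn_const] with x hx
    rw [hx, one_mul]
  have e2 : ∫ x, (0 : L2) x * φ x ∂cell = 0 := by
    refine integral_eq_zero_of_ae ?_
    filter_upwards [Lp.coeFn_zero ℝ 2 cell] with x hx
    simp only [hx, Pi.zero_apply, zero_mul]
  have e3 : ∫ x, deriv φ x ∂cell = 0 := by
    rw [integral_cell, intervalIntegral.integral_deriv_eq_sub
      (fun x _ => (h1.differentiable (by simp)).differentiableAt)
      (hd.intervalIntegrable _ _), h0 1 (by simp), h0 (-1) (by simp), sub_zero]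
  change ∫ x, ofCont (fun _ => 1) continuousOn_const x * deriv φ x ∂cell
    = -∫ x, (0 : L2) x * φ x ∂cell
  rw [e1, e2, e3, neg_zero]⟩

/-- The primitive vanishing at `-1`, as a bounded operator from `L²(-1, 1)` to `H¹(-1, 1)`. -/
def primH : L2 →L[ℝ] H1 :=
  (((WithLp.prodContinuousLinearEquiv 2 ℝ L2 L2).symm : L2 × L2 →L[ℝ] WithLp 2 (L2 × L2)).comp
    (primL.prod (ContinuousLinearMap.id ℝ L2))).codRestrict H1 isWeakDeriv_primL

lemma val_primH (f : L2) : val (primH f) =ᵐ[cell] prim f := coe_primL f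

lemma der_primH (f : L2) : der (primH f) = f := rfl

lemma val_add (u v : H1) : val (u + v) =ᵐ[cell] fun x => val u x + val v x :=
  Lp.coeFn_add u.1.fst v.1.fst

lemma der_add (u v : H1) : der (u + v) =ᵐ[cell] fun x => der u x + der v x :=
  Lp.coeFn_add u.1.snd v.1.snd

lemma val_smul (c : ℝ) (u : H1) : val (c • u) =ᵐ[cell] fun x => c * val u x :=
  Lp.coeFn_smul c u.1.fst

lemma der_smul (c : ℝ) (u : H1) : der (c • u) =ᵐ[cell] fun x => c * der u x :=
  Lp.coeFn_smul c u.1.snd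

lemma val_oneH : val oneH =ᵐ[cell] fun _ => 1 := coe_ofCont continuousOn_const

lemma der_oneH : der oneH =ᵐ[cell] fun _ => 0 := Lp.coeFn_zero ℝ 2 cell

/-- The element `a + ∫₋₁ˣ f` of `H¹(-1, 1)`. -/
def mkH (a : ℝ) (f : L2) : H1 := a • oneH + primH f

lemma val_mkH (a : ℝ) (f : L2) : val (mkH a f) =ᵐ[cell] fun x => a + prim f x := by
  filter_upwards [val_add (a • oneH) (primH f), val_smul a oneH, val_oneH, val_primH f]
    with x h1 h2 h3 h4
  rw [mkH, h1, h2, h3, h4, mul_one]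

lemma der_mkH (a : ℝ) (f : L2) : der (mkH a f) =ᵐ[cell] f := by
  filter_upwards [der_add (a • oneH) (primH f), der_smul a oneH, der_oneH] with x h1 h2 h3
  rw [mkH, h1, h2, h3, mul_zero, zero_add, der_primH]

lemma H1.ext' {u v : H1} (h1 : val u =ᵐ[cell] val v) (h2 : der u =ᵐ[cell] der v) : u = v := by
  have e1 : u.1.fst = v.1.fst := Lp.ext h1
  have e2 : u.1.snd = v.1.snd := Lp.ext h2
  exact Subtype.ext (WithLp.ofLp_injective 2 (Prod.ext e1 e2))

/-- Every element of `H¹(-1, 1)` is, up to a constant, the primitive of its derivative. -/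
lemma exists_eq_mkH (u : H1) : ∃ a, u = mkH a u.1.snd := by
  set f : L2 := u.1.snd
  have hI : Integrable (fun x => val u x - prim f x) cell :=
    (integrable_coe u.1.fst).sub (integrable_cell (prim f).continuous.continuousOn)
  obtain ⟨a, ha⟩ := ae_const_of_weakDeriv_zero hI (by
    intro φ h1 h2 h3
    have hd : Continuous (deriv φ) := h1.continuous_deriv (by simp)
    have e1 := u.2 φ h1 h2 h3
    have e2 := isWeakDeriv_primL f φ h1 h2 h3
    have e3 : ∫ x, (val u x - prim f x) * deriv φ x ∂cell
        = ∫ x, u.1.fst x * deriv φ x ∂cell - ∫ x, primL f x * deriv φ x ∂cell := by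
      rw [← integral_sub (integrable_mul_of_continuous _ hd h2.deriv)
        (integrable_mul_of_continuous _ hd h2.deriv)]
      refine integral_congr_ae ?_
      filter_upwards [coe_primL f] with x hx
      rw [hx, sub_mul]; rfl
    rw [e3, e1, e2, sub_self])
  refine ⟨a, H1.ext' ?_ ?_⟩
  · filter_upwards [ha, val_mkH a f] with x h1 h2
    rw [h2]; linarith
  · exact (der_mkH a f).symm

lemma eqOn_Icc_of_ae {g h : ℝ → ℝ} (hg : ContinuousOn g (Icc (-1) 1))
    (hh : ContinuousOn h (Icc (-1) 1)) (e : g =ᵐ[cell] h) : EqOn g h (Icc (-1) 1) := by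
  have h1 : EqOn g h (Ioo (-1) 1) := Measure.eqOn_open_of_ae_eq e isOpen_Ioo
    (hg.mono Ioo_subset_Icc_self) (hh.mono Ioo_subset_Icc_self)
  have hc : Icc (-1 : ℝ) 1 ⊆ closure (Ioo (-1) 1) := by
    rw [closure_Ioo (by norm_num)]
  exact h1.of_subset_closure hg hh Ioo_subset_Icc_self hc

lemma hasBoundaryValues_mkH (a : ℝ) (f : L2) : HasBoundaryValues (mkH a f) a (a + prim f 1) :=
  ⟨fun x => a + prim f x, by fun_prop, val_mkH a f, by simp only [prim_neg_one, add_zero], rfl⟩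

lemma hasBoundaryValues_iff {u : H1} {a b : ℝ} :
    HasBoundaryValues u a b ↔ ∃ f : L2, prim f 1 = b - a ∧ u = mkH a f := by
  constructor
  · rintro ⟨g, hg, hu, ha, hb⟩
    obtain ⟨c, hc⟩ := exists_eq_mkH u
    set f : L2 := u.1.snd
    have he : EqOn g (fun x => c + prim f x) (Icc (-1) 1) := by
      refine eqOn_Icc_of_ae hg (by fun_prop) ?_
      filter_upwards [hu, val_mkH c f] with x h1 h2
      rw [← h1, ← h2, ← hc]
    have e1 := he (x := -1) (by norm_num)
    have e2 := he (x := 1) (by norm_num)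
    simp only [prim_neg_one, add_zero] at e1 e2
    have : c = a := by linarith
    subst this
    exact ⟨f, by linarith, hc⟩
  · rintro ⟨f, hf, rfl⟩
    have := hasBoundaryValues_mkH a f
    rwa [hf, add_sub_cancel] at this

/-- The mean-zero functions, that is, the derivatives of the elements of `H¹₀(-1, 1)`. Elements of
`H¹₀(-1, 1)` are represented by their derivatives throughout, so that `Y` with the norm of `L²` is
`H¹₀(-1, 1)` with the Dirichlet norm. -/
def Y : Submodule ℝ L2 :=
  LinearMap.ker ((BoundedContinuousFunction.evalCLM ℝ (1 : ℝ)).comp prim : L2 →ₗ[ℝ] ℝ)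

lemma mem_Y {f : L2} : f ∈ Y ↔ prim f 1 = 0 := Iff.rfl

lemma isClosed_Y : IsClosed (Y : Set L2) :=
  ContinuousLinearMap.isClosed_ker ((BoundedContinuousFunction.evalCLM ℝ (1 : ℝ)).comp prim)

instance : CompleteSpace Y := isClosed_Y.completeSpace_coe

lemma mkH_zero_left (f : L2) : mkH 0 f = primH f := by rw [mkH, zero_smul, zero_add]

lemma isH10_iff {h : H1} : IsH10 h ↔ ∃ f ∈ Y, h = primH f := by
  simp only [IsH10, hasBoundaryValues_iff, sub_zero, mkH_zero_left, mem_Y]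

lemma primH_eq_zero {f : L2} : primH f = 0 ↔ f = 0 := by
  constructor
  · intro h
    have : (primH f).1.snd = (0 : H1).1.snd := by rw [h]
    exact this
  · rintro rfl; exact map_zero _

/-! ### Quadratic forms on primitives and their lowest eigenvalue -/

lemma integrable_weight {α : ℝ → ℝ} (hα : ContinuousOn α (Icc (-1) 1)) (f g : L2) :
    Integrable (fun x => α x * (f x * g x)) cell :=
  integrable_cont_mul hα (integrable_mul_coe f g)

/-- The weighted inner product `∫ α f g`. -/
def weightForm (α : ℝ → ℝ) (hα : ContinuousOn α (Icc (-1) 1)) : L2 →L[ℝ] L2 →L[ℝ] ℝ :=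
  LinearMap.mkContinuous₂
    (LinearMap.mk₂ ℝ (fun f g : L2 => ∫ x, α x * (f x * g x) ∂cell)
      (by
        intro f f' g
        rw [← integral_add (integrable_weight hα f g) (integrable_weight hα f' g)]
        refine integral_congr_ae ?_
        filter_upwards [Lp.coeFn_add f f'] with x hx
        rw [hx, Pi.add_apply]; ring)
      (by
        intro c f g
        rw [smul_eq_mul, ← integral_const_mul]
        refine integral_congr_ae ?_
        filter_upwards [Lp.coeFn_smul c f] with x hx
        rw [hx, Pi.smul_apply, smul_eq_mul]; ring)
      (by
        intro f g g'
        rw [← integral_add (integrable_weight hα f g) (integrable_weight hα f g')]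
        refine integral_congr_ae ?_
        filter_upwards [Lp.coeFn_add g g'] with x hx
        rw [hx, Pi.add_apply]; ring)
      (by
        intro c f g
        rw [smul_eq_mul, ← integral_const_mul]
        refine integral_congr_ae ?_
        filter_upwards [Lp.coeFn_smul c g] with x hx
        rw [hx, Pi.smul_apply, smul_eq_mul]; ring))
    (Classical.choose (exists_bound_cell hα)) (by
      intro f g
      obtain ⟨hC0, hC⟩ := Classical.choose_spec (exists_bound_cell hα)
      set C := Classical.choose (exists_bound_cell hα)
      simp only [LinearMap.mk₂_apply]
      have h1 : ‖∫ x, α x * (f x * g x) ∂cell‖ ≤ ∫ x, C * (|f x| * |g x|) ∂cell := by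
        refine norm_integral_le_of_norm_le ?_ (ae_cell fun x hx => ?_)
        · refine Integrable.const_mul ?_ C
          simpa only [abs_mul] using (integrable_mul_coe f g).abs
        · rw [Real.norm_eq_abs, abs_mul, abs_mul]
          gcongr
          exact hC x (Ioo_subset_Icc_self hx)
      have h2 : ∫ x, |f x| * |g x| ∂cell ≤ ‖f‖ * ‖g‖ := by
        have := real_inner_le_norm (|f|) (|g|)
        rw [inner_eq, norm_abs_eq_norm, norm_abs_eq_norm] at this
        refine le_trans (le_of_eq ?_) this
        refine integral_congr_ae ?_
        filter_upwards [Lp.coeFn_abs f, Lp.coeFn_abs g] with x h1 h2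
        rw [h1, h2]
      rw [integral_const_mul] at h1
      calc _ ≤ _ := h1
        _ ≤ C * (‖f‖ * ‖g‖) := by gcongr
        _ = _ := by ring)

/-- The bilinear form `∫ (α u' v' + β u v)` in terms of the derivatives `f = u'` and `g = v'` of
functions vanishing at `-1`. -/
def form (α β : ℝ → ℝ) (hα : ContinuousOn α (Icc (-1) 1)) (hβ : ContinuousOn β (Icc (-1) 1)) :
    L2 →L[ℝ] L2 →L[ℝ] ℝ :=
  weightForm α hα + (weightForm β hβ).bilinearComp primL primL

section form

lemma integrable_weight_prim {β : ℝ → ℝ} (hβ : ContinuousOn β (Icc (-1) 1)) (f g : L2) :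
    Integrable (fun x => β x * (prim f x * prim g x)) cell :=
  integrable_cell (hβ.mul (by fun_prop))

variable {α β : ℝ → ℝ} (hα : ContinuousOn α (Icc (-1) 1)) (hβ : ContinuousOn β (Icc (-1) 1))

lemma form_apply (f g : L2) : form α β hα hβ f g
    = ∫ x, α x * (f x * g x) ∂cell + ∫ x, β x * (prim f x * prim g x) ∂cell := by
  have : ∫ x, β x * (primL f x * primL g x) ∂cell = ∫ x, β x * (prim f x * prim g x) ∂cell := by
    refine integral_congr_ae ?_
    filter_upwards [coe_primL f, coe_primL g] with x h1 h2
    rw [h1, h2]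
  rw [← this]
  rfl

lemma form_apply_self (f : L2) : form α β hα hβ f f
    = ∫ x, (α x * f x ^ 2 + β x * prim f x ^ 2) ∂cell := by
  rw [form_apply, ← integral_add (integrable_weight hα f f) (integrable_weight_prim hβ f f)]
  simp only [sq]

lemma form_symm (f g : L2) : form α β hα hβ f g = form α β hα hβ g f := by
  rw [form_apply, form_apply]
  simp only [mul_comm]

end form

lemma continuous_bilin_self (B : L2 →L[ℝ] L2 →L[ℝ] ℝ) : Continuous fun f => B f f :=
  B.continuous.clm_apply continuous_id

lemma integrable_sq (f : L2) : Integrable (fun x => f x ^ 2) cell := by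
  simpa only [sq] using integrable_mul_coe f f

lemma integrable_prim_sq (f : L2) : Integrable (fun x => prim f x ^ 2) cell :=
  integrable_cell (by fun_prop)

lemma norm_primL_sq (f : L2) : ‖primL f‖ ^ 2 = ∫ x, prim f x ^ 2 ∂cell := by
  rw [norm_sq_eq]
  refine integral_congr_ae ?_
  filter_upwards [coe_primL f] with x h1
  rw [h1]

/-- A Poincaré inequality. -/
lemma norm_primL_sq_le (f : L2) : ‖primL f‖ ^ 2 ≤ 4 * ‖f‖ ^ 2 := by
  rw [norm_primL_sq]
  calc ∫ x, prim f x ^ 2 ∂cell ≤ ∫ _x, 2 * ‖f‖ ^ 2 ∂cell :=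
        integral_mono (integrable_prim_sq f) (integrable_const _) fun x => prim_sq_le f x
    _ = 4 * ‖f‖ ^ 2 := by
        rw [integral_const, Measure.real, cell_univ, smul_eq_mul]; norm_num; ring

lemma primL_injective {f : L2} (h : primL f = 0) : f = 0 := by
  have key : ∀ᵐ x ∂cell, x ∈ Ioo (-1 : ℝ) 1 → f x = 0 := by
    refine IsOpen.ae_eq_zero_of_integral_contDiff_smul_eq_zero isOpen_Ioo
      ((integrable_coe f).locallyIntegrable.locallyIntegrableOn _) ?_
    intro ψ h1 h2 h3
    have h4 := isWeakDeriv_primL f ψ h1 h2 h3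
    have h5 : ∫ x, primL f x * deriv ψ x ∂cell = 0 := by
      rw [h]
      refine integral_eq_zero_of_ae ?_
      filter_upwards [Lp.coeFn_zero ℝ 2 cell] with x hx
      simp only [hx, Pi.zero_apply, zero_mul]
    simp only [smul_eq_mul, mul_comm (ψ _)]
    linarith
  refine Lp.ext ?_
  filter_upwards [key, ae_restrict_mem measurableSet_Ioo, Lp.coeFn_zero ℝ 2 cell] with x h1 h2 h3
  rw [h1 h2, h3, Pi.zero_apply]

/-- The infimum over `H¹₀(-1, 1)` of the Rayleigh quotient of `q`, where the elements of
`H¹₀(-1, 1)` are represented by their derivatives. -/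
def lowest (q : L2 → ℝ) : ℝ := sInf {r | ∃ f ∈ Y, f ≠ 0 ∧ r = q f / ‖primL f‖ ^ 2}

lemma norm_primL_sq_pos {f : L2} (hf : f ≠ 0) : 0 < ‖primL f‖ ^ 2 := by
  have : primL f ≠ 0 := fun h => hf (primL_injective h)
  positivity

lemma exists_mem_Y_ne_zero : ∃ f ∈ Y, f ≠ 0 := by
  have h : IsC1 (fun x : ℝ => x ^ 2) (fun x => 2 * x) :=
    ⟨by fun_prop, by fun_prop, fun x _ => by simpa using hasDerivAt_pow 2 x⟩
  have hp : ∀ x ∈ Icc (-1 : ℝ) 1, prim (ofCont _ h.cont') x = x ^ 2 - (-1) ^ 2 :=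
    fun x hx => h.prim_eq (coe_ofCont _) hx
  refine ⟨ofCont _ h.cont', mem_Y.2 ?_, fun h0 => ?_⟩
  · rw [hp 1 (by norm_num)]; norm_num
  · have := hp 0 (by norm_num)
    simp [h0] at this

lemma lowest_nonempty (q : L2 → ℝ) : {r | ∃ f ∈ Y, f ≠ 0 ∧ r = q f / ‖primL f‖ ^ 2}.Nonempty := by
  obtain ⟨f, h1, h2⟩ := exists_mem_Y_ne_zero
  exact ⟨_, f, h1, h2, rfl⟩

lemma le_lowest {q : L2 → ℝ} {M : ℝ} (h : ∀ f ∈ Y, M * ‖primL f‖ ^ 2 ≤ q f) : M ≤ lowest q := by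
  refine le_csInf (lowest_nonempty q) ?_
  rintro r ⟨f, h1, h2, rfl⟩
  rw [le_div_iff₀ (norm_primL_sq_pos h2)]
  exact h f h1

lemma lowest_mul_le {q : L2 → ℝ} {M : ℝ} (h : ∀ f ∈ Y, M * ‖primL f‖ ^ 2 ≤ q f)
    {f : L2} (hf : f ∈ Y) (h0 : f ≠ 0) : lowest q * ‖primL f‖ ^ 2 ≤ q f := by
  rw [← le_div_iff₀ (norm_primL_sq_pos h0)]
  refine csInf_le ⟨M, ?_⟩ ⟨f, hf, h0, rfl⟩
  rintro r ⟨f, h1, h2, rfl⟩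
  rw [le_div_iff₀ (norm_primL_sq_pos h2)]
  exact h f h1

lemma lowest_mul_le' {B : L2 →L[ℝ] L2 →L[ℝ] ℝ} {M : ℝ} (h : ∀ f ∈ Y, M * ‖primL f‖ ^ 2 ≤ B f f)
    {f : L2} (hf : f ∈ Y) : lowest (fun f => B f f) * ‖primL f‖ ^ 2 ≤ B f f := by
  by_cases h0 : f = 0
  · simp [h0]
  · exact lowest_mul_le (q := fun f => B f f) h hf h0

/-! ### Compactness and the spectral gap -/

/-- Restriction of the primitive to the compact interval. -/
def primK (f : L2) : BoundedContinuousFunction (Icc (-1 : ℝ) 1) ℝ :=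
  (prim f).compContinuous ⟨Subtype.val, continuous_subtype_val⟩

lemma primK_apply (f : L2) (x : Icc (-1 : ℝ) 1) : primK f x = prim f x := rfl

lemma norm_primL_sub_le (f g : L2) :
    ‖primL f - primL g‖ ^ 2 ≤ 2 * dist (primK f) (primK g) ^ 2 := by
  rw [← map_sub, norm_primL_sq]
  calc ∫ x, prim (f - g) x ^ 2 ∂cell ≤ ∫ _x, dist (primK f) (primK g) ^ 2 ∂cell := by
        refine integral_mono_ae (integrable_prim_sq _) (integrable_const _) (ae_cell fun x hx => ?_)
        have := BoundedContinuousFunction.dist_coe_le_dist (f := primK f) (g := primK g)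
          ⟨x, Ioo_subset_Icc_self hx⟩
        rw [primK_apply, primK_apply, Real.dist_eq] at this
        simp only [map_sub, BoundedContinuousFunction.coe_sub, Pi.sub_apply]
        rw [← sq_abs]
        gcongr
    _ = 2 * dist (primK f) (primK g) ^ 2 := by
        rw [integral_const, Measure.real, cell_univ, smul_eq_mul]; norm_num

/-- Rellich's theorem: the primitives of a sequence of unit vectors subconverge in `L²`. -/
lemma exists_subseq_cauchy_primL {u : ℕ → L2} (hu : ∀ n, ‖u n‖ = 1) :
    ∃ φ : ℕ → ℕ, StrictMono φ ∧ CauchySeq fun n => primL (u (φ n)) := by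
  set A : Set (BoundedContinuousFunction (Icc (-1 : ℝ) 1) ℝ) := range fun n => primK (u n) with hA
  have hcomp : IsCompact (closure A) := by
    refine BoundedContinuousFunction.arzela_ascoli (Icc (-√2) (√2)) isCompact_Icc A ?_ ?_
    · rintro _ x ⟨n, rfl⟩
      have := abs_prim_le (u n) x
      rw [hu, mul_one] at this
      exact abs_le.1 this
    · refine Metric.equicontinuous_of_continuity_modulus (fun d => √d)
        (by simpa using (Real.continuous_sqrt.tendsto 0)) _ ?_
      rintro x y ⟨_, n, rfl⟩
      have := abs_primFun_sub_le (u n) x y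
      rw [hu, mul_one] at this
      exact this
  obtain ⟨a, -, φ, hφ, hlim⟩ := hcomp.tendsto_subseq
    (x := fun n => primK (u n)) fun n => subset_closure ⟨n, rfl⟩
  refine ⟨φ, hφ, ?_⟩
  have hc := hlim.cauchySeq
  rw [Metric.cauchySeq_iff] at hc ⊢
  intro ε hε
  obtain ⟨N, hN⟩ := hc (ε / 2) (by positivity)
  refine ⟨N, fun m hm n hn => ?_⟩
  have h1 := hN m hm n hn
  have h2 := norm_primL_sub_le (u (φ m)) (u (φ n))
  rw [dist_eq_norm]
  simp only [Function.comp_apply] at h1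
  have h3 := dist_nonneg (x := primK (u (φ m))) (y := primK (u (φ n)))
  refine lt_of_pow_lt_pow_left₀ 2 hε.le (h2.trans_lt ?_)
  nlinarith

/-- A nonnegative form that is coercive up to a compact term, and definite on a closed subspace,
is bounded below by the norm there: by the parallelogram law a normalized sequence along which the
form tends to zero has a Cauchy subsequence, whose limit would be a null vector. -/
lemma exists_gap {N : L2 →L[ℝ] L2 →L[ℝ] ℝ} {G : Submodule ℝ L2} (hG : IsClosed (G : Set L2))
    (hsymm : ∀ f g, N f g = N g f) (hpos : ∀ f ∈ G, 0 ≤ N f f) {p q : ℝ} (hp : 0 < p) (hq : 0 < q)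
    (hco : ∀ f, p * ‖f‖ ^ 2 ≤ N f f + q * ‖primL f‖ ^ 2)
    (hdef : ∀ f ∈ G, N f f = 0 → f = 0) : ∃ δ, 0 < δ ∧ ∀ f ∈ G, δ * ‖f‖ ^ 2 ≤ N f f := by
  by_contra! hcon
  have hex : ∀ n : ℕ, ∃ g ∈ G, ‖g‖ = 1 ∧ N g g < 1 / (n + 1 : ℝ) := by
    intro n
    obtain ⟨f, hf, hlt⟩ := hcon (1 / (n + 1 : ℝ)) (by positivity)
    have h0 : f ≠ 0 := by rintro rfl; simp at hlt
    have hn : 0 < ‖f‖ := norm_pos_iff.2 h0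
    refine ⟨‖f‖⁻¹ • f, G.smul_mem _ hf, ?_, ?_⟩
    · rw [norm_smul, norm_inv, norm_norm, inv_mul_cancel₀ hn.ne']
    · have : N (‖f‖⁻¹ • f) (‖f‖⁻¹ • f) = N f f / ‖f‖ ^ 2 := by
        simp only [map_smul, smul_apply, smul_eq_mul]
        field_simp
      rw [this, div_lt_iff₀ (by positivity)]
      exact hlt
  choose u huG hu1 huN using hex
  obtain ⟨φ, hφ, hc⟩ := exists_subseq_cauchy_primL hu1
  have hNlim : Tendsto (fun n => N (u (φ n)) (u (φ n))) atTop (𝓝 0) := by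
    have h1 : Tendsto (fun n => 1 / ((φ n : ℝ) + 1)) atTop (𝓝 0) :=
      tendsto_one_div_add_atTop_nhds_zero_nat.comp hφ.tendsto_atTop
    exact squeeze_zero (fun n => hpos _ (huG _)) (fun n => (huN _).le) h1
  have hcs : CauchySeq fun n => u (φ n) := by
    rw [Metric.cauchySeq_iff] at hc ⊢
    intro ε hε
    obtain ⟨N1, hN1⟩ := hc (√(p * ε ^ 2 / (2 * q))) (by positivity)
    obtain ⟨N2, hN2⟩ := eventually_atTop.1
      (hNlim.eventually (gt_mem_nhds (show (0 : ℝ) < p * ε ^ 2 / 8 by positivity)))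
    refine ⟨max N1 N2, fun m hm n hn => ?_⟩
    have a1 := hN1 m (le_of_max_le_left hm) n (le_of_max_le_left hn)
    have a2 := hN2 m (le_of_max_le_right hm)
    have a3 := hN2 n (le_of_max_le_right hn)
    rw [dist_eq_norm] at a1 ⊢
    rw [Real.lt_sqrt (norm_nonneg _), ← map_sub] at a1
    set f := u (φ m)
    set g := u (φ n)
    have b1 := hco (f - g)
    have b2 := hpos (f + g) (G.add_mem (huG _) (huG _))
    have b3 : N (f - g) (f - g) = 2 * N f f + 2 * N g g - N (f + g) (f + g) := by
      simp only [map_sub, map_add, sub_apply, add_apply,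
        hsymm g f]
      ring
    have b4 : q * ‖primL (f - g)‖ ^ 2 < p * ε ^ 2 / 2 := by
      calc q * ‖primL (f - g)‖ ^ 2 < q * (p * ε ^ 2 / (2 * q)) := by gcongr
        _ = p * ε ^ 2 / 2 := by field_simp
    refine lt_of_pow_lt_pow_left₀ 2 hε.le ?_
    refine lt_of_mul_lt_mul_left ?_ hp.le
    linarith
  obtain ⟨g, hg⟩ := cauchySeq_tendsto_of_complete hcs
  have hgG : g ∈ G := hG.mem_of_tendsto hg (Eventually.of_forall fun n => huG _)
  have hgN : N g g = 0 :=
    tendsto_nhds_unique (((continuous_bilin_self N).tendsto g).comp hg) hNlim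
  have hg1 : ‖g‖ = 1 := tendsto_nhds_unique hg.norm (by simp [hu1])
  rw [hdef g hgG hgN, norm_zero] at hg1
  exact zero_ne_one hg1

/-! ### Simplicity of the lowest eigenvalue -/

/-- A solution of the linear system `P' = R / α`, `R' = β P` with zero initial data vanishes:
`(P² + R²) e ^ (-K x)` is nonincreasing for large `K`. -/
lemma linear_system_unique {α β P R : ℝ → ℝ} (hα : ContinuousOn α (Icc (-1) 1))
    (hα0 : ∀ x ∈ Icc (-1 : ℝ) 1, 0 < α x) (hβ : ContinuousOn β (Icc (-1) 1))
    (hP : IsC1 P fun x => R x / α x) (hR : IsC1 R fun x => β x * P x)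
    (hP0 : P (-1) = 0) (hR0 : R (-1) = 0) : ∀ x ∈ Icc (-1 : ℝ) 1, R x = 0 := by
  have hc : ContinuousOn (fun x => (α x)⁻¹ + β x) (Icc (-1) 1) :=
    (hα.inv₀ fun x hx => (hα0 x hx).ne').add hβ
  obtain ⟨K, hK0, hK⟩ := exists_bound_cell hc
  set E : ℝ → ℝ := fun x => (P x ^ 2 + R x ^ 2) * Real.exp (-K * x) with hE
  have hanti : AntitoneOn E (Icc (-1) 1) := by
    refine antitoneOn_of_hasDerivWithinAt_nonpos (convex_Icc _ _)
      (((hP.cont.pow 2).add (hR.cont.pow 2)).mul (by fun_prop))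
      (f' := fun x => (2 * P x * R x * ((α x)⁻¹ + β x) - K * (P x ^ 2 + R x ^ 2))
        * Real.exp (-K * x)) ?_ ?_
    · intro x hx
      rw [interior_Icc] at hx
      have h1 := ((hP.deriv x hx).pow 2).add ((hR.deriv x hx).pow 2)
      have h2 : HasDerivAt (fun x => Real.exp (-K * x)) (Real.exp (-K * x) * (-K)) x := by
        simpa using ((hasDerivAt_id x).const_mul (-K)).exp
      refine ((h1.mul h2).congr_deriv ?_).hasDerivWithinAt
      simp only [Pi.add_apply, Pi.pow_apply]
      norm_num
      ring
    · intro x hx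
      rw [interior_Icc] at hx
      have h1 := hK x (Ioo_subset_Icc_self hx)
      refine mul_nonpos_of_nonpos_of_nonneg ?_ (Real.exp_pos _).le
      have h2 : 2 * P x * R x * ((α x)⁻¹ + β x) ≤ |2 * P x * R x| * K := by
        refine (le_abs_self _).trans ?_
        rw [abs_mul]
        gcongr
      have h3 : |2 * P x * R x| ≤ P x ^ 2 + R x ^ 2 := by
        rw [abs_le]; constructor <;> nlinarith [sq_nonneg (P x + R x), sq_nonneg (P x - R x)]
      nlinarith
  intro x hx
  have h1 := hanti (left_mem_Icc.2 (by norm_num)) hx hx.1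
  simp only [hE, hP0, hR0] at h1
  have h2 : P x ^ 2 + R x ^ 2 ≤ 0 := by
    by_contra! h
    have := mul_pos h (Real.exp_pos (-K * x))
    rw [show ((0 : ℝ) ^ 2 + 0 ^ 2) * Real.exp (-K * -1) = 0 by ring] at h1
    linarith
  have : R x ^ 2 = 0 := le_antisymm (by nlinarith [sq_nonneg (P x)]) (sq_nonneg _)
  exact pow_eq_zero_iff (two_ne_zero) |>.1 this

lemma apply_eq_zero_of_null {N : L2 →L[ℝ] L2 →L[ℝ] ℝ} {G : Submodule ℝ L2}
    (hsymm : ∀ f g, N f g = N g f) (hpos : ∀ f ∈ G, 0 ≤ N f f) {f : L2} (hf : f ∈ G)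
    (hN : N f f = 0) {g : L2} (hg : g ∈ G) : N f g = 0 := by
  have h : ∀ t : ℝ, 0 ≤ N g g * (t * t) + (2 * N f g) * t + 0 := by
    intro t
    have := hpos (f + t • g) (G.add_mem hf (G.smul_mem t hg))
    simp only [map_add, map_smul, add_apply, smul_apply,
      smul_eq_mul, hN, hsymm g f] at this
    linarith
  have := discrim_le_zero h
  rw [discrim] at this
  nlinarith [sq_nonneg (N f g)]

/-- The Euler–Lagrange equation of a form, integrated once: a null vector `f` satisfies
`α f = κ + R` with a constant `κ` and `R = ∫₋₁ˣ β (prim f)`. -/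
lemma exists_first_integral {α β : ℝ → ℝ} (hα : ContinuousOn α (Icc (-1) 1))
    (hβ : ContinuousOn β (Icc (-1) 1)) {f : L2}
    (h : ∀ g ∈ Y, form α β hα hβ f g = 0) :
    ∃ κ : ℝ, ∀ᵐ x ∂cell, α x * f x
      = κ + prim (ofCont (fun x => β x * prim f x) (hβ.mul (by fun_prop))) x := by
  have hβf : ContinuousOn (fun x => β x * prim f x) (Icc (-1) 1) := hβ.mul (by fun_prop)
  set R := prim (ofCont _ hβf) with hR
  have hR1 : IsC1 R fun x => β x * prim f x := isC1_prim hβf (coe_ofCont hβf)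
  have hz : MemLp (fun x => α x * f x - R x) 2 cell := by
    refine MemLp.sub ?_ (memLp_cell hR1.cont 2)
    obtain ⟨C, -, hC⟩ := exists_bound_cell hα
    refine (Lp.memLp f).of_le_mul (c := C)
      ((aestronglyMeasurable_cell hα).mul (Lp.memLp f).1) (ae_cell fun x hx => ?_)
    rw [norm_mul]
    gcongr
    exact hC x (Ioo_subset_Icc_self hx)
  set κ : ℝ := (∫ x, (α x * f x - R x) ∂cell) / 2 with hκ
  have hzI : Integrable (fun x => α x * f x - R x) cell := hz.integrable (by norm_num)
  have hgm : MemLp (fun x => α x * f x - R x - κ) 2 cell := hz.sub (memLp_const κ)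
  set g : L2 := hgm.toLp _ with hg
  have hgc : g =ᵐ[cell] fun x => α x * f x - R x - κ := hgm.coeFn_toLp
  have hg0 : ∫ x, g x ∂cell = 0 := by
    rw [integral_congr_ae hgc, integral_sub hzI (integrable_const κ), integral_const, Measure.real,
      cell_univ, hκ, smul_eq_mul]
    norm_num
    ring
  have hgY : g ∈ Y := mem_Y.2 (by rw [prim_one, hg0])
  have e1 := h g hgY
  have e2 := integral_by_parts hR1 g
  rw [mem_Y.1 hgY, mul_zero] at e2
  rw [form_apply] at e1
  have e3 : ∫ x, g x ^ 2 ∂cell = 0 := by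
    have e4 : ∫ x, g x ^ 2 ∂cell = ∫ x, α x * (f x * g x) ∂cell - ∫ x, R x * g x ∂cell
        - κ * ∫ x, g x ∂cell := by
      have i1 := integrable_weight hα f g
      have i2 : Integrable (fun x => R x * g x) cell := integrable_cont_mul hR1.cont (integrable_coe g)
      have i3 : Integrable (fun x => α x * (f x * g x) - R x * g x) cell := i1.sub i2
      rw [← integral_const_mul, ← integral_sub i1 i2,
        ← integral_sub i3 ((integrable_coe g).const_mul κ)]
      refine integral_congr_ae ?_
      filter_upwards [hgc] with x hx
      have : g x ^ 2 = g x * (α x * f x - R x - κ) := by rw [← hx]; ring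
      rw [this]; ring
    rw [e4, hg0]
    have e5 : ∫ x, β x * (prim f x * prim g x) ∂cell = ∫ x, β x * prim f x * prim g x ∂cell := by
      simp only [mul_assoc]
    linarith
  have hgz : g = 0 := by
    have := norm_sq_eq g
    rw [e3] at this
    exact norm_eq_zero.1 (pow_eq_zero_iff two_ne_zero |>.1 this)
  refine ⟨κ, ?_⟩
  filter_upwards [hgc, Lp.coeFn_zero ℝ 2 cell] with x h1 h2
  rw [hgz, h2, Pi.zero_apply] at h1
  linarith

lemma eq_zero_of_first_integral {α β : ℝ → ℝ} (hα : ContinuousOn α (Icc (-1) 1))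
    (hα0 : ∀ x ∈ Icc (-1 : ℝ) 1, 0 < α x) (hβ : ContinuousOn β (Icc (-1) 1)) {f : L2}
    (h : ∀ᵐ x ∂cell, α x * f x
      = prim (ofCont (fun x => β x * prim f x) (hβ.mul (by fun_prop))) x) : f = 0 := by
  have hβf : ContinuousOn (fun x => β x * prim f x) (Icc (-1) 1) := hβ.mul (by fun_prop)
  set R := prim (ofCont _ hβf) with hR
  have hR1 : IsC1 R fun x => β x * prim f x := isC1_prim hβf (coe_ofCont hβf)
  have hf : f =ᵐ[cell] fun x => R x / α x := by
    filter_upwards [h, ae_restrict_mem measurableSet_Ioo] with x h1 h2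
    have := (hα0 x (Ioo_subset_Icc_self h2)).ne'
    field_simp
    linarith
  have hP := isC1_prim (hR1.cont.div hα fun x hx => (hα0 x hx).ne') hf
  have hz := linear_system_unique hα hα0 hβ hP hR1 (prim_neg_one f) (prim_neg_one _)
  refine Lp.ext ?_
  filter_upwards [hf, ae_restrict_mem measurableSet_Ioo, Lp.coeFn_zero ℝ 2 cell] with x h1 h2 h3
  rw [h1, hz x (Ioo_subset_Icc_self h2), zero_div, h3, Pi.zero_apply]

/-- In one space dimension the null space of a nonnegative form is at most one-dimensional: a
suitable combination of two null vectors has vanishing first integral. -/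
lemma eq_zero_of_null_of_orthogonal {α β : ℝ → ℝ} (hα : ContinuousOn α (Icc (-1) 1))
    (hα0 : ∀ x ∈ Icc (-1 : ℝ) 1, 0 < α x) (hβ : ContinuousOn β (Icc (-1) 1))
    (hpos : ∀ f ∈ Y, 0 ≤ form α β hα hβ f f) {f g : L2} (hf : f ∈ Y) (hg : g ∈ Y)
    (hfN : form α β hα hβ f f = 0) (hgN : form α β hα hβ g g = 0)
    (ho : inner ℝ (primL f) (primL g) = 0) (hf0 : f ≠ 0) : g = 0 := by
  have hs := form_symm hα hβ
  have hf' := fun k (hk : k ∈ Y) => apply_eq_zero_of_null hs hpos hf hfN hk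
  have hg' := fun k (hk : k ∈ Y) => apply_eq_zero_of_null hs hpos hg hgN hk
  obtain ⟨κ, hκ⟩ := exists_first_integral hα hβ hf'
  obtain ⟨μ, hμ⟩ := exists_first_integral hα hβ hg'
  have hcomb : μ • f - κ • g = 0 := by
    obtain ⟨ν, hν⟩ := exists_first_integral hα hβ (f := μ • f - κ • g) (by
      intro k hk
      simp [hf' k hk, hg' k hk])
    have hlin : ∀ x ∈ Icc (-1 : ℝ) 1,
        prim (ofCont (fun x => β x * prim (μ • f - κ • g) x) (hβ.mul (by fun_prop))) x
          = μ * prim (ofCont (fun x => β x * prim f x) (hβ.mul (by fun_prop))) x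
            - κ * prim (ofCont (fun x => β x * prim g x) (hβ.mul (by fun_prop))) x := by
      intro x _
      have : ofCont (fun x => β x * prim (μ • f - κ • g) x) (hβ.mul (by fun_prop))
          = μ • ofCont (fun x => β x * prim f x) (hβ.mul (by fun_prop))
            - κ • ofCont (fun x => β x * prim g x) (hβ.mul (by fun_prop)) := by
        refine Lp.ext ?_
        filter_upwards [coe_ofCont (α := fun x => β x * prim (μ • f - κ • g) x)
            (hβ.mul (by fun_prop)), coe_ofCont (α := fun x => β x * prim f x)
            (hβ.mul (by fun_prop)), coe_ofCont (α := fun x => β x * prim g x)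
            (hβ.mul (by fun_prop)),
          Lp.coeFn_sub (μ • ofCont (fun x => β x * prim f x) (hβ.mul (by fun_prop)))
            (κ • ofCont (fun x => β x * prim g x) (hβ.mul (by fun_prop))),
          Lp.coeFn_smul μ (ofCont (fun x => β x * prim f x) (hβ.mul (by fun_prop))),
          Lp.coeFn_smul κ (ofCont (fun x => β x * prim g x) (hβ.mul (by fun_prop)))]
          with x a1 a2 a3 a4 a5 a6
        rw [a1, a4, Pi.sub_apply, a5, a6, Pi.smul_apply, Pi.smul_apply, a2, a3]
        simp only [map_sub, map_smul, BoundedContinuousFunction.coe_sub, Pi.sub_apply,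
          BoundedContinuousFunction.coe_smul, smul_eq_mul]
        ring
      rw [this]
      simp only [map_sub, map_smul, BoundedContinuousFunction.coe_sub, Pi.sub_apply,
          BoundedContinuousFunction.coe_smul, smul_eq_mul]
    refine eq_zero_of_first_integral hα hα0 hβ ?_
    filter_upwards [hκ, hμ, ae_restrict_mem measurableSet_Ioo, Lp.coeFn_sub (μ • f) (κ • g),
      Lp.coeFn_smul μ f, Lp.coeFn_smul κ g] with x a1 a2 a3 a4 a5 a6
    rw [hlin x (Ioo_subset_Icc_self a3), a4, Pi.sub_apply, a5, a6, Pi.smul_apply, Pi.smul_apply,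
      smul_eq_mul, smul_eq_mul]
    linear_combination μ * a1 - κ * a2
  by_contra hg0
  have hμ0 : μ ≠ 0 := by
    rintro rfl
    refine hg0 (eq_zero_of_first_integral hα hα0 hβ ?_)
    filter_upwards [hμ] with x hx
    rw [hx, zero_add]
  have h1 : inner ℝ (primL f) (primL (μ • f - κ • g)) = 0 := by rw [hcomb, map_zero, inner_zero_right]
  rw [map_sub, map_smul, map_smul, inner_sub_right, inner_smul_right, inner_smul_right, ho,
    mul_zero, sub_zero, real_inner_self_eq_norm_sq] at h1
  have := norm_primL_sq_pos hf0
  rcases mul_eq_zero.1 h1 with h | h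
  · exact hμ0 h
  · exact this.ne' h

/-! ### Differentiability of the lowest eigenvalue -/

/-- The scalar inequality behind first-order perturbation theory: `s` and `κ` are the sizes of the
two components of a competitor, and the cross term is absorbed by the gap `δ`. -/
lemma perturbation_scalar {ε s κ b d a K H δ m n Qk x y q : ℝ} (hδ : 0 < δ) (hK : 0 ≤ K)
    (hx : |x| ≤ a * H * κ) (hy : |y| ≤ a * κ * κ)
    (hbk : b ^ 2 ≤ 4 * κ ^ 2) (hn : n ^ 2 ≤ 2 * (s ^ 2 * H ^ 2) + 2 * κ ^ 2)
    (hgap : δ * κ ^ 2 ≤ Qk - m * b ^ 2) (hc1 : |ε| * (a + 2 * K + 4 * |d|) ≤ δ / 2)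
    (hc2 : |ε| ≤ 1)
    (hq : s ^ 2 * m + Qk + ε * (s ^ 2 * d + 2 * s * x + y) - K * ε ^ 2 * n ^ 2 ≤ q) :
    (m + ε * d - (4 * a ^ 2 * H ^ 2 / δ + 2 * K * H ^ 2) * ε ^ 2) * (s ^ 2 + b ^ 2) ≤ q := by
  have hcross : -(δ / 4 * κ ^ 2 + 4 * a ^ 2 * H ^ 2 / δ * ε ^ 2 * s ^ 2) ≤ ε * (2 * s * x) := by
    have e1 : |ε * (2 * s * x)| ≤ 2 * (|ε| * |s| * (a * H)) * κ := by
      rw [abs_mul, abs_mul, abs_mul, abs_two]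
      calc |ε| * (2 * |s| * |x|) ≤ |ε| * (2 * |s| * (a * H * κ)) := by gcongr
        _ = _ := by ring
    have e2 : 2 * (|ε| * |s| * (a * H)) * κ ≤ δ / 4 * κ ^ 2
        + 4 / δ * (|ε| * |s| * (a * H)) ^ 2 := by
      have : 0 ≤ (δ / 4 * κ - |ε| * |s| * (a * H)) ^ 2 * (4 / δ) := by positivity
      have e : (δ / 4 * κ - |ε| * |s| * (a * H)) ^ 2 * (4 / δ)
          = δ / 4 * κ ^ 2 - 2 * (|ε| * |s| * (a * H)) * κ
            + 4 / δ * (|ε| * |s| * (a * H)) ^ 2 := by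
        field_simp; ring
      linarith
    have e3 : 4 / δ * (|ε| * |s| * (a * H)) ^ 2 = 4 * a ^ 2 * H ^ 2 / δ * ε ^ 2 * s ^ 2 := by
      rw [mul_pow, mul_pow, mul_pow, sq_abs, sq_abs]; ring
    have := (abs_le.1 e1).1
    linarith
  have hkk : -(|ε| * a * κ ^ 2) ≤ ε * y := by
    have e : |ε * y| ≤ |ε| * (a * κ * κ) := by rw [abs_mul]; gcongr
    have e' : |ε| * (a * κ * κ) = |ε| * a * κ ^ 2 := by ring
    rw [← e']
    exact (abs_le.1 e).1
  have hdk : ε * d * b ^ 2 ≤ |ε| * (4 * |d|) * κ ^ 2 := by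
    calc ε * d * b ^ 2 ≤ |ε * d| * b ^ 2 := by gcongr; exact le_abs_self _
      _ ≤ |ε| * |d| * (4 * κ ^ 2) := by rw [abs_mul]; gcongr
      _ = _ := by ring
  have hεK : 2 * K * ε ^ 2 * κ ^ 2 ≤ |ε| * (2 * K) * κ ^ 2 := by
    have : ε ^ 2 ≤ |ε| := by rw [← sq_abs]; nlinarith [abs_nonneg ε]
    calc 2 * K * ε ^ 2 * κ ^ 2 ≤ 2 * K * |ε| * κ ^ 2 := by gcongr
      _ = _ := by ring
  have hsm : |ε| * (a + 2 * K + 4 * |d|) * κ ^ 2 ≤ δ / 2 * κ ^ 2 := by gcongr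
  have hKg : K * ε ^ 2 * n ^ 2 ≤ K * ε ^ 2 * (2 * (s ^ 2 * H ^ 2) + 2 * κ ^ 2) := by gcongr
  have hKb : 0 ≤ (4 * a ^ 2 * H ^ 2 / δ + 2 * K * H ^ 2) * ε ^ 2 * b ^ 2 := by positivity
  have hδk : 0 ≤ δ / 4 * κ ^ 2 := by positivity
  generalize 4 * a ^ 2 * H ^ 2 / δ = z at *
  linarith

/-- First-order perturbation theory: a lowest eigenvalue separated by a gap from the rest of the
spectrum is differentiable, and its derivative is the perturbation evaluated at the normalized
eigenvector `h`. The lower bound splits a competitor into a multiple of `h` and an orthogonal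
part, whose cross term is absorbed by the gap. -/
lemma hasDerivAt_lowest {Q : ℝ → L2 →L[ℝ] L2 →L[ℝ] ℝ} {A : L2 →L[ℝ] L2 →L[ℝ] ℝ}
    {c₀ m δ K : ℝ} {h : L2} (hQs : ∀ f g, Q c₀ f g = Q c₀ g f) (hAs : ∀ f g, A f g = A g f)
    (hδ : 0 < δ) (hK : 0 ≤ K)
    (hA : ∀ᶠ c in 𝓝 c₀, ∀ f ∈ Y, |Q c f f - Q c₀ f f - (c - c₀) * A f f|
      ≤ K * (c - c₀) ^ 2 * ‖f‖ ^ 2)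
    (hY : h ∈ Y) (h1 : ‖primL h‖ = 1)
    (hnull : ∀ g ∈ Y, Q c₀ h g = m * inner ℝ (primL h) (primL g))
    (hgap : ∀ k ∈ Y, inner ℝ (primL h) (primL k) = 0 →
      δ * ‖k‖ ^ 2 ≤ Q c₀ k k - m * ‖primL k‖ ^ 2) :
    lowest (fun f => Q c₀ f f) = m ∧ HasDerivAt (fun c => lowest fun f => Q c f f) (A h h) c₀ := by
  set d := A h h with hd
  set a := ‖A‖ with ha
  set H := ‖h‖ with hH
  have ha0 : 0 ≤ a := norm_nonneg A
  have hH0 : 0 ≤ H := norm_nonneg _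
  have hhh : Q c₀ h h = m := by
    rw [hnull h hY, real_inner_self_eq_norm_sq, h1]; ring
  have hne : h ≠ 0 := by rintro rfl; simp at h1
  set K' := 4 * a ^ 2 * H ^ 2 / δ + 2 * K * H ^ 2 with hK'
  have hK'0 : 0 ≤ K' := by positivity
  have hKK' : K * H ^ 2 ≤ K' := by
    have : 0 ≤ 4 * a ^ 2 * H ^ 2 / δ := by positivity
    nlinarith [mul_nonneg hK (sq_nonneg H)]
  -- the lower bound for all competitors
  have hlow : ∀ᶠ c in 𝓝 c₀, ∀ g ∈ Y,
      (m + (c - c₀) * d - K' * (c - c₀) ^ 2) * ‖primL g‖ ^ 2 ≤ Q c g g := by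
    have hs1 : ∀ᶠ c in 𝓝 c₀, |c - c₀| * (a + 2 * K + 4 * |d|) < δ / 2 := by
      have : Continuous fun c => |c - c₀| * (a + 2 * K + 4 * |d|) := by fun_prop
      refine (this.tendsto c₀).eventually (gt_mem_nhds ?_)
      simpa using hδ
    have hs2 : ∀ᶠ c in 𝓝 c₀, |c - c₀| < 1 := by
      have : Continuous fun c => |c - c₀| := by fun_prop
      exact (this.tendsto c₀).eventually (gt_mem_nhds (by simp))
    filter_upwards [hA, hs1, hs2] with c hc hc1 hc2 g hg
    set ε := c - c₀ with hε
    set s : ℝ := inner ℝ (primL h) (primL g) with hs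
    set k := g - s • h with hk
    have hkY : k ∈ Y := Y.sub_mem hg (Y.smul_mem s hY)
    have hgk : g = s • h + k := by rw [hk]; abel
    have ho : inner ℝ (primL h) (primL k) = 0 := by
      rw [hk, map_sub, map_smul, inner_sub_right, inner_smul_right, real_inner_self_eq_norm_sq,
        h1, ← hs]
      ring
    have hgk1 := hgap k hkY ho
    have hbg : ‖primL g‖ ^ 2 = s ^ 2 + ‖primL k‖ ^ 2 := by
      rw [hgk, map_add, map_smul, ← real_inner_self_eq_norm_sq, inner_add_add_self,
        inner_smul_left, inner_smul_left, inner_smul_right, inner_smul_right,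
        real_inner_comm (primL h) (primL k), ho, real_inner_self_eq_norm_sq,
        real_inner_self_eq_norm_sq, h1]
      simp only [RCLike.conj_to_real]
      ring
    have hQg : Q c₀ g g = s ^ 2 * m + Q c₀ k k := by
      rw [hgk]
      simp only [map_add, map_smul, add_apply, smul_apply, smul_eq_mul, hQs k h, hhh,
        hnull k hkY, ho]
      ring
    have hAg : A g g = s ^ 2 * d + 2 * s * A h k + A k k := by
      rw [hgk]
      simp only [map_add, map_smul, add_apply, smul_apply, smul_eq_mul, hAs k h, ← hd]
      ring
    have hAhk : |A h k| ≤ a * H * ‖k‖ := A.le_opNorm₂ h k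
    have hAkk : |A k k| ≤ a * ‖k‖ * ‖k‖ := A.le_opNorm₂ k k
    have hgn : ‖g‖ ^ 2 ≤ 2 * (s ^ 2 * H ^ 2) + 2 * ‖k‖ ^ 2 := by
      have : ‖g‖ ≤ |s| * H + ‖k‖ := by
        rw [hgk]
        refine (norm_add_le _ _).trans ?_
        rw [norm_smul, Real.norm_eq_abs]
      have h2 : ‖g‖ ^ 2 ≤ (|s| * H + ‖k‖) ^ 2 := by gcongr
      nlinarith [sq_nonneg (|s| * H - ‖k‖), sq_abs s]
    have hbk := norm_primL_sq_le k
    have hq := (abs_le.1 (hc g hg)).1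
    rw [hQg, hAg] at hq
    rw [hbg]
    exact perturbation_scalar hδ hK hAhk hAkk hbk hgn hgk1 hc1.le hc2.le
      (by linarith)
  have hup : ∀ᶠ c in 𝓝 c₀, |lowest (fun f => Q c f f) - m - (c - c₀) * d| ≤ K' * (c - c₀) ^ 2 := by
    filter_upwards [hlow, hA] with c hc hcA
    have e1 := le_lowest hc
    have e2 := lowest_mul_le' hc hY
    rw [h1, one_pow, mul_one] at e2
    have e3 := (abs_le.1 (hcA h hY)).2
    rw [hhh, ← hd] at e3
    have e4 : K * (c - c₀) ^ 2 * H ^ 2 ≤ K' * (c - c₀) ^ 2 := by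
      calc K * (c - c₀) ^ 2 * H ^ 2 = K * H ^ 2 * (c - c₀) ^ 2 := by ring
        _ ≤ _ := by gcongr
    rw [abs_le]
    constructor <;> linarith
  have hm : lowest (fun f => Q c₀ f f) = m := by
    have := hup.self_of_nhds
    simp only [sub_self, zero_mul, sub_zero, ne_eq, OfNat.ofNat_ne_zero, not_false_eq_true,
      zero_pow, mul_zero] at this
    have := abs_nonpos_iff.1 this
    linarith
  refine ⟨hm, ?_⟩
  rw [hasDerivAt_iff_isLittleO]
  refine Asymptotics.IsBigO.trans_isLittleO (g := fun c => ‖c - c₀‖ ^ 2) ?_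
    (Asymptotics.isLittleO_pow_sub_sub c₀ (by norm_num : 1 < 2))
  refine Asymptotics.IsBigO.of_bound K' ?_
  filter_upwards [hup] with c hc
  rw [hm, smul_eq_mul, norm_pow, norm_norm, Real.norm_eq_abs, Real.norm_eq_abs, sq_abs]
  exact hc

/-- The lowest eigenvalue of a nondegenerate second-order form is attained and simple, and
therefore differentiable along a differentiable family. -/
lemma exists_hasDerivAt_lowest {Q : ℝ → L2 →L[ℝ] L2 →L[ℝ] ℝ} {A : L2 →L[ℝ] L2 →L[ℝ] ℝ}
    {c₀ K : ℝ} {α β : ℝ → ℝ} (hα : ContinuousOn α (Icc (-1) 1))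
    (hα0 : ∀ x ∈ Icc (-1 : ℝ) 1, 0 < α x) (hβ : ContinuousOn β (Icc (-1) 1))
    (hQ : Q c₀ = form α β hα hβ) (hAs : ∀ f g, A f g = A g f) (hK : 0 ≤ K)
    (hA : ∀ᶠ c in 𝓝 c₀, ∀ f ∈ Y, |Q c f f - Q c₀ f f - (c - c₀) * A f f|
      ≤ K * (c - c₀) ^ 2 * ‖f‖ ^ 2) :
    ∃ d, HasDerivAt (fun c => lowest fun f => Q c f f) d c₀ := by
  obtain ⟨b, hb0, hb⟩ := exists_bound_cell hβ
  obtain ⟨p, hp0, hp⟩ : ∃ p, 0 < p ∧ ∀ x ∈ Icc (-1 : ℝ) 1, p ≤ α x := by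
    obtain ⟨x, hx, hmin⟩ := isCompact_Icc.exists_isMinOn (nonempty_Icc.2 (by norm_num)) hα
    exact ⟨α x, hα0 x hx, fun y hy => hmin hy⟩
  have hco : ∀ f, p * ‖f‖ ^ 2 ≤ form α β hα hβ f f + b * ‖primL f‖ ^ 2 := by
    intro f
    rw [norm_sq_eq, norm_primL_sq, form_apply_self, ← integral_const_mul, ← integral_const_mul]
    have i1 : Integrable (fun x => α x * f x ^ 2) cell := integrable_cont_mul hα (integrable_sq f)
    have i2 : Integrable (fun x => β x * prim f x ^ 2) cell :=
      integrable_cont_mul hβ (integrable_prim_sq f)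
    have i3 : Integrable (fun x => α x * f x ^ 2 + β x * prim f x ^ 2) cell := i1.add i2
    rw [← integral_add i3 ((integrable_prim_sq f).const_mul b)]
    refine integral_mono_ae ((integrable_sq f).const_mul p)
      (i3.add ((integrable_prim_sq f).const_mul b)) (ae_cell fun x hx => ?_)
    have h1 := hp x (Ioo_subset_Icc_self hx)
    have h2 := (abs_le.1 (hb x (Ioo_subset_Icc_self hx))).1
    have h3 := mul_le_mul_of_nonneg_right h1 (sq_nonneg (f x))
    have h4 := mul_le_mul_of_nonneg_right h2 (sq_nonneg (prim f x))
    linarith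
  have hbdd : ∀ f ∈ Y, -b * ‖primL f‖ ^ 2 ≤ form α β hα hβ f f := by
    intro f _
    have := hco f
    nlinarith [mul_nonneg hp0.le (sq_nonneg ‖f‖)]
  set m := lowest (fun f => form α β hα hβ f f) with hm
  have hm' : ∀ f ∈ Y, m * ‖primL f‖ ^ 2 ≤ form α β hα hβ f f := fun f hf => lowest_mul_le' hbdd hf
  have hmb : -b ≤ m := le_lowest hbdd
  have hβm : ContinuousOn (fun x => β x - m) (Icc (-1) 1) := hβ.sub continuousOn_const
  have hN : ∀ f g, form α (fun x => β x - m) hα hβm f g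
      = form α β hα hβ f g - m * inner ℝ (primL f) (primL g) := by
    intro f g
    have e : ∫ x, (β x - m) * (prim f x * prim g x) ∂cell
        = ∫ x, β x * (prim f x * prim g x) ∂cell - m * inner ℝ (primL f) (primL g) := by
      have i : Integrable (fun x => prim f x * prim g x) cell :=
        integrable_cell (by fun_prop)
      have e1 : inner ℝ (primL f) (primL g) = ∫ x, prim f x * prim g x ∂cell := by
        rw [inner_eq]
        refine integral_congr_ae ?_
        filter_upwards [coe_primL f, coe_primL g] with x h1 h2
        rw [h1, h2]
      rw [e1, ← integral_const_mul, ← integral_sub (integrable_weight_prim hβ f g)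
        (i.const_mul m)]
      refine integral_congr_ae (ae_of_all _ fun x => ?_)
      ring
    rw [form_apply, form_apply, e]; ring
  have hNN : ∀ f, form α (fun x => β x - m) hα hβm f f
      = form α β hα hβ f f - m * ‖primL f‖ ^ 2 := by
    intro f; rw [hN, real_inner_self_eq_norm_sq]
  have hNpos : ∀ f ∈ Y, 0 ≤ form α (fun x => β x - m) hα hβm f f := by
    intro f hf; rw [hNN]; linarith [hm' f hf]
  have hNs := form_symm hα hβm
  have hq : 0 < b + m + 1 := by linarith
  have hNco : ∀ f, p * ‖f‖ ^ 2 ≤ form α (fun x => β x - m) hα hβm f f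
      + (b + m + 1) * ‖primL f‖ ^ 2 := by
    intro f; rw [hNN]; nlinarith [hco f, sq_nonneg ‖primL f‖]
  -- the infimum is attained, since otherwise the form would exceed it by a positive amount
  obtain ⟨h', hh'Y, hh'N, hh'0⟩ : ∃ f ∈ Y, form α (fun x => β x - m) hα hβm f f = 0 ∧ f ≠ 0 := by
    by_contra! hcon
    obtain ⟨δ, hδ, hgap⟩ := exists_gap isClosed_Y hNs hNpos hp0 hq hNco hcon
    have : m + δ / 4 ≤ m := le_lowest fun f hf => by
      have h1 := hgap f hf
      have h2 := norm_primL_sq_le f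
      rw [hNN] at h1
      nlinarith
    linarith
  have hpos' := norm_primL_sq_pos hh'0
  have hpos : 0 < ‖primL h'‖ := norm_pos_iff.2 fun h => by simp [h] at hpos'
  set h := ‖primL h'‖⁻¹ • h' with hh
  have hhY : h ∈ Y := Y.smul_mem _ hh'Y
  have hh1 : ‖primL h‖ = 1 := by
    rw [hh, map_smul, norm_smul, norm_inv, norm_norm, inv_mul_cancel₀ hpos.ne']
  have hhN : form α (fun x => β x - m) hα hβm h h = 0 := by
    rw [hh]
    simp [hh'N]
  have hh0 : h ≠ 0 := by intro h0; simp [h0] at hh1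
  -- the gap on the orthogonal complement
  set G : Submodule ℝ L2 := Y ⊓ LinearMap.ker ((innerSL ℝ (primL h)).comp primL : L2 →ₗ[ℝ] ℝ)
    with hG
  have hGc : IsClosed (G : Set L2) := by
    rw [hG, Submodule.coe_inf]
    exact isClosed_Y.inter (ContinuousLinearMap.isClosed_ker ((innerSL ℝ (primL h)).comp primL))
  have hGm : ∀ f, f ∈ G ↔ f ∈ Y ∧ inner ℝ (primL h) (primL f) = 0 := fun f => Iff.rfl
  obtain ⟨δ, hδ, hgap⟩ := exists_gap hGc hNs (fun f hf => hNpos f ((hGm f).1 hf).1) hp0 hq hNco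
    (fun f hf hf0 => eq_zero_of_null_of_orthogonal hα hα0 hβm hNpos hhY ((hGm f).1 hf).1 hhN hf0
      ((hGm f).1 hf).2 hh0)
  refine ⟨A h h, (hasDerivAt_lowest (m := m) (δ := δ) (K := K) (h := h) ?_ hAs hδ hK hA hhY hh1
    ?_ ?_).2⟩
  · rw [hQ]; exact form_symm hα hβ
  · intro g hg
    have := apply_eq_zero_of_null hNs hNpos hhY hhN hg
    rw [hN] at this
    rw [hQ]; linarith
  · intro k hk ho
    have := hgap k ((hGm k).2 ⟨hk, ho⟩)
    rw [hNN] at this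
    rwa [hQ]

/-! ### Inequalities for primitives -/

/-- A closed property of mean-zero functions holds as soon as it holds for those with a continuous
representative. -/
lemma induction_cont_Y {p : L2 → Prop} (hp : IsClosed {f | p f})
    (h : ∀ f ∈ Y, ∀ α : ℝ → ℝ, ContinuousOn α (Icc (-1) 1) → f =ᵐ[cell] α → p f)
    {f : L2} (hf : f ∈ Y) : p f := by
  set e : L2 := ofCont (fun _ => 1) continuousOn_const with he
  have he1 : prim e 1 = 2 := by
    rw [integral_coe_congr (coe_ofCont continuousOn_const) (by norm_num)]
    simp; norm_num
  set π : L2 → L2 := fun f => f - (prim f 1 / 2) • e with hπ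
  have hπc : Continuous π := by
    have h3 : Continuous fun f : L2 => prim f 1 :=
      (BoundedContinuousFunction.evalCLM ℝ (1 : ℝ)).continuous.comp prim.continuous
    exact continuous_id.sub ((h3.div_const 2).smul continuous_const)
  have key : ∀ f, p (π f) := by
    refine induction_cont (hp.preimage hπc) ?_
    intro f α hα hf
    refine h _ ?_ (fun x => α x - prim f 1 / 2) (hα.sub continuousOn_const) ?_
    · rw [mem_Y]
      simp [hπ, he1]
    · filter_upwards [hf, Lp.coeFn_sub f ((prim f 1 / 2) • e), Lp.coeFn_smul (prim f 1 / 2) e,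
        coe_ofCont (α := fun _ => 1) continuousOn_const] with x h1 h2 h3 h4
      rw [h2, Pi.sub_apply, h3, Pi.smul_apply, h1, he, h4, smul_eq_mul, mul_one]
  have := key f
  simpa only [hπ, mem_Y.1 hf, zero_div, zero_smul, sub_zero] using this

/-- The Riccati (or Jacobi) inequality: completing the square in `∫ (u' + ρ u)² ≥ 0`. -/
lemma riccati {ρ ρ' : ℝ → ℝ} (hρ : IsC1 ρ ρ') {f : L2} (hf : f ∈ Y) :
    ∫ x, (ρ' x - ρ x ^ 2) * prim f x ^ 2 ∂cell ≤ ∫ x, f x ^ 2 ∂cell := by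
  have hβ : ContinuousOn (fun x => -(ρ' x - ρ x ^ 2)) (Icc (-1) 1) :=
    (hρ.cont'.sub (hρ.cont.pow 2)).neg
  have h1 : ContinuousOn (fun _ : ℝ => (1 : ℝ)) (Icc (-1) 1) := continuousOn_const
  have key : 0 ≤ form _ _ h1 hβ f f := by
    refine induction_cont_Y (p := fun f => 0 ≤ form _ _ h1 hβ f f)
      (isClosed_le continuous_const (continuous_bilin_self _)) ?_ hf
    intro f hf α hα hfα
    have hP := isC1_prim hα hfα
    have e : form _ _ h1 hβ f f
        = ∫ x, ((α x + ρ x * prim f x) ^ 2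
          - (ρ' x * prim f x ^ 2 + ρ x * (2 * prim f x * α x))) ∂cell := by
      rw [form_apply_self]
      refine integral_congr_ae ?_
      filter_upwards [hfα] with x hx
      rw [hx]; ring
    have hc1 : ContinuousOn (fun x => (α x + ρ x * prim f x) ^ 2) (Icc (-1) 1) :=
      (hα.add (hρ.cont.mul hP.cont)).pow 2
    have hc2 : ContinuousOn (fun x => 2 * prim f x * α x) (Icc (-1) 1) :=
      (continuousOn_const.mul hP.cont).mul hα
    have hc3 : ContinuousOn (fun x => ρ' x * prim f x ^ 2 + ρ x * (2 * prim f x * α x))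
        (Icc (-1) 1) :=
      (hρ.cont'.mul (hP.cont.pow 2)).add (hρ.cont.mul hc2)
    have hz : ∫ x, (ρ' x * prim f x ^ 2 + ρ x * (2 * prim f x * α x)) ∂cell = 0 := by
      rw [integral_cell]
      have := intervalIntegral.integral_deriv_mul_eq_sub_of_hasDerivAt (a := -1) (b := 1)
        (u := ρ) (v := fun x => prim f x ^ 2) (u' := ρ') (v' := fun x => 2 * prim f x * α x)
        (by rw [uIcc_of_le (by norm_num)]; exact hρ.cont)
        (by rw [uIcc_of_le (by norm_num)]; exact hP.cont.pow 2)
        (by simpa using hρ.deriv)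
        (by
          intro x hx
          rw [min_eq_left (by norm_num), max_eq_right (by norm_num)] at hx
          refine ((hP.deriv x hx).pow 2).congr_deriv ?_
          norm_num)
        (hρ.cont'.intervalIntegrable_of_Icc (by norm_num))
        (hc2.intervalIntegrable_of_Icc (by norm_num))
      rw [this, mem_Y.1 hf, prim_neg_one]
      ring
    rw [e, integral_sub (integrable_cell hc1) (integrable_cell hc3), hz, sub_zero]
    exact integral_nonneg fun x => sq_nonneg _
  rw [form_apply_self] at key
  have i1 : Integrable (fun x => (ρ' x - ρ x ^ 2) * prim f x ^ 2) cell :=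
    integrable_cont_mul (hρ.cont'.sub (hρ.cont.pow 2)) (integrable_prim_sq f)
  have e : ∫ x, ((1 : ℝ) * f x ^ 2 + -(ρ' x - ρ x ^ 2) * prim f x ^ 2) ∂cell
      = ∫ x, f x ^ 2 ∂cell - ∫ x, (ρ' x - ρ x ^ 2) * prim f x ^ 2 ∂cell := by
    rw [← integral_sub (integrable_sq f) i1]
    refine integral_congr_ae (ae_of_all _ fun x => ?_)
    ring
  rw [e] at key
  linarith

/-! ### The symmetry-breaking form in the amplitude coordinate -/

/-- The square of the slope of a profile with first integral `c`, as a function of its value. -/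
def slopeSq (c v : ℝ) : ℝ := (1 - v ^ 2) ^ 2 + c

lemma slopeSq_pos {c : ℝ} (hc : 0 < c) (v : ℝ) : 0 < slopeSq c v := by
  unfold slopeSq; positivity

lemma continuous_slopeSq (c : ℝ) : Continuous (slopeSq c) := by
  unfold slopeSq; fun_prop

lemma continuous_ampPot {c : ℝ} (hc : 0 < c) :
    Continuous fun x => -(c * x ^ 2 / slopeSq c x) :=
  ((by fun_prop : Continuous fun x => c * x ^ 2).div (continuous_slopeSq c)
    fun x => (slopeSq_pos hc x).ne').neg

/-- The form `∫ ((1 - x²)² + c) g'² - c x² / ((1 - x²)² + c) g²`, set to zero for `c ≤ 0`. It is the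
second variation on symmetry-breaking perturbations, up to normalization, when the value of the
profile is taken as the independent variable. -/
def ampForm (c : ℝ) : L2 →L[ℝ] L2 →L[ℝ] ℝ :=
  if hc : 0 < c then
    form (slopeSq c) (fun x => -(c * x ^ 2 / slopeSq c x)) (continuous_slopeSq c).continuousOn
      (continuous_ampPot hc).continuousOn
  else 0

/-- The lowest eigenvalue of `ampForm c`. -/
def ampEig (c : ℝ) : ℝ := lowest fun f => ampForm c f f

lemma ampForm_apply {c : ℝ} (hc : 0 < c) (f : L2) : ampForm c f f
    = ∫ x, (slopeSq c x * f x ^ 2 + -(c * x ^ 2 / slopeSq c x) * prim f x ^ 2) ∂cell := by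
  rw [ampForm, dif_pos hc, form_apply_self]

lemma integrable_ampForm {c : ℝ} (hc : 0 < c) (f : L2) : Integrable
    (fun x => slopeSq c x * f x ^ 2 + -(c * x ^ 2 / slopeSq c x) * prim f x ^ 2) cell :=
  (integrable_cont_mul (continuous_slopeSq c).continuousOn (integrable_sq f)).add
    (integrable_cont_mul (continuous_ampPot hc).continuousOn (integrable_prim_sq f))

lemma integrable_ampForm_sub {c c' : ℝ} (hc : 0 < c) (hc' : 0 < c') (f : L2) : Integrable
    (fun x => slopeSq c x * f x ^ 2 + -(c * x ^ 2 / slopeSq c x) * prim f x ^ 2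
      - (slopeSq c' x * f x ^ 2 + -(c' * x ^ 2 / slopeSq c' x) * prim f x ^ 2)) cell :=
  (integrable_ampForm hc f).sub (integrable_ampForm hc' f)

lemma neg_le_ampForm {c : ℝ} (hc : 0 < c) (f : L2) :
    -1 * ‖primL f‖ ^ 2 ≤ ampForm c f f := by
  rw [norm_primL_sq, ampForm_apply hc, ← integral_const_mul]
  refine integral_mono_ae ((integrable_prim_sq f).const_mul _) (integrable_ampForm hc f)
    (ae_cell fun x hx => ?_)
  have hs := slopeSq_pos hc x
  have h1 : c * x ^ 2 / slopeSq c x ≤ 1 := by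
    rw [div_le_one hs, slopeSq]
    have : x ^ 2 ≤ 1 := by nlinarith [hx.1, hx.2]
    nlinarith [sq_nonneg (1 - x ^ 2)]
  have h2 := mul_le_mul_of_nonneg_right h1 (sq_nonneg (prim f x))
  have h3 := mul_nonneg hs.le (sq_nonneg (f x))
  simp only
  linarith

/-- The pointwise form of Hardy's inequality that makes `ampForm` monotone in the parameter. -/
lemma hardy_weight_le {c c' ε x : ℝ} (hc' : 0 < c') (hcc : c' < c) (hε : 0 < ε) (hε1 : ε ≤ 1)
    (hε2 : 2 * ε + ε ^ 2 ≤ c') (hx : x ∈ Icc (-1 : ℝ) 1) :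
    1 / 2 + x ^ 2 * (1 - x ^ 2) ^ 2 / (slopeSq c x * slopeSq c' x)
      ≤ (1 + ε) / (1 + ε - x ^ 2) ^ 2 := by
  have hx2 : x ^ 2 ≤ 1 := by nlinarith [hx.1, hx.2]
  have hx0 := sq_nonneg x
  have hc : 0 < c := hc'.trans hcc
  have hd : 0 < 1 + ε - x ^ 2 := by linarith
  have h1 : x ^ 2 * (1 - x ^ 2) ^ 2 / (slopeSq c x * slopeSq c' x) ≤ x ^ 2 / slopeSq c' x := by
    rw [div_le_div_iff₀ (mul_pos (slopeSq_pos hc x) (slopeSq_pos hc' x)) (slopeSq_pos hc' x)]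
    have : (1 - x ^ 2) ^ 2 ≤ slopeSq c x := by rw [slopeSq]; linarith
    have := mul_le_mul_of_nonneg_left this (mul_nonneg hx0 (slopeSq_pos hc' x).le)
    linarith
  have h2 : x ^ 2 / slopeSq c' x ≤ x ^ 2 / (1 + ε - x ^ 2) ^ 2 := by
    gcongr
    rw [slopeSq]
    nlinarith
  have h3 : (1 + ε) / (1 + ε - x ^ 2) ^ 2 - x ^ 2 / (1 + ε - x ^ 2) ^ 2 = 1 / (1 + ε - x ^ 2) := by
    field_simp
  have h4 : 1 / 2 ≤ 1 / (1 + ε - x ^ 2) := by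
    apply one_div_le_one_div_of_le hd; linarith
  linarith

/-- The form increases at least at rate `1/2` with the parameter. -/
lemma ampForm_mono {c c' : ℝ} (hc' : 0 < c') (hcc : c' < c) {f : L2} (hf : f ∈ Y) :
    ampForm c' f f + (c - c') / 2 * ‖primL f‖ ^ 2 ≤ ampForm c f f := by
  have hc : 0 < c := hc'.trans hcc
  obtain ⟨ε, hε, hε1, hε2⟩ : ∃ ε : ℝ, 0 < ε ∧ ε ≤ 1 ∧ 2 * ε + ε ^ 2 ≤ c' := by
    refine ⟨min 1 (c' / 3), by positivity, min_le_left _ _, ?_⟩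
    have h1 := min_le_left 1 (c' / 3)
    have h2 := min_le_right 1 (c' / 3)
    have h3 : 0 < min 1 (c' / 3) := by positivity
    nlinarith
  have hd : ∀ x ∈ Icc (-1 : ℝ) 1, 1 + ε - x ^ 2 ≠ 0 := fun x hx => by
    have : x ^ 2 ≤ 1 := by nlinarith [hx.1, hx.2]
    have : 0 < 1 + ε - x ^ 2 := by linarith
    exact this.ne'
  -- the logarithmic derivative of `√(1 + ε - x²)`, up to sign
  have hρ : IsC1 (fun x => x / (1 + ε - x ^ 2)) (fun x => (1 + ε + x ^ 2) / (1 + ε - x ^ 2) ^ 2) := by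
    refine ⟨ContinuousOn.div (by fun_prop) (by fun_prop) hd,
      ContinuousOn.div (by fun_prop) (by fun_prop) fun x hx => pow_ne_zero 2 (hd x hx), ?_⟩
    intro x hx
    have h1 : HasDerivAt (fun x : ℝ => 1 + ε - x ^ 2) (-(2 * x)) x := by
      simpa using (hasDerivAt_pow 2 x).const_sub (1 + ε)
    refine ((hasDerivAt_id x).div h1 (hd x (Ioo_subset_Icc_self hx))).congr_deriv ?_
    simp only [id]; ring
  have hric := riccati hρ hf
  have e0 : ampForm c f f - ampForm c' f f - (c - c') / 2 * ‖primL f‖ ^ 2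
      = (c - c') * ∫ x, (f x ^ 2 - (1 / 2 + x ^ 2 * (1 - x ^ 2) ^ 2 / (slopeSq c x * slopeSq c' x))
        * prim f x ^ 2) ∂cell := by
    rw [ampForm_apply hc, ampForm_apply hc', norm_primL_sq,
      ← integral_sub (integrable_ampForm hc f) (integrable_ampForm hc' f),
      ← integral_const_mul, ← integral_const_mul,
      ← integral_sub (integrable_ampForm_sub hc hc' f)
        ((integrable_prim_sq f).const_mul _)]
    refine integral_congr_ae (ae_of_all _ fun x => ?_)
    have h1 := (slopeSq_pos hc x).ne'
    have h2 := (slopeSq_pos hc' x).ne'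
    simp only
    field_simp
    simp only [slopeSq]
    ring
  have hw : Continuous fun x => 1 / 2 + x ^ 2 * (1 - x ^ 2) ^ 2 / (slopeSq c x * slopeSq c' x) :=
    continuous_const.add ((by fun_prop : Continuous fun x : ℝ => x ^ 2 * (1 - x ^ 2) ^ 2).div
      ((continuous_slopeSq c).mul (continuous_slopeSq c'))
      fun x => (mul_pos (slopeSq_pos hc x) (slopeSq_pos hc' x)).ne')
  have i1 : Integrable (fun x => (1 / 2 + x ^ 2 * (1 - x ^ 2) ^ 2 / (slopeSq c x * slopeSq c' x))
      * prim f x ^ 2) cell := integrable_cont_mul hw.continuousOn (integrable_prim_sq f)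
  have h1 : ∫ x, (1 / 2 + x ^ 2 * (1 - x ^ 2) ^ 2 / (slopeSq c x * slopeSq c' x))
      * prim f x ^ 2 ∂cell ≤ ∫ x, f x ^ 2 ∂cell := by
    refine le_trans (integral_mono_ae i1 (integrable_cont_mul (hρ.cont'.sub (hρ.cont.pow 2))
      (integrable_prim_sq f)) (ae_cell fun x hx => ?_)) hric
    have := hardy_weight_le hc' hcc hε hε1 hε2 (Ioo_subset_Icc_self hx)
    refine mul_le_mul_of_nonneg_right (this.trans (le_of_eq ?_)) (sq_nonneg _)
    have := hd x (Ioo_subset_Icc_self hx)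
    simp only [Pi.sub_apply, Pi.pow_apply]
    field_simp
    ring
  rw [integral_sub (integrable_sq f) i1] at e0
  have := mul_nonneg (sub_pos.2 hcc).le (sub_nonneg.2 h1)
  linarith

lemma ampEig_mul_le {c : ℝ} (hc : 0 < c) {f : L2} (hf : f ∈ Y) :
    ampEig c * ‖primL f‖ ^ 2 ≤ ampForm c f f :=
  lowest_mul_le' (fun f _ => neg_le_ampForm hc f) hf

lemma ampEig_mono {c c' : ℝ} (hc' : 0 < c') (hcc : c' < c) :
    ampEig c' + (c - c') / 2 ≤ ampEig c := by
  refine le_lowest fun f hf => ?_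
  have h1 := ampForm_mono hc' hcc hf
  have h2 := ampEig_mul_le hc' hf
  nlinarith

lemma exists_hasDerivAt_ampEig {c₀ : ℝ} (hc₀ : 0 < c₀) :
    ∃ d, 1 / 2 ≤ d ∧ HasDerivAt ampEig d c₀ := by
  have hβ1 : Continuous fun x : ℝ => -(x ^ 2 * (1 - x ^ 2) ^ 2 / slopeSq c₀ x ^ 2) :=
    ((by fun_prop : Continuous fun x : ℝ => x ^ 2 * (1 - x ^ 2) ^ 2).div
      ((continuous_slopeSq c₀).pow 2) fun x => pow_ne_zero 2 (slopeSq_pos hc₀ x).ne').neg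
  have h1 : ContinuousOn (fun _ : ℝ => (1 : ℝ)) (Icc (-1) 1) := continuousOn_const
  obtain ⟨d, hd⟩ := exists_hasDerivAt_lowest (Q := ampForm) (A := form _ _ h1 hβ1.continuousOn)
    (c₀ := c₀) (K := 4 / c₀ ^ 2) (continuous_slopeSq c₀).continuousOn
    (fun x _ => slopeSq_pos hc₀ x) (continuous_ampPot hc₀).continuousOn (by rw [ampForm, dif_pos hc₀])
    (form_symm _ _) (by positivity) (by
      filter_upwards [lt_mem_nhds hc₀] with c hc f _
      have i0 := integrable_ampForm_sub hc hc₀ f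
      have i1 : Integrable (fun x => (c - c₀) * (1 * f x ^ 2
          + -(x ^ 2 * (1 - x ^ 2) ^ 2 / slopeSq c₀ x ^ 2) * prim f x ^ 2)) cell :=
        (((integrable_sq f).const_mul 1).add
          (integrable_cont_mul hβ1.continuousOn (integrable_prim_sq f))).const_mul (c - c₀)
      have e : ampForm c f f - ampForm c₀ f f - (c - c₀) * form _ _ h1 hβ1.continuousOn f f
          = ∫ x, x ^ 2 * (1 - x ^ 2) ^ 2 * (c - c₀) ^ 2 / (slopeSq c x * slopeSq c₀ x ^ 2)
            * prim f x ^ 2 ∂cell := by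
        rw [ampForm_apply hc, ampForm_apply hc₀, form_apply_self,
          ← integral_sub (integrable_ampForm hc f) (integrable_ampForm hc₀ f),
          ← integral_const_mul, ← integral_sub i0 i1]
        refine integral_congr_ae (ae_of_all _ fun x => ?_)
        have h1 := (slopeSq_pos hc x).ne'
        have h2 := (slopeSq_pos hc₀ x).ne'
        simp only
        field_simp
        simp only [slopeSq]
        ring
      rw [e, ← Real.norm_eq_abs]
      have hb : ∀ x ∈ Ioo (-1 : ℝ) 1,
          ‖x ^ 2 * (1 - x ^ 2) ^ 2 * (c - c₀) ^ 2 / (slopeSq c x * slopeSq c₀ x ^ 2)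
            * prim f x ^ 2‖ ≤ 1 / c₀ ^ 2 * (c - c₀) ^ 2 * prim f x ^ 2 := by
        intro x hx
        have hs := slopeSq_pos hc x
        have hs0 := slopeSq_pos hc₀ x
        rw [Real.norm_of_nonneg (by positivity)]
        gcongr
        rw [div_mul_eq_mul_div, one_mul, div_le_div_iff₀ (by positivity) (by positivity)]
        have a1 : x ^ 2 * (1 - x ^ 2) ^ 2 ≤ slopeSq c x := by
          have : x ^ 2 ≤ 1 := by nlinarith [hx.1, hx.2]
          rw [slopeSq]
          nlinarith [sq_nonneg (1 - x ^ 2)]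
        have a2 : c₀ ^ 2 ≤ slopeSq c₀ x ^ 2 := by
          gcongr
          rw [slopeSq]; linarith [sq_nonneg (1 - x ^ 2)]
        calc x ^ 2 * (1 - x ^ 2) ^ 2 * (c - c₀) ^ 2 * c₀ ^ 2
            ≤ slopeSq c x * (c - c₀) ^ 2 * slopeSq c₀ x ^ 2 := by gcongr
          _ = _ := by ring
      refine (norm_integral_le_of_norm_le ((integrable_prim_sq f).const_mul _)
        (ae_cell hb)).trans ?_
      rw [integral_const_mul, ← norm_primL_sq]
      calc 1 / c₀ ^ 2 * (c - c₀) ^ 2 * ‖primL f‖ ^ 2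
          ≤ 1 / c₀ ^ 2 * (c - c₀) ^ 2 * (4 * ‖f‖ ^ 2) := by
            gcongr
            exact norm_primL_sq_le f
        _ = _ := by ring)
  refine ⟨d, ?_, hd⟩
  have hs := hd.tendsto_slope.mono_left (nhdsWithin_mono c₀ (show Ioi c₀ ⊆ {c₀}ᶜ from
    fun x hx => ne_of_gt hx))
  refine ge_of_tendsto hs ?_
  filter_upwards [self_mem_nhdsWithin] with c hc
  have hc' : 0 < c - c₀ := sub_pos.2 hc
  rw [slope_def_field, le_div_iff₀ hc']
  have := ampEig_mono hc₀ hc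
  simp only [ampEig] at this ⊢
  linarith

/-- For a small first integral the trial function `1 - x²` shows instability. -/
lemma ampEig_lt_one : ampEig (1 / 10) < 1 := by
  have hg : IsC1 (fun x : ℝ => 1 - x ^ 2) (fun x => -(2 * x)) :=
    ⟨by fun_prop, by fun_prop, fun x _ => by simpa using (hasDerivAt_pow 2 x).const_sub 1⟩
  set f := ofCont _ hg.cont' with hf
  have hp : ∀ x ∈ Icc (-1 : ℝ) 1, prim f x = 1 - x ^ 2 := fun x hx => by
    rw [hg.prim_eq (coe_ofCont _) hx]; norm_num
  have hY : f ∈ Y := mem_Y.2 (by rw [hp 1 (by norm_num)]; norm_num)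
  have hc : (0 : ℝ) < 1 / 10 := by norm_num
  have h1 := ampEig_mul_le hc hY
  have ii : ∀ {F : ℝ → ℝ}, Continuous F → IntervalIntegrable F volume (-1) 1 :=
    fun h => h.intervalIntegrable _ _
  have e1 : ‖primL f‖ ^ 2 = 16 / 15 := by
    rw [norm_primL_sq, integral_cell, intervalIntegral.integral_congr
      (g := fun x => 1 - 2 * x ^ 2 + x ^ 4) (fun x hx => by
        rw [uIcc_of_le (by norm_num)] at hx
        simp only [hp x hx]; ring)]
    rw [intervalIntegral.integral_add (ii (by fun_prop)) (ii (by fun_prop)),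
      intervalIntegral.integral_sub (ii (by fun_prop)) (ii (by fun_prop)),
      intervalIntegral.integral_const_mul, integral_pow, integral_pow]
    norm_num
  have e2 : ampForm (1 / 10) f f ≤ 92 / 105 := by
    rw [ampForm_apply hc]
    have hc2 : Continuous fun x : ℝ => 22 / 5 * x ^ 2 - 8 * x ^ 4 + 4 * x ^ 6 := by fun_prop
    have e3 : ∫ x, (22 / 5 * x ^ 2 - 8 * x ^ 4 + 4 * x ^ 6) ∂cell = 92 / 105 := by
      rw [integral_cell, intervalIntegral.integral_add (ii (by fun_prop)) (ii (by fun_prop)),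
        intervalIntegral.integral_sub (ii (by fun_prop)) (ii (by fun_prop)),
        intervalIntegral.integral_const_mul, intervalIntegral.integral_const_mul,
        intervalIntegral.integral_const_mul, integral_pow, integral_pow, integral_pow]
      norm_num
    rw [← e3]
    refine integral_mono_ae (integrable_ampForm hc f) (integrable_cell hc2.continuousOn) ?_
    filter_upwards [coe_ofCont hg.cont'] with x hx
    rw [hx]
    have hs := slopeSq_pos hc x
    have : 0 ≤ 1 / 10 * x ^ 2 / slopeSq (1 / 10) x * prim f x ^ 2 := by positivity
    have e4 : slopeSq (1 / 10) x * (-(2 * x)) ^ 2 = 22 / 5 * x ^ 2 - 8 * x ^ 4 + 4 * x ^ 6 := by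
      rw [slopeSq]; ring
    rw [e4]; linarith
  rw [e1] at h1
  linarith

/-! ### The monotone profile and its first integral -/

/-- The slope of a profile as a function of its value, frozen outside `[-1, 1]` so that the
resulting autonomous equation has global solutions. -/
def slope (c v : ℝ) : ℝ := √(slopeSq c (max (-1) (min v 1)))

lemma clamp_eq {v : ℝ} (hv : v ∈ Icc (-1 : ℝ) 1) : max (-1) (min v 1) = v := by
  rw [min_eq_left hv.2, max_eq_right hv.1]

lemma slope_eq (c : ℝ) {v : ℝ} (hv : v ∈ Icc (-1 : ℝ) 1) : slope c v = √(slopeSq c v) := by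
  rw [slope, clamp_eq hv]

lemma slope_pos {c : ℝ} (hc : 0 < c) (v : ℝ) : 0 < slope c v := Real.sqrt_pos.2 (slopeSq_pos hc _)

lemma slope_sq {c : ℝ} (hc : 0 < c) (v : ℝ) :
    slope c v ^ 2 = (1 - (max (-1) (min v 1)) ^ 2) ^ 2 + c := Real.sq_sqrt (slopeSq_pos hc _).le

lemma continuous_slope (c : ℝ) : Continuous (slope c) := by
  unfold slope slopeSq; fun_prop

lemma sqrt_le_slope {c : ℝ} (v : ℝ) : √c ≤ slope c v :=
  Real.sqrt_le_sqrt (by rw [slopeSq]; linarith [sq_nonneg (1 - (max (-1) (min v 1)) ^ 2)])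

lemma slope_le {c : ℝ} (v : ℝ) : slope c v ≤ √(1 + c) := by
  refine Real.sqrt_le_sqrt ?_
  have h1 : -1 ≤ max (-1) (min v 1) := le_max_left _ _
  have h2 : max (-1) (min v 1) ≤ 1 := max_le (by norm_num) (min_le_right _ _)
  have h3 : (max (-1) (min v 1)) ^ 2 ≤ 1 := by nlinarith
  rw [slopeSq]
  nlinarith [sq_nonneg (max (-1) (min v 1))]

/-- The time needed to travel from `0` to `u` at speed `slope c`. -/
def travel (c u : ℝ) : ℝ := ∫ v in (0 : ℝ)..u, (slope c v)⁻¹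

lemma continuous_slope_inv {c : ℝ} (hc : 0 < c) : Continuous fun v => (slope c v)⁻¹ :=
  (continuous_slope c).inv₀ fun v => (slope_pos hc v).ne'

lemma hasDerivAt_travel {c : ℝ} (hc : 0 < c) (u : ℝ) :
    HasDerivAt (travel c) (slope c u)⁻¹ u :=
  (continuous_slope_inv hc).integral_hasStrictDerivAt 0 u |>.hasDerivAt

lemma travel_zero (c : ℝ) : travel c 0 = 0 := intervalIntegral.integral_same

lemma travel_neg (c u : ℝ) : travel c (-u) = -travel c u := by
  have h : ∀ v, slope c (-v) = slope c v := by
    intro v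
    have : max (-1) (min (-v) 1) = -max (-1) (min v 1) := by
      rcases le_total v 1 with h1 | h1 <;> rcases le_total (-1) v with h2 | h2 <;>
        simp only [min_def, max_def] <;> split_ifs <;> linarith
    rw [slope, slope, this, slopeSq, slopeSq, neg_sq]
  rw [travel, travel, ← intervalIntegral.integral_symm]
  have := intervalIntegral.integral_comp_neg (a := 0) (b := -u) fun v => (slope c v)⁻¹
  simp only [h, neg_neg, neg_zero] at this
  exact this

lemma travel_strictMono {c : ℝ} (hc : 0 < c) : StrictMono (travel c) :=
  strictMono_of_hasDerivAt_pos (hasDerivAt_travel hc) fun u => inv_pos.2 (slope_pos hc u)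

lemma travel_sub_ge {c : ℝ} (hc : 0 < c) {u v : ℝ} (h : u ≤ v) :
    (√(1 + c))⁻¹ * (v - u) ≤ travel c v - travel c u := by
  have hm : Monotone fun u => travel c u - (√(1 + c))⁻¹ * u := by
    refine monotone_of_hasDerivAt_nonneg
      (f' := fun u => (slope c u)⁻¹ - (√(1 + c))⁻¹ * 1) (fun u => ?_) fun u => ?_
    · exact (hasDerivAt_travel hc u).sub ((hasDerivAt_id u).const_mul _)
    · simp only [Pi.zero_apply, mul_one, sub_nonneg]
      exact inv_anti₀ (slope_pos hc u) (slope_le u)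
  have := hm h
  simp only at this
  linarith

lemma travel_surjective {c : ℝ} (hc : 0 < c) : Function.Surjective (travel c) := by
  have hcont : Continuous (travel c) :=
    continuous_iff_continuousAt.2 fun u => (hasDerivAt_travel hc u).continuousAt
  have hk : 0 < (√(1 + c))⁻¹ := by positivity
  refine hcont.surjective ?_ ?_
  · refine tendsto_atTop_mono' atTop ?_ (tendsto_id.const_mul_atTop hk)
    filter_upwards [eventually_ge_atTop 0] with u hu
    have := travel_sub_ge hc hu
    simpa [travel_zero] using this
  · refine tendsto_atBot_mono' atBot ?_ (tendsto_id.const_mul_atBot hk)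
    filter_upwards [eventually_le_atBot 0] with u hu
    have := travel_sub_ge hc hu
    simp only [travel_zero, id] at this ⊢
    linarith

/-- The solution of `u' = slope c u`, `u(0) = 0`, as the inverse of the travel time (and `0` for
`c ≤ 0`). -/
def orbit (c t : ℝ) : ℝ :=
  if hc : 0 < c then
    ((travel_strictMono hc).orderIsoOfSurjective (travel c) (travel_surjective hc)).symm t
  else 0

lemma travel_orbit {c : ℝ} (hc : 0 < c) (t : ℝ) : travel c (orbit c t) = t := by
  rw [orbit, dif_pos hc]
  exact ((travel_strictMono hc).orderIsoOfSurjective (travel c)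
    (travel_surjective hc)).apply_symm_apply t

lemma orbit_travel {c : ℝ} (hc : 0 < c) (u : ℝ) : orbit c (travel c u) = u :=
  (travel_strictMono hc).injective (travel_orbit hc _)

lemma hasDerivAt_orbit {c : ℝ} (hc : 0 < c) (t : ℝ) :
    HasDerivAt (orbit c) (slope c (orbit c t)) t := by
  have hcont : Continuous (orbit c) := by
    have : orbit c = ((travel_strictMono hc).orderIsoOfSurjective (travel c)
        (travel_surjective hc)).symm := by
      ext t; rw [orbit, dif_pos hc]
    rw [this]
    exact OrderIso.continuous _
  have := HasDerivAt.of_local_left_inverse (f := travel c) (g := orbit c) (a := t)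
    hcont.continuousAt (hasDerivAt_travel hc _) (inv_ne_zero (slope_pos hc _).ne')
    (Eventually.of_forall fun s => travel_orbit hc s)
  rwa [inv_inv] at this

/-- The time needed to travel from `0` to `1`: half the time between `-1` and `1`. -/
def halfTime (c : ℝ) : ℝ := ∫ v in (0 : ℝ)..1, (√(slopeSq c v))⁻¹

lemma travel_one (c : ℝ) : travel c 1 = halfTime c := by
  refine intervalIntegral.integral_congr fun v hv => ?_
  rw [uIcc_of_le (by norm_num)] at hv
  rw [slope_eq c ⟨by linarith [hv.1], hv.2⟩]

lemma continuous_sqrt_inv {c : ℝ} (hc : 0 < c) : Continuous fun v => (√(slopeSq c v))⁻¹ :=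
  (continuous_slopeSq c).sqrt.inv₀ fun v => (Real.sqrt_pos.2 (slopeSq_pos hc v)).ne'

lemma exists_hasDerivAt_halfTime {c₀ : ℝ} (hc₀ : 0 < c₀) :
    ∃ d, d < 0 ∧ HasDerivAt halfTime d c₀ := by
  set F' : ℝ → ℝ → ℝ := fun c v => -((2 * √(slopeSq c v))⁻¹ / slopeSq c v) with hF'
  have hF'c : Continuous (F' c₀) :=
    (((continuous_const.mul (continuous_slopeSq c₀).sqrt).inv₀ fun v =>
      (mul_pos two_pos (Real.sqrt_pos.2 (slopeSq_pos hc₀ v))).ne').div (continuous_slopeSq c₀)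
      fun v => (slopeSq_pos hc₀ v).ne').neg
  have hnhds : Ioi (c₀ / 2) ∈ 𝓝 c₀ := Ioi_mem_nhds (by linarith)
  have h := intervalIntegral.hasDerivAt_integral_of_dominated_loc_of_deriv_le
    (μ := volume) (a := 0) (b := 1) (F := fun c v => (√(slopeSq c v))⁻¹) (F' := F')
    (x₀ := c₀) (bound := fun _ => (2 * √(c₀ / 2))⁻¹ / (c₀ / 2)) hnhds
    (by
      filter_upwards [lt_mem_nhds hc₀] with c hc
      exact (continuous_sqrt_inv hc).aestronglyMeasurable)
    ((continuous_sqrt_inv hc₀).intervalIntegrable _ _) hF'c.aestronglyMeasurable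
    (ae_of_all _ fun v _ c hc => by
      have hc' : c₀ / 2 < c := hc
      have h1 : c₀ / 2 ≤ slopeSq c v := by rw [slopeSq]; linarith [sq_nonneg (1 - v ^ 2)]
      have h2 : 0 < c₀ / 2 := by linarith
      have h3 : 0 < slopeSq c v := h2.trans_le h1
      rw [hF', norm_neg, Real.norm_of_nonneg (by positivity)]
      gcongr)
    intervalIntegrable_const
    (ae_of_all _ fun v _ c hc => by
      have hc' : c₀ / 2 < c := hc
      have h3 : 0 < slopeSq c v := slopeSq_pos (by linarith) v
      have h1 : HasDerivAt (fun c => slopeSq c v) 1 c := by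
        simpa [slopeSq] using (hasDerivAt_id c).const_add ((1 - v ^ 2) ^ 2)
      refine ((h1.sqrt h3.ne').inv (Real.sqrt_pos.2 h3).ne').congr_deriv ?_
      rw [Real.sq_sqrt h3.le, hF', neg_div, one_div])
  refine ⟨_, ?_, h.2⟩
  rw [hF', intervalIntegral.integral_neg, neg_lt_zero]
  refine intervalIntegral.intervalIntegral_pos_of_pos (Continuous.intervalIntegrable ?_ _ _)
    (fun v => ?_) (by norm_num)
  · simpa only [hF', Pi.neg_def, neg_neg] using hF'c.neg
  · have h3 := slopeSq_pos hc₀ v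
    positivity

lemma halfTime_strictAnti : StrictAntiOn halfTime (Ioi 0) := by
  refine strictAntiOn_of_deriv_neg (convex_Ioi 0) (fun c hc => ?_) fun c hc => ?_
  · obtain ⟨d, -, hd⟩ := exists_hasDerivAt_halfTime hc
    exact hd.continuousAt.continuousWithinAt
  · rw [interior_Ioi] at hc
    obtain ⟨d, h, hd⟩ := exists_hasDerivAt_halfTime hc
    rwa [hd.deriv]

lemma halfTime_le {c : ℝ} (hc : 0 < c) : halfTime c ≤ (√c)⁻¹ := by
  have : halfTime c ≤ ∫ _v in (0 : ℝ)..1, (√c)⁻¹ := by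
    refine intervalIntegral.integral_mono_on (by norm_num)
      ((continuous_sqrt_inv hc).intervalIntegrable _ _) intervalIntegrable_const fun v _ => ?_
    refine inv_anti₀ (Real.sqrt_pos.2 hc) (Real.sqrt_le_sqrt ?_)
    rw [slopeSq]; linarith [sq_nonneg (1 - v ^ 2)]
  simpa using this

/-- The travel time diverges logarithmically as the first integral tends to zero. -/
lemma log_le_halfTime {b : ℝ} (hb : 0 < b) : Real.log ((2 + b) / b) / 2 ≤ halfTime (b ^ 2) := by
  have hb2 : 0 < b ^ 2 := by positivity
  have hpos : ∀ v ∈ uIcc (0 : ℝ) 1, 0 < 2 * (1 - v) + b := by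
    intro v hv
    rw [uIcc_of_le (by norm_num)] at hv
    linarith [hv.2]
  have hcont : ContinuousOn (fun v : ℝ => (2 * (1 - v) + b)⁻¹) (uIcc 0 1) :=
    ContinuousOn.inv₀ (by fun_prop) fun v hv => (hpos v hv).ne'
  have e : ∫ v in (0 : ℝ)..1, (2 * (1 - v) + b)⁻¹ = Real.log ((2 + b) / b) / 2 := by
    rw [intervalIntegral.integral_eq_sub_of_hasDerivAt
      (f := fun v => -(Real.log (2 * (1 - v) + b) / 2)) (fun v hv => ?_) hcont.intervalIntegrable]
    · rw [Real.log_div (by positivity) hb.ne']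
      norm_num
      ring
    · have h1 : HasDerivAt (fun v : ℝ => 2 * (1 - v) + b) (-2) v := by
        simpa using (((hasDerivAt_id v).const_sub 1).const_mul 2).add_const b
      refine (((h1.log (hpos v hv).ne').div_const 2).neg).congr_deriv ?_
      have := (hpos v hv).ne'
      field_simp
  rw [← e]
  refine intervalIntegral.integral_mono_on (by norm_num) hcont.intervalIntegrable
    ((continuous_sqrt_inv hb2).intervalIntegrable _ _) fun v hv => ?_
  refine inv_anti₀ (Real.sqrt_pos.2 (slopeSq_pos hb2 v)) ?_
  rw [Real.sqrt_le_left (by linarith [hv.2]), slopeSq]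
  have h1 : 0 ≤ 1 - v := by linarith [hv.2]
  have h2 : 1 - v ^ 2 ≤ 2 * (1 - v) := by nlinarith [hv.1]
  have h3 : 0 ≤ 1 - v ^ 2 := by nlinarith [hv.1]
  nlinarith [mul_nonneg h1 hb.le]

lemma exists_halfTime_eq {L : ℝ} (hL : 0 < L) : ∃ c, 0 < c ∧ halfTime c = L := by
  set b := 2 * Real.exp (-(2 * L)) with hb
  have hb0 : 0 < b := by positivity
  have h1 : L ≤ halfTime (b ^ 2) := by
    refine le_trans ?_ (log_le_halfTime hb0)
    rw [le_div_iff₀ (by norm_num), Real.le_log_iff_exp_le (by positivity), le_div_iff₀ hb0, hb]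
    have : Real.exp (L * 2) * Real.exp (-(2 * L)) = 1 := by
      rw [← Real.exp_add]; simp; ring
    have := Real.exp_pos (-(2 * L))
    nlinarith
  have h2 : halfTime ((L⁻¹) ^ 2) ≤ L := by
    refine (halfTime_le (by positivity)).trans ?_
    rw [Real.sqrt_sq (by positivity), inv_inv]
  have hcont : ContinuousOn halfTime (Ioi 0) := fun c hc => by
    obtain ⟨d, -, hd⟩ := exists_hasDerivAt_halfTime hc
    exact hd.continuousAt.continuousWithinAt
  obtain ⟨c, hc, h⟩ := isPreconnected_Ioi.intermediate_value
    (show (L⁻¹) ^ 2 ∈ Ioi (0 : ℝ) from by simp only [mem_Ioi]; positivity)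
    (show b ^ 2 ∈ Ioi (0 : ℝ) from by simp only [mem_Ioi]; positivity) hcont ⟨h2, h1⟩
  exact ⟨c, hc, h⟩

/-- The first integral of the profile at parameter `lam`: the number whose half travel time is
`√2 * lam` (and `0` for `lam ≤ 0`). -/
def firstIntegral (lam : ℝ) : ℝ :=
  if h : 0 < √2 * lam then Classical.choose (exists_halfTime_eq h) else 0

lemma sqrt_two_mul_pos {lam : ℝ} (h : 0 < lam) : 0 < √2 * lam := by positivity

lemma firstIntegral_pos {lam : ℝ} (h : 0 < lam) : 0 < firstIntegral lam := by
  rw [firstIntegral, dif_pos (sqrt_two_mul_pos h)]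
  exact (Classical.choose_spec (exists_halfTime_eq (sqrt_two_mul_pos h))).1

lemma halfTime_firstIntegral {lam : ℝ} (h : 0 < lam) :
    halfTime (firstIntegral lam) = √2 * lam := by
  rw [firstIntegral, dif_pos (sqrt_two_mul_pos h)]
  exact (Classical.choose_spec (exists_halfTime_eq (sqrt_two_mul_pos h))).2

lemma firstIntegral_strictAnti : StrictAntiOn firstIntegral (Ioi 0) := by
  intro a ha b hb hab
  by_contra! h
  have := halfTime_strictAnti.antitoneOn (firstIntegral_pos ha) (firstIntegral_pos hb) h
  rw [halfTime_firstIntegral ha, halfTime_firstIntegral hb] at this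
  have h2 : (0 : ℝ) < √2 := by positivity
  nlinarith

lemma halfTime_pos {c : ℝ} (hc : 0 < c) : 0 < halfTime c := by
  refine intervalIntegral.intervalIntegral_pos_of_pos
    ((continuous_sqrt_inv hc).intervalIntegrable _ _) (fun v => ?_) (by norm_num)
  have := slopeSq_pos hc v
  positivity

lemma firstIntegral_halfTime {c : ℝ} (hc : 0 < c) : firstIntegral (halfTime c / √2) = c := by
  have h : 0 < halfTime c / √2 := div_pos (halfTime_pos hc) (by positivity)
  refine halfTime_strictAnti.injOn (firstIntegral_pos h) hc ?_
  rw [halfTime_firstIntegral h]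
  field_simp

lemma continuousAt_firstIntegral {lam : ℝ} (h : 0 < lam) : ContinuousAt firstIntegral lam := by
  have hm : StrictMonoOn (fun l => -firstIntegral l) (Ioi 0) := firstIntegral_strictAnti.neg
  have hi : (fun l => -firstIntegral l) '' Ioi 0 ∈ 𝓝 (-firstIntegral lam) := by
    refine mem_of_superset (Iio_mem_nhds (neg_lt_zero.2 (firstIntegral_pos h))) ?_
    intro c hc
    have hc' : 0 < -c := neg_pos.2 hc
    refine ⟨halfTime (-c) / √2, div_pos (halfTime_pos hc') (by positivity), ?_⟩
    simp only [firstIntegral_halfTime hc', neg_neg]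
  simpa only [neg_neg] using (hm.continuousAt_of_image_mem_nhds (Ioi_mem_nhds h) hi).fun_neg

lemma exists_hasDerivAt_firstIntegral {lam : ℝ} (h : 0 < lam) :
    ∃ d, d < 0 ∧ HasDerivAt firstIntegral d lam := by
  obtain ⟨d, hd0, hd⟩ := exists_hasDerivAt_halfTime (firstIntegral_pos h)
  have h2 : (0 : ℝ) < √2 := by positivity
  refine ⟨(d / √2)⁻¹, inv_lt_zero.2 (div_neg_of_neg_of_pos hd0 h2), ?_⟩
  refine HasDerivAt.of_local_left_inverse (f := fun c => halfTime c / √2)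
    (continuousAt_firstIntegral h) (hd.div_const _) (div_neg_of_neg_of_pos hd0 h2).ne ?_
  filter_upwards [lt_mem_nhds h] with l hl
  rw [halfTime_firstIntegral hl]
  field_simp

/-- `u` is an increasing profile on `[-1, 1]` joining `-1` to `1`, with speed `k` and first
integral `c`, and `ξ` is its inverse. -/
structure IsProfile (k c : ℝ) (u ξ : ℝ → ℝ) : Prop where
  k_pos : 0 < k
  c_pos : 0 < c
  deriv : ∀ x ∈ Icc (-1 : ℝ) 1, HasDerivAt u (k * √(slopeSq c (u x))) x
  mem : ∀ x ∈ Icc (-1 : ℝ) 1, u x ∈ Icc (-1 : ℝ) 1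
  left : u (-1) = -1
  right : u 1 = 1
  inv_deriv : ∀ v ∈ Icc (-1 : ℝ) 1, HasDerivAt ξ (k * √(slopeSq c v))⁻¹ v
  inv_mem : ∀ v ∈ Icc (-1 : ℝ) 1, ξ v ∈ Icc (-1 : ℝ) 1
  apply_inv : ∀ v, u (ξ v) = v
  inv_apply : ∀ x, ξ (u x) = x

/-- The increasing profile at parameter `lam`. -/
def profile (lam x : ℝ) : ℝ := orbit (firstIntegral lam) (√2 * lam * x)

/-- The inverse of the increasing profile. -/
def profileInv (lam v : ℝ) : ℝ := travel (firstIntegral lam) v / (√2 * lam)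

lemma isProfile {lam : ℝ} (h : 0 < lam) :
    IsProfile (√2 * lam) (firstIntegral lam) (profile lam) (profileInv lam) := by
  have hk := sqrt_two_mul_pos h
  have hc := firstIntegral_pos h
  have hT : travel (firstIntegral lam) 1 = √2 * lam := by
    rw [travel_one, halfTime_firstIntegral h]
  have hui : ∀ v, profile lam (profileInv lam v) = v := by
    intro v
    rw [profile, profileInv, mul_div_cancel₀ _ hk.ne', orbit_travel hc]
  have hiu : ∀ x, profileInv lam (profile lam x) = x := by
    intro x
    rw [profile, profileInv, travel_orbit hc, mul_div_cancel_left₀ _ hk.ne']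
  have hi1 : profileInv lam 1 = 1 := by rw [profileInv, hT, div_self hk.ne']
  have hi2 : profileInv lam (-1) = -1 := by
    rw [profileInv, travel_neg, hT, neg_div, div_self hk.ne']
  have hi_mono : StrictMono (profileInv lam) := fun a b hab =>
    div_lt_div_of_pos_right (travel_strictMono hc hab) hk
  have h1 : profile lam 1 = 1 := by
    have := hui 1; rwa [hi1] at this
  have h2 : profile lam (-1) = -1 := by
    have := hui (-1); rwa [hi2] at this
  have hmem : ∀ x ∈ Icc (-1 : ℝ) 1, profile lam x ∈ Icc (-1 : ℝ) 1 := by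
    intro x hx
    constructor
    · rw [← hi_mono.le_iff_le, hiu, hi2]; exact hx.1
    · rw [← hi_mono.le_iff_le, hiu, hi1]; exact hx.2
  refine ⟨hk, hc, ?_, hmem, h2, h1, ?_, ?_, hui, hiu⟩
  · intro x hx
    rw [← slope_eq _ (hmem x hx)]
    have h3 : HasDerivAt (fun x => √2 * lam * x) (√2 * lam) x := by
      simpa using (hasDerivAt_id x).const_mul (√2 * lam)
    have := (hasDerivAt_orbit hc (√2 * lam * x)).comp x h3
    rw [mul_comm]
    exact this
  · intro v hv
    rw [← slope_eq _ hv, mul_inv, mul_comm, ← div_eq_mul_inv]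
    exact (hasDerivAt_travel hc v).div_const _
  · intro v hv
    exact ⟨by rw [← hi2]; exact hi_mono.monotone hv.1, by rw [← hi1]; exact hi_mono.monotone hv.2⟩

lemma abs_travel_sub_le {c c₀ u : ℝ} (hc : 0 < c) (hc₀ : 0 < c₀) (hu : u ∈ Icc (-1 : ℝ) 1) :
    |travel c u - travel c₀ u| ≤ |c - c₀| / (c₀ * √c) := by
  have hb : ∀ v ∈ uIoc 0 u, ‖(slope c v)⁻¹ - (slope c₀ v)⁻¹‖ ≤ |c - c₀| / (c₀ * √c) := by
    intro v _
    have p := slope_pos hc v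
    have p0 := slope_pos hc₀ v
    have h1 : slope c v ^ 2 - slope c₀ v ^ 2 = c - c₀ := by
      rw [slope_sq hc, slope_sq hc₀]; ring
    have h2 : (slope c v)⁻¹ - (slope c₀ v)⁻¹
        = -((c - c₀) / ((slope c v + slope c₀ v) * (slope c v * slope c₀ v))) := by
      rw [← h1]
      have := p.ne'; have := p0.ne'
      field_simp
      ring
    rw [h2, norm_neg, norm_div, Real.norm_eq_abs, Real.norm_of_nonneg (by positivity)]
    refine div_le_div_of_nonneg_left (abs_nonneg _) (by positivity) ?_
    have h3 := sqrt_le_slope (c := c) v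
    have h4 := sqrt_le_slope (c := c₀) v
    have h5 : √c₀ * √c₀ = c₀ := Real.mul_self_sqrt hc₀.le
    calc c₀ * √c = √c₀ * (√c * √c₀) := by linear_combination (-√c) * h5
      _ ≤ (slope c v + slope c₀ v) * (slope c v * slope c₀ v) := by
        gcongr; linarith
  have := intervalIntegral.norm_integral_le_of_norm_le_const hb
  rw [intervalIntegral.integral_sub ((continuous_slope_inv hc).intervalIntegrable _ _)
    ((continuous_slope_inv hc₀).intervalIntegrable _ _), sub_zero] at this
  refine this.trans ?_
  have h1 : |u| ≤ 1 := abs_le.2 hu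
  have h2 : 0 ≤ |c - c₀| / (c₀ * √c) := by positivity
  nlinarith

/-- The profiles depend continuously on the parameter, uniformly on `[-1, 1]`. -/
lemma profile_tendsto {lam₀ : ℝ} (h₀ : 0 < lam₀) {ε : ℝ} (hε : 0 < ε) :
    ∀ᶠ l in 𝓝 lam₀, ∀ x ∈ Icc (-1 : ℝ) 1, |profile l x - profile lam₀ x| ≤ ε := by
  have hc₀ := firstIntegral_pos h₀
  set c₀ := firstIntegral lam₀ with hc₀'
  set B : ℝ → ℝ := fun l => √(1 + c₀) *
    (|firstIntegral l - c₀| / (c₀ * √(firstIntegral l)) + √2 * |l - lam₀|) with hB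
  have hlim : Tendsto B (𝓝 lam₀) (𝓝 0) := by
    have hc := continuousAt_firstIntegral h₀
    have h1 : ContinuousAt B lam₀ := by
      refine continuousAt_const.mul (ContinuousAt.add (ContinuousAt.div ?_ ?_ ?_) ?_)
      · exact (hc.sub continuousAt_const).abs
      · exact continuousAt_const.mul hc.sqrt
      · exact (mul_pos hc₀ (Real.sqrt_pos.2 hc₀)).ne'
      · fun_prop
    have h2 : B lam₀ = 0 := by simp [hB, hc₀']
    rw [← h2]; exact h1
  filter_upwards [hlim.eventually (gt_mem_nhds hε), lt_mem_nhds h₀] with l hl hl0 x hx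
  have hc := firstIntegral_pos hl0
  have hm := (isProfile hl0).mem x hx
  set u := profile l x
  set u₀ := profile lam₀ x
  have e1 : travel (firstIntegral l) u = √2 * l * x := travel_orbit hc _
  have e2 : travel c₀ u₀ = √2 * lam₀ * x := travel_orbit hc₀ _
  have h1 := abs_travel_sub_le hc hc₀ hm
  have h2 : |u - u₀| ≤ √(1 + c₀) * |travel c₀ u - travel c₀ u₀| := by
    have hs : (0 : ℝ) < √(1 + c₀) := by positivity
    rcases le_total u₀ u with h | h
    · have := travel_sub_ge hc₀ h
      rw [inv_mul_le_iff₀ hs] at this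
      rw [abs_of_nonneg (sub_nonneg.2 h)]
      exact this.trans (by gcongr; exact le_abs_self _)
    · have := travel_sub_ge hc₀ h
      rw [inv_mul_le_iff₀ hs] at this
      rw [abs_sub_comm, abs_of_nonneg (sub_nonneg.2 h), abs_sub_comm]
      exact this.trans (by gcongr; exact le_abs_self _)
  have h3 : |travel c₀ u - travel c₀ u₀|
      ≤ |firstIntegral l - c₀| / (c₀ * √(firstIntegral l)) + √2 * |l - lam₀| := by
    have e3 : travel c₀ u - travel c₀ u₀
        = -(travel (firstIntegral l) u - travel c₀ u) + √2 * (l - lam₀) * x := by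
      rw [e1, e2]; ring
    rw [e3]
    refine (abs_add_le _ _).trans ?_
    rw [abs_neg]
    refine add_le_add h1 ?_
    rw [abs_mul, abs_mul, abs_of_nonneg (Real.sqrt_nonneg 2)]
    have : |x| ≤ 1 := abs_le.2 hx
    have h4 : 0 ≤ √2 * |l - lam₀| := by positivity
    nlinarith
  calc |u - u₀| ≤ _ := h2
    _ ≤ B l := mul_le_mul_of_nonneg_left h3 (Real.sqrt_nonneg _)
    _ ≤ ε := hl.le

/-! ### The amplitude as a coordinate -/

lemma IsC1.ofCont_mem_Y {g g' : ℝ → ℝ} (hg : IsC1 g g') (h1 : g (-1) = 0) (h2 : g 1 = 0) :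
    ofCont g' hg.cont' ∈ Y := by
  rw [mem_Y, hg.prim_eq (coe_ofCont _) (by norm_num), h1, h2, sub_zero]

lemma IsC1.norm_primL_sq {g g' : ℝ → ℝ} (hg : IsC1 g g') (h1 : g (-1) = 0) {f : L2}
    (hf : f =ᵐ[cell] g') : ‖primL f‖ ^ 2 = ∫ x, g x ^ 2 ∂cell := by
  rw [Nematic.norm_primL_sq]
  refine integral_congr_ae (ae_cell fun x hx => ?_)
  simp only [hg.prim_eq hf (Ioo_subset_Icc_self hx), h1, sub_zero]

lemma IsC1.form_eq {g g' : ℝ → ℝ} (hg : IsC1 g g') (h1 : g (-1) = 0) {f : L2}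
    (hf : f =ᵐ[cell] g') (α β : ℝ → ℝ) :
    ∫ x, (α x * f x ^ 2 + β x * prim f x ^ 2) ∂cell
      = ∫ x, (α x * g' x ^ 2 + β x * g x ^ 2) ∂cell := by
  refine integral_congr_ae ?_
  filter_upwards [hf, ae_restrict_mem measurableSet_Ioo] with x hx hx'
  rw [hx, hg.prim_eq hf (Ioo_subset_Icc_self hx'), h1, sub_zero]

section coordinate

variable {k c : ℝ} {u ξ : ℝ → ℝ}

lemma IsProfile.continuousOn (hp : IsProfile k c u ξ) : ContinuousOn u (Icc (-1) 1) :=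
  fun x hx => (hp.deriv x hx).continuousAt.continuousWithinAt

lemma IsProfile.inv_continuousOn (hp : IsProfile k c u ξ) : ContinuousOn ξ (Icc (-1) 1) :=
  fun x hx => (hp.inv_deriv x hx).continuousAt.continuousWithinAt

lemma IsProfile.deriv_continuousOn (hp : IsProfile k c u ξ) :
    ContinuousOn (fun x => k * √(slopeSq c (u x))) (Icc (-1) 1) :=
  continuousOn_const.mul (((continuous_slopeSq c).sqrt).comp_continuousOn hp.continuousOn)

/-- Substitution of the value `v = u x` for the position `x`. -/
lemma IsProfile.integral_comp (hp : IsProfile k c u ξ) {F : ℝ → ℝ}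
    (hF : ContinuousOn F (Icc (-1) 1)) :
    ∫ x, F (u x) * √(slopeSq c (u x)) ∂cell = k⁻¹ * ∫ v, F v ∂cell := by
  have hk := hp.k_pos.ne'
  have h := intervalIntegral.integral_comp_mul_deriv'' (a := -1) (b := 1) (f := u)
    (f' := fun x => k * √(slopeSq c (u x))) (g := F)
    (by rw [uIcc_of_le (by norm_num)]; exact hp.continuousOn)
    (fun x hx => by
      rw [min_eq_left (by norm_num), max_eq_right (by norm_num)] at hx
      exact (hp.deriv x (Ioo_subset_Icc_self hx)).hasDerivWithinAt)
    (by rw [uIcc_of_le (by norm_num)]; exact hp.deriv_continuousOn)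
    (hF.mono (by
      rw [uIcc_of_le (by norm_num)]
      rintro _ ⟨x, hx, rfl⟩
      exact hp.mem x hx))
  rw [hp.left, hp.right] at h
  rw [integral_cell, integral_cell, ← h, ← intervalIntegral.integral_const_mul]
  refine intervalIntegral.integral_congr fun x _ => ?_
  simp only [Function.comp_apply]
  field_simp

/-- The square root of the slope, as a function of the value of the profile. With this weight the
change of variables preserves the `L²` norm up to a constant factor. -/
def ampWeight (c v : ℝ) : ℝ := √(√(slopeSq c v))

lemma ampWeight_pos (hc : 0 < c) (v : ℝ) : 0 < ampWeight c v :=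
  Real.sqrt_pos.2 (Real.sqrt_pos.2 (slopeSq_pos hc v))

lemma ampWeight_sq (v : ℝ) : ampWeight c v ^ 2 = √(slopeSq c v) :=
  Real.sq_sqrt (Real.sqrt_nonneg _)

lemma hasDerivAt_slopeSq (v : ℝ) : HasDerivAt (slopeSq c) (-4 * v * (1 - v ^ 2)) v := by
  have h := (((hasDerivAt_pow 2 v).const_sub 1).pow 2).add_const c
  refine h.congr_deriv ?_
  norm_num
  ring

lemma hasDerivAt_ampWeight (hc : 0 < c) (v : ℝ) :
    HasDerivAt (ampWeight c) (-(v * (1 - v ^ 2) / slopeSq c v) * ampWeight c v) v := by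
  have hs := slopeSq_pos hc v
  have h1 := (hasDerivAt_slopeSq (c := c) v).sqrt hs.ne'
  have h2 := h1.sqrt (Real.sqrt_pos.2 hs).ne'
  refine h2.congr_deriv ?_
  have e1 : √(√(slopeSq c v)) ≠ 0 := (ampWeight_pos hc v).ne'
  have e2 : √(slopeSq c v) ≠ 0 := (Real.sqrt_pos.2 hs).ne'
  have e3 : √(√(slopeSq c v)) ^ 2 = √(slopeSq c v) := ampWeight_sq v
  have e4 : √(slopeSq c v) ^ 2 = slopeSq c v := Real.sq_sqrt hs.le
  rw [ampWeight]
  generalize √(√(slopeSq c v)) = r at *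
  generalize √(slopeSq c v) = σ at *
  rw [← e4, ← e3]
  field_simp
  ring

lemma continuous_ampWeight (c : ℝ) : Continuous (ampWeight c) :=
  (continuous_slopeSq c).sqrt.sqrt

lemma continuous_drift (hc : 0 < c) : Continuous fun v => v * (1 - v ^ 2) / slopeSq c v :=
  (by fun_prop : Continuous fun v : ℝ => v * (1 - v ^ 2)).div (continuous_slopeSq c)
    fun v => (slopeSq_pos hc v).ne'

/-- Under `h(x) = ampWeight (u x) g(u x)` the second variation on symmetry-breaking perturbations
turns into the amplitude form; the cross term `v (1 - v²) (g²)'` is integrated by parts. -/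
lemma IsProfile.form_transfer (hp : IsProfile k c u ξ) {g g' h h' : ℝ → ℝ} (hg : IsC1 g g')
    (e : ∀ x ∈ Icc (-1 : ℝ) 1, h x = ampWeight c (u x) * g (u x))
    (e' : ∀ x ∈ Icc (-1 : ℝ) 1, h' x = k * √(slopeSq c (u x)) * (ampWeight c (u x)
      * (g' (u x) - u x * (1 - u x ^ 2) / slopeSq c (u x) * g (u x)))) :
    ∫ x, h x ^ 2 ∂cell = k⁻¹ * ∫ v, g v ^ 2 ∂cell ∧
    ∫ x, (4 / k ^ 2 * h' x ^ 2 + 8 * (u x ^ 2 - 1) * h x ^ 2) ∂cell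
      = k⁻¹ * (4 * ∫ v, (slopeSq c v * g' v ^ 2 + -(c * v ^ 2 / slopeSq c v) * g v ^ 2) ∂cell
        - 4 * ∫ v, g v ^ 2 ∂cell) := by
  have hc := hp.c_pos
  have hk := hp.k_pos.ne'
  constructor
  · rw [← hp.integral_comp (F := fun v => g v ^ 2) (hg.cont.pow 2)]
    refine integral_congr_ae (ae_cell fun x hx => ?_)
    simp only
    rw [e x (Ioo_subset_Icc_self hx), mul_pow, ampWeight_sq, mul_comm]
  · set F : ℝ → ℝ := fun v => 4 * slopeSq c v
      * (g' v - v * (1 - v ^ 2) / slopeSq c v * g v) ^ 2 - 8 * (1 - v ^ 2) * g v ^ 2 with hF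
    have hFc : ContinuousOn F (Icc (-1) 1) :=
      ((continuous_const.mul (continuous_slopeSq c)).continuousOn.mul
        ((hg.cont'.sub ((continuous_drift hc).continuousOn.mul hg.cont)).pow 2)).sub
        ((by fun_prop : Continuous fun v : ℝ => 8 * (1 - v ^ 2)).continuousOn.mul (hg.cont.pow 2))
    have e1 : ∫ x, (4 / k ^ 2 * h' x ^ 2 + 8 * (u x ^ 2 - 1) * h x ^ 2) ∂cell
        = k⁻¹ * ∫ v, F v ∂cell := by
      rw [← hp.integral_comp hFc]
      refine integral_congr_ae (ae_cell fun x hx => ?_)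
      have hx' := Ioo_subset_Icc_self hx
      simp only [hF]
      rw [e x hx', e' x hx']
      have e4 : √(slopeSq c (u x)) ^ 2 = slopeSq c (u x) := Real.sq_sqrt (slopeSq_pos hc _).le
      have e5 := ampWeight_sq (c := c) (u x)
      have hs := (slopeSq_pos hc (u x)).ne'
      generalize u x * (1 - u x ^ 2) / slopeSq c (u x) = b
      simp only [mul_pow, e5]
      rw [e4]
      field_simp
      ring
    rw [e1]
    congr 1
    -- the two integrands differ by the derivative of `4 v (1 - v²) g²`
    have hd : ContinuousOn (fun v => (4 - 12 * v ^ 2) * g v ^ 2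
        + 4 * v * (1 - v ^ 2) * (2 * g v * g' v)) (Icc (-1) 1) :=
      ((by fun_prop : Continuous fun v : ℝ => 4 - 12 * v ^ 2).continuousOn.mul (hg.cont.pow 2)).add
        ((by fun_prop : Continuous fun v : ℝ => 4 * v * (1 - v ^ 2)).continuousOn.mul
          ((continuousOn_const.mul hg.cont).mul hg.cont'))
    have hz : ∫ v, ((4 - 12 * v ^ 2) * g v ^ 2
        + 4 * v * (1 - v ^ 2) * (2 * g v * g' v)) ∂cell = 0 := by
      rw [integral_cell]
      rw [intervalIntegral.integral_eq_sub_of_hasDerivAt_of_le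
        (f := fun v => 4 * v * (1 - v ^ 2) * g v ^ 2) (by norm_num)
        ((by fun_prop : Continuous fun v : ℝ => 4 * v * (1 - v ^ 2)).continuousOn.mul
          (hg.cont.pow 2)) (fun v hv => ?_) (hd.intervalIntegrable_of_Icc (by norm_num))]
      · norm_num
      · have h1 : HasDerivAt (fun v : ℝ => 4 * v * (1 - v ^ 2)) (4 - 12 * v ^ 2) v := by
          refine (((hasDerivAt_id v).const_mul 4).mul
            ((hasDerivAt_pow 2 v).const_sub 1)).congr_deriv ?_
          norm_num
          ring
        refine (h1.mul ((hg.deriv v hv).pow 2)).congr_deriv ?_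
        simp only [Pi.pow_apply]
        norm_num
    have i1 : Integrable (fun v => slopeSq c v * g' v ^ 2 + -(c * v ^ 2 / slopeSq c v) * g v ^ 2)
        cell := integrable_cell (((continuous_slopeSq c).continuousOn.mul (hg.cont'.pow 2)).add
          ((continuous_ampPot hc).continuousOn.mul (hg.cont.pow 2)))
    have i2 : Integrable (fun v => g v ^ 2) cell := integrable_cell (hg.cont.pow 2)
    rw [← integral_const_mul, ← integral_const_mul,
      ← integral_sub (i1.const_mul 4) (i2.const_mul 4), ← add_zero (∫ v, F v ∂cell), ← hz,
      ← integral_add (integrable_cell hFc) (integrable_cell hd)]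
    refine integral_congr_ae (ae_of_all _ fun v => ?_)
    have hs := (slopeSq_pos hc v).ne'
    simp only [hF]
    field_simp
    simp only [slopeSq]
    ring

/-- The lowest symmetry-breaking eigenvalue is determined by the first integral alone. -/
lemma IsProfile.lowest_eq (hp : IsProfile k c u ξ) (q : L2 → ℝ)
    (hq : ∀ f, q f = ∫ x, (4 / k ^ 2 * f x ^ 2 + 8 * (u x ^ 2 - 1) * prim f x ^ 2) ∂cell) :
    lowest q = 4 * ampEig c - 4 := by
  have hc := hp.c_pos
  have hk := hp.k_pos
  have hα : ContinuousOn (fun _ : ℝ => 4 / k ^ 2) (Icc (-1) 1) := continuousOn_const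
  have hβ : ContinuousOn (fun x => 8 * (u x ^ 2 - 1)) (Icc (-1) 1) :=
    continuousOn_const.mul ((hp.continuousOn.pow 2).sub continuousOn_const)
  obtain rfl : q = fun f => form _ _ hα hβ f f := by
    ext f; rw [hq, form_apply_self]
  have hclosed : ∀ (M : ℝ) (B : L2 →L[ℝ] L2 →L[ℝ] ℝ),
      IsClosed {f : L2 | M * ‖primL f‖ ^ 2 ≤ B f f} := fun M B =>
    isClosed_le (continuous_const.mul (primL.continuous.norm.pow 2)) (continuous_bilin_self B)
  have hkey : ∀ f ∈ Y, (4 * ampEig c - 4) * ‖primL f‖ ^ 2 ≤ form _ _ hα hβ f f := by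
    intro f hf
    refine induction_cont_Y (hclosed (4 * ampEig c - 4) (form _ _ hα hβ)) ?_ hf
    intro f hf h' hh' hfh
    have hP := isC1_prim hh' hfh
    set g : ℝ → ℝ := fun v => (ampWeight c v)⁻¹ * prim f (ξ v) with hg
    set g' : ℝ → ℝ := fun v => (ampWeight c v)⁻¹ * (v * (1 - v ^ 2) / slopeSq c v * prim f (ξ v)
      + h' (ξ v) * (k * √(slopeSq c v))⁻¹) with hg'
    have hξ := hp.inv_continuousOn
    have hξm : MapsTo ξ (Icc (-1) 1) (Icc (-1) 1) := hp.inv_mem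
    have hrc : ContinuousOn (fun v => (ampWeight c v)⁻¹) (Icc (-1) 1) :=
      ((continuous_ampWeight c).inv₀ fun v => (ampWeight_pos hc v).ne').continuousOn
    have hgC : IsC1 g g' := by
      refine ⟨hrc.mul (hP.cont.comp hξ hξm), hrc.mul
        (((continuous_drift hc).continuousOn.mul (hP.cont.comp hξ hξm)).add
          ((hh'.comp hξ hξm).mul (Continuous.continuousOn ?_))), ?_⟩
      · exact (continuous_const.mul (continuous_slopeSq c).sqrt).inv₀ fun v =>
          (mul_pos hk (Real.sqrt_pos.2 (slopeSq_pos hc v))).ne'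
      · intro v hv
        have hξv : ξ v ∈ Ioo (-1 : ℝ) 1 := by
          have h1 := hp.inv_mem v (Ioo_subset_Icc_self hv)
          refine ⟨lt_of_le_of_ne h1.1 fun h => ?_, lt_of_le_of_ne h1.2 fun h => ?_⟩
          · have := hp.apply_inv v
            rw [← h, hp.left] at this
            exact hv.1.ne this
          · have := hp.apply_inv v
            rw [h, hp.right] at this
            exact hv.2.ne' this
        have d1 := (hasDerivAt_ampWeight hc v).inv (ampWeight_pos hc v).ne'
        have d2 := (hP.deriv _ hξv).comp v (hp.inv_deriv v (Ioo_subset_Icc_self hv))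
        refine (d1.mul d2).congr_deriv ?_
        have := (ampWeight_pos hc v).ne'
        simp only [hg', Function.comp_apply, Pi.inv_apply]
        field_simp
    have hξ1 : ξ 1 = 1 := by have := hp.inv_apply 1; rwa [hp.right] at this
    have hξ2 : ξ (-1) = -1 := by have := hp.inv_apply (-1); rwa [hp.left] at this
    have hg1 : g (-1) = 0 := by simp only [hg, hξ2, prim_neg_one, mul_zero]
    have hg2 : g 1 = 0 := by simp only [hg, hξ1, mem_Y.1 hf, mul_zero]
    obtain ⟨t1, t2⟩ := hp.form_transfer (h := prim f) (h' := h') hgC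
      (fun x hx => by
        have := (ampWeight_pos hc (u x)).ne'
        simp only [hg, hp.inv_apply]
        field_simp)
      (fun x hx => by
        have h1 := (ampWeight_pos hc (u x)).ne'
        have h2 := (Real.sqrt_pos.2 (slopeSq_pos hc (u x))).ne'
        simp only [hg, hg', hp.inv_apply]
        field_simp
        ring)
    have hG := ampEig_mul_le hc (hgC.ofCont_mem_Y hg1 hg2)
    rw [hgC.norm_primL_sq hg1 (coe_ofCont _), ampForm_apply hc,
      hgC.form_eq hg1 (coe_ofCont _)] at hG
    rw [hP.norm_primL_sq (prim_neg_one f) hfh, form_apply_self,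
      hP.form_eq (prim_neg_one f) hfh, t1, t2, mul_left_comm]
    refine mul_le_mul_of_nonneg_left ?_ (inv_nonneg.2 hk.le)
    linarith
  refine le_antisymm ?_ (le_lowest hkey)
  have : (lowest (fun f => form _ _ hα hβ f f) + 4) / 4 ≤ ampEig c := by
    refine le_lowest fun f hf => ?_
    refine induction_cont_Y (hclosed _ (ampForm c)) ?_ hf
    intro f hf g' hg' hfg
    have hP := isC1_prim hg' hfg
    set h : ℝ → ℝ := fun x => ampWeight c (u x) * prim f (u x) with hh
    set h' : ℝ → ℝ := fun x => k * √(slopeSq c (u x)) * (ampWeight c (u x)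
      * (g' (u x) - u x * (1 - u x ^ 2) / slopeSq c (u x) * prim f (u x))) with hh'
    have hu := hp.continuousOn
    have hum : MapsTo u (Icc (-1) 1) (Icc (-1) 1) := hp.mem
    have hhC : IsC1 h h' := by
      refine ⟨((continuous_ampWeight c).comp_continuousOn hu).mul (hP.cont.comp hu hum),
        hp.deriv_continuousOn.mul (((continuous_ampWeight c).comp_continuousOn hu).mul
          ((hg'.comp hu hum).sub (((continuous_drift hc).comp_continuousOn hu).mul
            (hP.cont.comp hu hum)))), ?_⟩
      intro x hx
      have hux : u x ∈ Ioo (-1 : ℝ) 1 := by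
        have h1 := hp.mem x (Ioo_subset_Icc_self hx)
        refine ⟨lt_of_le_of_ne h1.1 fun h => ?_, lt_of_le_of_ne h1.2 fun h => ?_⟩
        · have := congrArg ξ (h.symm.trans hp.left.symm)
          rw [hp.inv_apply, hp.inv_apply] at this
          exact hx.1.ne' this
        · have := congrArg ξ (h.trans hp.right.symm)
          rw [hp.inv_apply, hp.inv_apply] at this
          exact hx.2.ne this
      have d := hp.deriv x (Ioo_subset_Icc_self hx)
      have d1 := (hasDerivAt_ampWeight hc (u x)).comp x d
      have d2 := (hP.deriv _ hux).comp x d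
      refine (d1.mul d2).congr_deriv ?_
      simp only [hh', Function.comp_apply]
      ring
    have hh1 : h (-1) = 0 := by simp only [hh, hp.left, prim_neg_one, mul_zero]
    have hh2 : h 1 = 0 := by simp only [hh, hp.right, mem_Y.1 hf, mul_zero]
    obtain ⟨t1, t2⟩ := hp.form_transfer (h := h) (h' := h') hP
      (fun x _ => rfl) (fun x _ => rfl)
    have hG := lowest_mul_le' hkey (hhC.ofCont_mem_Y hh1 hh2)
    rw [hhC.norm_primL_sq hh1 (coe_ofCont _), form_apply_self,
      hhC.form_eq hh1 (coe_ofCont _), t1, t2, mul_left_comm] at hG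
    rw [hP.norm_primL_sq (prim_neg_one f) hfg, ampForm_apply hc,
      hP.form_eq (prim_neg_one f) hfg]
    have := le_of_mul_le_mul_left hG (inv_pos.2 hk)
    linarith
  linarith

end coordinate

/-! ### First and second variation of the energy -/

/-- The derivative of the bulk energy density at `q` in the direction `h`. -/
def dBulk (θ q₁ q₂ q₃ h₁ h₂ h₃ : ℝ) : ℝ :=
  2 * (3 * q₁ * h₁ + q₂ * h₂ + q₃ * h₃) * (θ / 3 + (3 * q₁ ^ 2 + q₂ ^ 2 + q₃ ^ 2))
    + 4 * h₁ * (q₁ ^ 2 - q₂ ^ 2 - q₃ ^ 2) + 8 * q₁ * (q₁ * h₁ - q₂ * h₂ - q₃ * h₃)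

/-- The second derivative of the bulk energy density at `q`, as a quadratic form in `h`. -/
def d2Bulk (θ q₁ q₂ q₃ h₁ h₂ h₃ : ℝ) : ℝ :=
  2 * (3 * h₁ ^ 2 + h₂ ^ 2 + h₃ ^ 2) * (θ / 3 + (3 * q₁ ^ 2 + q₂ ^ 2 + q₃ ^ 2))
    + 4 * (3 * q₁ * h₁ + q₂ * h₂ + q₃ * h₃) ^ 2
    + 16 * h₁ * (q₁ * h₁ - q₂ * h₂ - q₃ * h₃) + 8 * q₁ * (h₁ ^ 2 - h₂ ^ 2 - h₃ ^ 2)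

/-- The cubic coefficient of the bulk energy density along `t ↦ q + t h`. -/
def d3Bulk (q₁ q₂ q₃ h₁ h₂ h₃ : ℝ) : ℝ :=
  2 * (3 * q₁ * h₁ + q₂ * h₂ + q₃ * h₃) * (3 * h₁ ^ 2 + h₂ ^ 2 + h₃ ^ 2)
    + 4 * h₁ * (h₁ ^ 2 - h₂ ^ 2 - h₃ ^ 2)

lemma bulk_expand (θ q₁ q₂ q₃ h₁ h₂ h₃ t : ℝ) :
    bulk θ (q₁ + t * h₁) (q₂ + t * h₂) (q₃ + t * h₃) = bulk θ q₁ q₂ q₃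
      + t * dBulk θ q₁ q₂ q₃ h₁ h₂ h₃ + t ^ 2 / 2 * d2Bulk θ q₁ q₂ q₃ h₁ h₂ h₃
      + t ^ 3 * d3Bulk q₁ q₂ q₃ h₁ h₂ h₃ + t ^ 4 * ((3 * h₁ ^ 2 + h₂ ^ 2 + h₃ ^ 2) ^ 2 / 2) := by
  simp only [bulk, bulk₀, dBulk, d2Bulk, d3Bulk]
  ring

lemma integrable_dirichlet (lam : ℝ) (f₁ f₂ f₃ g₁ g₂ g₃ : L2) :
    Integrable (fun x => (3 * (f₁ x * g₁ x) + f₂ x * g₂ x + f₃ x * g₃ x) / lam ^ 2) cell :=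
  ((((integrable_mul_coe f₁ g₁).const_mul 3).add (integrable_mul_coe f₂ g₂)).add
    (integrable_mul_coe f₃ g₃)).div_const _

lemma integral_quartic {F₀ F₁ F₂ F₃ F₄ : ℝ → ℝ} (i₀ : Integrable F₀ cell)
    (i₁ : Integrable F₁ cell) (i₂ : Integrable F₂ cell) (i₃ : Integrable F₃ cell)
    (i₄ : Integrable F₄ cell) (a b c d : ℝ) :
    ∫ x, (F₀ x + a * F₁ x + b * F₂ x + c * F₃ x + d * F₄ x) ∂cell
      = ∫ x, F₀ x ∂cell + a * ∫ x, F₁ x ∂cell + b * ∫ x, F₂ x ∂cell + c * ∫ x, F₃ x ∂cell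
        + d * ∫ x, F₄ x ∂cell := by
  have j₁ : Integrable (fun x => F₀ x + a * F₁ x) cell := i₀.add (i₁.const_mul a)
  have j₂ : Integrable (fun x => F₀ x + a * F₁ x + b * F₂ x) cell := j₁.add (i₂.const_mul b)
  have j₃ : Integrable (fun x => F₀ x + a * F₁ x + b * F₂ x + c * F₃ x) cell :=
    j₂.add (i₃.const_mul c)
  rw [integral_add j₃ (i₄.const_mul d), integral_add j₂ (i₃.const_mul c),
    integral_add j₁ (i₂.const_mul b), integral_add i₀ (i₁.const_mul a)]
  simp only [integral_const_mul]

/-- Along a line the energy is a quartic polynomial in the parameter. -/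
lemma energy_expand (θ lam : ℝ) (Q H : Config) {q₁ q₂ q₃ h₁ h₂ h₃ : ℝ → ℝ}
    (c₁ : Continuous q₁) (c₂ : Continuous q₂) (c₃ : Continuous q₃)
    (k₁ : Continuous h₁) (k₂ : Continuous h₂) (k₃ : Continuous h₃)
    (e₁ : val Q.1 =ᵐ[cell] q₁) (e₂ : val Q.2.1 =ᵐ[cell] q₂) (e₃ : val Q.2.2 =ᵐ[cell] q₃)
    (d₁ : val H.1 =ᵐ[cell] h₁) (d₂ : val H.2.1 =ᵐ[cell] h₂) (d₃ : val H.2.2 =ᵐ[cell] h₃) :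
    ∃ a₀ a₃ a₄ : ℝ, ∀ t : ℝ, energy θ lam (Q + t • H) = a₀
      + t * (∫ x, 2 * ((3 * (der Q.1 x * der H.1 x) + der Q.2.1 x * der H.2.1 x
          + der Q.2.2 x * der H.2.2 x) / lam ^ 2)
          + dBulk θ (q₁ x) (q₂ x) (q₃ x) (h₁ x) (h₂ x) (h₃ x) ∂cell)
      + t ^ 2 / 2 * (∫ x, 2 * ((3 * (der H.1 x * der H.1 x) + der H.2.1 x * der H.2.1 x
          + der H.2.2 x * der H.2.2 x) / lam ^ 2)
          + d2Bulk θ (q₁ x) (q₂ x) (q₃ x) (h₁ x) (h₂ x) (h₃ x) ∂cell)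
      + t ^ 3 * a₃ + t ^ 4 * a₄ := by
  have i0 := integrable_dirichlet lam Q.1.1.snd Q.2.1.1.snd Q.2.2.1.snd
    Q.1.1.snd Q.2.1.1.snd Q.2.2.1.snd
  have i1 := integrable_dirichlet lam Q.1.1.snd Q.2.1.1.snd Q.2.2.1.snd
    H.1.1.snd H.2.1.1.snd H.2.2.1.snd
  have i2 := integrable_dirichlet lam H.1.1.snd H.2.1.1.snd H.2.2.1.snd
    H.1.1.snd H.2.1.1.snd H.2.2.1.snd
  have b0 : Integrable (fun x => bulk θ (q₁ x) (q₂ x) (q₃ x)) cell :=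
    integrable_cell (Continuous.continuousOn (by unfold bulk bulk₀; fun_prop))
  have b1 : Integrable (fun x => dBulk θ (q₁ x) (q₂ x) (q₃ x) (h₁ x) (h₂ x) (h₃ x)) cell :=
    integrable_cell (Continuous.continuousOn (by unfold dBulk; fun_prop))
  have b2 : Integrable (fun x => d2Bulk θ (q₁ x) (q₂ x) (q₃ x) (h₁ x) (h₂ x) (h₃ x)) cell :=
    integrable_cell (Continuous.continuousOn (by unfold d2Bulk; fun_prop))
  have b3 : Integrable (fun x => d3Bulk (q₁ x) (q₂ x) (q₃ x) (h₁ x) (h₂ x) (h₃ x)) cell :=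
    integrable_cell (Continuous.continuousOn (by unfold d3Bulk; fun_prop))
  have b4 : Integrable (fun x => (3 * h₁ x ^ 2 + h₂ x ^ 2 + h₃ x ^ 2) ^ 2 / 2) cell :=
    integrable_cell (Continuous.continuousOn (by fun_prop))
  have j0 : Integrable (fun x => (3 * (der Q.1 x * der Q.1 x) + der Q.2.1 x * der Q.2.1 x
      + der Q.2.2 x * der Q.2.2 x) / lam ^ 2 + bulk θ (q₁ x) (q₂ x) (q₃ x)) cell := i0.add b0
  have j1 : Integrable (fun x => 2 * ((3 * (der Q.1 x * der H.1 x) + der Q.2.1 x * der H.2.1 x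
      + der Q.2.2 x * der H.2.2 x) / lam ^ 2)
      + dBulk θ (q₁ x) (q₂ x) (q₃ x) (h₁ x) (h₂ x) (h₃ x)) cell := (i1.const_mul 2).add b1
  have j2 : Integrable (fun x => 2 * ((3 * (der H.1 x * der H.1 x) + der H.2.1 x * der H.2.1 x
      + der H.2.2 x * der H.2.2 x) / lam ^ 2)
      + d2Bulk θ (q₁ x) (q₂ x) (q₃ x) (h₁ x) (h₂ x) (h₃ x)) cell := (i2.const_mul 2).add b2
  refine ⟨∫ x, ((3 * (der Q.1 x * der Q.1 x) + der Q.2.1 x * der Q.2.1 x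
      + der Q.2.2 x * der Q.2.2 x) / lam ^ 2 + bulk θ (q₁ x) (q₂ x) (q₃ x)) ∂cell,
    ∫ x, d3Bulk (q₁ x) (q₂ x) (q₃ x) (h₁ x) (h₂ x) (h₃ x) ∂cell,
    ∫ x, (3 * h₁ x ^ 2 + h₂ x ^ 2 + h₃ x ^ 2) ^ 2 / 2 ∂cell, fun t => ?_⟩
  rw [← integral_quartic j0 j1 j2 b3 b4]
  refine integral_congr_ae ?_
  filter_upwards [e₁, e₂, e₃, d₁, d₂, d₃, val_add Q.1 (t • H.1), val_add Q.2.1 (t • H.2.1),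
    val_add Q.2.2 (t • H.2.2), der_add Q.1 (t • H.1), der_add Q.2.1 (t • H.2.1),
    der_add Q.2.2 (t • H.2.2), val_smul t H.1, val_smul t H.2.1, val_smul t H.2.2,
    der_smul t H.1, der_smul t H.2.1, der_smul t H.2.2] with x e1 e2 e3 d1 d2 d3 v1 v2 v3 w1 w2 w3
    s1 s2 s3 r1 r2 r3
  simp only [Prod.fst_add, Prod.snd_add, Prod.smul_fst, Prod.smul_snd]
  rw [v1, v2, v3, w1, w2, w3, s1, s2, s3, r1, r2, r3, e1, e2, e3, d1, d2, d3, bulk_expand]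
  ring

lemma hasDerivAt_quartic (a₀ a₁ a₂ a₃ a₄ t : ℝ) :
    HasDerivAt (fun t : ℝ => a₀ + t * a₁ + t ^ 2 / 2 * a₂ + t ^ 3 * a₃ + t ^ 4 * a₄)
      (a₁ + t * a₂ + 3 * t ^ 2 * a₃ + 4 * t ^ 3 * a₄) t := by
  refine ((((((hasDerivAt_id t).mul_const a₁).const_add a₀).add
    (((hasDerivAt_pow 2 t).div_const 2).mul_const a₂)).add
    ((hasDerivAt_pow 3 t).mul_const a₃)).add ((hasDerivAt_pow 4 t).mul_const a₄)).congr_deriv ?_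
  norm_num

lemma hasDerivAt_energy (θ lam : ℝ) (Q H : Config) {q₁ q₂ q₃ h₁ h₂ h₃ : ℝ → ℝ}
    (c₁ : Continuous q₁) (c₂ : Continuous q₂) (c₃ : Continuous q₃)
    (k₁ : Continuous h₁) (k₂ : Continuous h₂) (k₃ : Continuous h₃)
    (e₁ : val Q.1 =ᵐ[cell] q₁) (e₂ : val Q.2.1 =ᵐ[cell] q₂) (e₃ : val Q.2.2 =ᵐ[cell] q₃)
    (d₁ : val H.1 =ᵐ[cell] h₁) (d₂ : val H.2.1 =ᵐ[cell] h₂) (d₃ : val H.2.2 =ᵐ[cell] h₃) :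
    HasDerivAt (fun t : ℝ => energy θ lam (Q + t • H))
      (∫ x, 2 * ((3 * (der Q.1 x * der H.1 x) + der Q.2.1 x * der H.2.1 x
          + der Q.2.2 x * der H.2.2 x) / lam ^ 2)
          + dBulk θ (q₁ x) (q₂ x) (q₃ x) (h₁ x) (h₂ x) (h₃ x) ∂cell) 0 := by
  obtain ⟨a₀, a₃, a₄, h⟩ := energy_expand θ lam Q H c₁ c₂ c₃ k₁ k₂ k₃ e₁ e₂ e₃ d₁ d₂ d₃
  rw [funext h]
  refine (hasDerivAt_quartic _ _ _ _ _ 0).congr_deriv ?_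
  ring

lemma secondVariation_eq (θ lam : ℝ) (Q H : Config) {q₁ q₂ q₃ h₁ h₂ h₃ : ℝ → ℝ}
    (c₁ : Continuous q₁) (c₂ : Continuous q₂) (c₃ : Continuous q₃)
    (k₁ : Continuous h₁) (k₂ : Continuous h₂) (k₃ : Continuous h₃)
    (e₁ : val Q.1 =ᵐ[cell] q₁) (e₂ : val Q.2.1 =ᵐ[cell] q₂) (e₃ : val Q.2.2 =ᵐ[cell] q₃)
    (d₁ : val H.1 =ᵐ[cell] h₁) (d₂ : val H.2.1 =ᵐ[cell] h₂) (d₃ : val H.2.2 =ᵐ[cell] h₃) :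
    secondVariation θ lam Q H
      = ∫ x, 2 * ((3 * (der H.1 x * der H.1 x) + der H.2.1 x * der H.2.1 x
          + der H.2.2 x * der H.2.2 x) / lam ^ 2)
          + d2Bulk θ (q₁ x) (q₂ x) (q₃ x) (h₁ x) (h₂ x) (h₃ x) ∂cell := by
  obtain ⟨a₀, a₃, a₄, h⟩ := energy_expand θ lam Q H c₁ c₂ c₃ k₁ k₂ k₃ e₁ e₂ e₃ d₁ d₂ d₃
  have hd : ∀ a₁ a₂ : ℝ, iteratedDeriv 2
      (fun t : ℝ => a₀ + t * a₁ + t ^ 2 / 2 * a₂ + t ^ 3 * a₃ + t ^ 4 * a₄) 0 = a₂ := by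
    intro a₁ a₂
    rw [iteratedDeriv_succ, iteratedDeriv_one,
      funext fun t => (hasDerivAt_quartic a₀ a₁ a₂ a₃ a₄ t).deriv]
    have := ((((hasDerivAt_id (0 : ℝ)).mul_const a₂).const_add a₁).add
      (((hasDerivAt_pow 2 (0 : ℝ)).const_mul 3).mul_const a₃)).add
      (((hasDerivAt_pow 3 (0 : ℝ)).const_mul 4).mul_const a₄)
    exact (this.congr_deriv (g' := a₂) (by norm_num)).deriv
  rw [secondVariation, funext h, hd]

lemma qPlus_eq : qPlus (-8) = 2 / 3 := by
  rw [qPlus, show (1 - (-8) : ℝ) = 3 ^ 2 by norm_num, Real.sqrt_sq (by norm_num)]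
  norm_num

/-- The configuration with the boundary values of the problem and the derivatives `f₁, f₂, f₃`. -/
def cfg (f₁ f₂ f₃ : L2) : Config := (mkH (2 / 3) f₁, mkH 2 f₂, primH f₃)

lemma isAdmissible_iff {Q : Config} : IsAdmissible (-8) Q ↔ ∃ f₁ f₂ f₃ : L2,
    prim f₁ 1 = 0 ∧ prim f₂ 1 = -4 ∧ prim f₃ 1 = 0 ∧ Q = cfg f₁ f₂ f₃ := by
  rw [IsAdmissible, hasBoundaryValues_iff, hasBoundaryValues_iff, hasBoundaryValues_iff, qPlus_eq]
  constructor
  · rintro ⟨⟨f, h1, h2⟩, ⟨g, h3, h4⟩, h, h5, h6⟩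
    refine ⟨f, g, h, by rw [h1]; norm_num, by rw [h3]; norm_num, by rw [h5]; norm_num, ?_⟩
    rw [cfg, ← h2, ← mkH_zero_left h, ← h6, Prod.ext_iff, Prod.ext_iff]
    exact ⟨rfl, h4.trans (by norm_num), rfl⟩
  · rintro ⟨f, g, h, h1, h2, h3, rfl⟩
    exact ⟨⟨f, by rw [h1]; norm_num, rfl⟩, ⟨g, by rw [h2]; norm_num, by norm_num [cfg]⟩,
      h, by rw [h3]; norm_num, (mkH_zero_left h).symm⟩

/-- The derivative of the energy at `cfg f₁ f₂ f₃` in the direction of the primitives of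
`g₁, g₂, g₃`. -/
def weakForm (lam : ℝ) (f₁ f₂ f₃ g₁ g₂ g₃ : L2) : ℝ :=
  ∫ x, 2 * ((3 * (f₁ x * g₁ x) + f₂ x * g₂ x + f₃ x * g₃ x) / lam ^ 2)
    + dBulk (-8) (2 / 3 + prim f₁ x) (2 + prim f₂ x) (prim f₃ x) (prim g₁ x) (prim g₂ x)
      (prim g₃ x) ∂cell

lemma hasDerivAt_energy_cfg (lam : ℝ) (f₁ f₂ f₃ g₁ g₂ g₃ : L2) :
    HasDerivAt (fun t : ℝ => energy (-8) lam (cfg f₁ f₂ f₃ + t • (primH g₁, primH g₂, primH g₃)))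
      (weakForm lam f₁ f₂ f₃ g₁ g₂ g₃) 0 := by
  refine (hasDerivAt_energy (-8) lam (cfg f₁ f₂ f₃) (primH g₁, primH g₂, primH g₃)
    (by fun_prop) (by fun_prop) (by fun_prop) (by fun_prop) (by fun_prop) (by fun_prop)
    (val_mkH _ _) (val_mkH _ _) (val_primH _) (val_primH _) (val_primH _)
    (val_primH _)).congr_deriv ?_
  refine integral_congr_ae ?_
  filter_upwards [der_mkH (2 / 3) f₁, der_mkH 2 f₂] with x h1 h2
  simp only [cfg, h1, h2, der_primH]

lemma secondVariation_cfg (lam : ℝ) (f₁ f₂ f₃ g₁ g₂ g₃ : L2) :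
    secondVariation (-8) lam (cfg f₁ f₂ f₃) (primH g₁, primH g₂, primH g₃)
      = ∫ x, 2 * ((3 * (g₁ x * g₁ x) + g₂ x * g₂ x + g₃ x * g₃ x) / lam ^ 2)
        + d2Bulk (-8) (2 / 3 + prim f₁ x) (2 + prim f₂ x) (prim f₃ x) (prim g₁ x) (prim g₂ x)
          (prim g₃ x) ∂cell := by
  rw [secondVariation_eq (-8) lam (cfg f₁ f₂ f₃) (primH g₁, primH g₂, primH g₃)
    (by fun_prop) (by fun_prop) (by fun_prop) (by fun_prop) (by fun_prop) (by fun_prop)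
    (val_mkH _ _) (val_mkH _ _) (val_primH _) (val_primH _) (val_primH _) (val_primH _)]
  simp only [der_primH]

lemma isCriticalPoint_cfg_iff {lam : ℝ} {f₁ f₂ f₃ : L2} (h₁ : prim f₁ 1 = 0)
    (h₂ : prim f₂ 1 = -4) (h₃ : prim f₃ 1 = 0) : IsCriticalPoint (-8) lam (cfg f₁ f₂ f₃) ↔
      ∀ g₁ ∈ Y, ∀ g₂ ∈ Y, ∀ g₃ ∈ Y, weakForm lam f₁ f₂ f₃ g₁ g₂ g₃ = 0 := by
  constructor
  · rintro ⟨-, h⟩ g₁ hg₁ g₂ hg₂ g₃ hg₃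
    exact (hasDerivAt_energy_cfg lam f₁ f₂ f₃ g₁ g₂ g₃).unique
      (h _ ⟨isH10_iff.2 ⟨g₁, hg₁, rfl⟩, isH10_iff.2 ⟨g₂, hg₂, rfl⟩, isH10_iff.2 ⟨g₃, hg₃, rfl⟩⟩)
  · intro h
    refine ⟨isAdmissible_iff.2 ⟨f₁, f₂, f₃, h₁, h₂, h₃, rfl⟩, ?_⟩
    rintro ⟨H1, H2, H3⟩ ⟨k1, k2, k3⟩
    obtain ⟨g₁, hg₁, rfl⟩ := isH10_iff.1 k1
    obtain ⟨g₂, hg₂, rfl⟩ := isH10_iff.1 k2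
    obtain ⟨g₃, hg₃, rfl⟩ := isH10_iff.1 k3
    exact (hasDerivAt_energy_cfg lam f₁ f₂ f₃ g₁ g₂ g₃).congr_deriv (h _ hg₁ _ hg₂ _ hg₃)

lemma IsCriticalPoint.exists_cfg {lam : ℝ} {Q : Config} (h : IsCriticalPoint (-8) lam Q) :
    ∃ f₁ f₂ f₃ : L2, prim f₁ 1 = 0 ∧ prim f₂ 1 = -4 ∧ prim f₃ 1 = 0 ∧ Q = cfg f₁ f₂ f₃ ∧
      ∀ g₁ ∈ Y, ∀ g₂ ∈ Y, ∀ g₃ ∈ Y, weakForm lam f₁ f₂ f₃ g₁ g₂ g₃ = 0 := by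
  obtain ⟨f₁, f₂, f₃, h₁, h₂, h₃, rfl⟩ := isAdmissible_iff.1 h.1
  exact ⟨f₁, f₂, f₃, h₁, h₂, h₃, rfl, (isCriticalPoint_cfg_iff h₁ h₂ h₃).1 h⟩

/-! ### The scalar boundary value problem and its explicit solutions -/

/-- `2 + prim f` is a weak solution of `y'' = lam ^ 2 * (y ^ 2 - 4) * y`, `y (-1) = 2`,
`y 1 = -2`. -/
def IsScalarSol (lam : ℝ) (f : L2) : Prop :=
  prim f 1 = -4 ∧ ∀ g ∈ Y, ∫ x, (f x * g x
    + lam ^ 2 * (((2 + prim f x) ^ 2 - 4) * (2 + prim f x)) * prim g x) ∂cell = 0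

lemma prim_zero_apply (x : ℝ) : prim 0 x = 0 := by
  rw [map_zero, BoundedContinuousFunction.coe_zero, Pi.zero_apply]

lemma weakForm_scalar {lam : ℝ} (h : lam ≠ 0) (f g₁ g₂ g₃ : L2) :
    weakForm lam 0 f 0 g₁ g₂ g₃ = 2 / lam ^ 2 * ∫ x, (f x * g₂ x
      + lam ^ 2 * (((2 + prim f x) ^ 2 - 4) * (2 + prim f x)) * prim g₂ x) ∂cell := by
  rw [weakForm, ← integral_const_mul]
  refine integral_congr_ae ?_
  filter_upwards [Lp.coeFn_zero ℝ 2 cell] with x hx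
  simp only [hx, Pi.zero_apply, prim_zero_apply, dBulk]
  field_simp
  ring

/-- With `q₁ = 2/3` and `q₃ = 0` the first and third Euler–Lagrange equations hold identically. -/
lemma isCriticalPoint_scalar {lam : ℝ} (h : lam ≠ 0) {f : L2} (hf : prim f 1 = -4) :
    IsCriticalPoint (-8) lam (cfg 0 f 0) ↔ IsScalarSol lam f := by
  rw [isCriticalPoint_cfg_iff (prim_zero_apply 1) hf (prim_zero_apply 1)]
  simp only [weakForm_scalar h, mul_eq_zero]
  have : 2 / lam ^ 2 ≠ 0 := by positivity
  exact ⟨fun H => ⟨hf, fun g hg => (H 0 Y.zero_mem g hg 0 Y.zero_mem).resolve_left this⟩,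
    fun H _ _ g hg _ _ => Or.inr (H.2 g hg)⟩

/-- At a configuration `(2/3, y, 0)` the second variation is diagonal. -/
lemma secondVariation_scalar (lam : ℝ) (f g₁ g₂ g₃ : L2) :
    secondVariation (-8) lam (cfg 0 f 0) (primH g₁, primH g₂, primH g₃)
      = ∫ x, (6 / lam ^ 2 * g₁ x ^ 2 + 6 * (4 + (2 + prim f x) ^ 2) * prim g₁ x ^ 2
        + (2 / lam ^ 2 * g₂ x ^ 2 + (6 * (2 + prim f x) ^ 2 - 8) * prim g₂ x ^ 2)
        + (2 / lam ^ 2 * g₃ x ^ 2 + 2 * ((2 + prim f x) ^ 2 - 4) * prim g₃ x ^ 2)) ∂cell := by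
  rw [secondVariation_cfg]
  refine integral_congr_ae (ae_of_all _ fun x => ?_)
  simp only [prim_zero_apply, d2Bulk]
  ring

lemma integral_val_primH_sq (g : L2) : ∫ x, val (primH g) x ^ 2 ∂cell = ‖primL g‖ ^ 2 := by
  rw [norm_primL_sq]
  refine integral_congr_ae ?_
  filter_upwards [val_primH g] with x hx
  rw [hx]

lemma mu_scalar (lam : ℝ) (f : L2) : mu (-8) lam (cfg 0 f 0)
    = lowest fun g => ∫ x, (2 / lam ^ 2 * g x ^ 2
      + 2 * ((2 + prim f x) ^ 2 - 4) * prim g x ^ 2) ∂cell := by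
  have key : ∀ g : L2, secondVariation (-8) lam (cfg 0 f 0) (0, 0, primH g)
      / ∫ x, val (primH g) x ^ 2 ∂cell = (∫ x, (2 / lam ^ 2 * g x ^ 2
      + 2 * ((2 + prim f x) ^ 2 - 4) * prim g x ^ 2) ∂cell) / ‖primL g‖ ^ 2 := by
    intro g
    have := secondVariation_scalar lam f 0 0 g
    rw [map_zero] at this
    rw [integral_val_primH_sq, this]
    congr 1
    refine integral_congr_ae ?_
    filter_upwards [Lp.coeFn_zero ℝ 2 cell] with x hx
    simp only [hx, Pi.zero_apply, prim_zero_apply]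
    ring
  rw [mu, lowest]
  congr 1
  ext r
  constructor
  · rintro ⟨h, h1, h2, h3⟩
    obtain ⟨g, hg, rfl⟩ := isH10_iff.1 h1
    exact ⟨g, hg, fun h => h2 (primH_eq_zero.2 h), h3.trans (key g)⟩
  · rintro ⟨g, hg, h2, h3⟩
    exact ⟨primH g, isH10_iff.2 ⟨g, hg, rfl⟩, fun h => h2 (primH_eq_zero.1 h), h3.trans (key g).symm⟩

lemma IsProfile.deriv_two {k c : ℝ} {u ξ : ℝ → ℝ} (hp : IsProfile k c u ξ) {x : ℝ}
    (hx : x ∈ Icc (-1 : ℝ) 1) :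
    HasDerivAt (fun x => k * √(slopeSq c (u x))) (k ^ 2 * (-(2 * u x) * (1 - u x ^ 2))) x := by
  have hs : HasDerivAt (slopeSq c) (-(4 * u x) * (1 - u x ^ 2)) (u x) := by
    refine (((((hasDerivAt_pow 2 (u x)).const_sub 1).pow 2)).add_const c).congr_deriv ?_
    norm_num
    ring
  have hp0 := slopeSq_pos hp.c_pos (u x)
  refine (((hs.comp x (hp.deriv x hx)).sqrt hp0.ne').const_mul k).congr_deriv ?_
  have := (Real.sqrt_pos.2 hp0).ne'
  simp only [Function.comp_apply]
  field_simp
  ring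

/-- The derivative of the decreasing solution `-2 * profile lam` (and `0` for `lam ≤ 0`). -/
def branchDer (lam : ℝ) : L2 :=
  if h : 0 < lam then
    ofCont (fun x => -2 * (√2 * lam * √(slopeSq (firstIntegral lam) (profile lam x))))
      (continuousOn_const.mul (isProfile h).deriv_continuousOn)
  else 0

/-- The branch of eigenvalue exchange solutions. -/
def branch (lam : ℝ) : Config := cfg 0 (branchDer lam) 0

section

variable {lam : ℝ} (h : 0 < lam)
include h

lemma coe_branchDer : branchDer lam =ᵐ[cell]
    fun x => -2 * (√2 * lam * √(slopeSq (firstIntegral lam) (profile lam x))) := by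
  rw [branchDer, dif_pos h]
  exact coe_ofCont _

lemma isC1_profile : IsC1 (fun x => -2 * profile lam x)
    (fun x => -2 * (√2 * lam * √(slopeSq (firstIntegral lam) (profile lam x)))) where
  cont := continuousOn_const.mul (isProfile h).continuousOn
  cont' := continuousOn_const.mul (isProfile h).deriv_continuousOn
  deriv x hx := ((isProfile h).deriv x (Ioo_subset_Icc_self hx)).const_mul (-2)

lemma prim_branchDer {x : ℝ} (hx : x ∈ Icc (-1 : ℝ) 1) :
    2 + prim (branchDer lam) x = -2 * profile lam x := by
  rw [(isC1_profile h).prim_eq (coe_branchDer h) hx, (isProfile h).left]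
  ring

lemma isScalarSol_branchDer : IsScalarSol lam (branchDer lam) := by
  have hp := isProfile h
  have h1 : prim (branchDer lam) 1 = -4 := by
    have := prim_branchDer h (x := 1) (by norm_num)
    rw [hp.right] at this
    linarith
  refine ⟨h1, fun g hg => ?_⟩
  have hC : IsC1 (fun x => -2 * (√2 * lam * √(slopeSq (firstIntegral lam) (profile lam x))))
      (fun x => 8 * lam ^ 2 * (profile lam x * (1 - profile lam x ^ 2))) := by
    refine ⟨(isC1_profile h).cont', continuousOn_const.mul (hp.continuousOn.mul
      (continuousOn_const.sub (hp.continuousOn.pow 2))), fun x hx => ?_⟩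
    refine ((hp.deriv_two (Ioo_subset_Icc_self hx)).const_mul (-2)).congr_deriv ?_
    rw [mul_pow, Real.sq_sqrt (by norm_num)]
    ring
  have hb := integral_by_parts hC g
  rw [mem_Y.1 hg, mul_zero] at hb
  rw [← hb, ← integral_add (integrable_cont_mul hC.cont (integrable_coe g))
    (integrable_cont_mul hC.cont'
      (integrable_cell (prim g).continuous.continuousOn))]
  refine integral_congr_ae ?_
  filter_upwards [coe_branchDer h, ae_cell fun x hx => prim_branchDer h (Ioo_subset_Icc_self hx)]
    with x h2 h3
  rw [h2, h3]
  ring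

lemma isCriticalPoint_branch : IsCriticalPoint (-8) lam (branch lam) :=
  (isCriticalPoint_scalar h.ne' (isScalarSol_branchDer h).1).2 (isScalarSol_branchDer h)

lemma solvesScalarBVP_branch : SolvesScalarBVP lam (branch lam).2.1 := by
  have hp := isProfile h
  refine ⟨fun x => -2 * profile lam x,
    fun x => -2 * (√2 * lam * √(slopeSq (firstIntegral lam) (profile lam x))),
    fun x => -2 * ((√2 * lam) ^ 2 * (-(2 * profile lam x) * (1 - profile lam x ^ 2))),
    ?_, fun x hx => ((hp.deriv x hx).const_mul (-2)).hasDerivWithinAt,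
    fun x hx => ((hp.deriv_two hx).const_mul (-2)).hasDerivWithinAt, fun x _ => ?_, ?_, ?_⟩
  · filter_upwards [val_mkH 2 (branchDer lam),
      ae_cell fun x hx => prim_branchDer h (Ioo_subset_Icc_self hx)] with x h1 h2
    rw [branch, cfg, h1, h2]
  · rw [mul_pow, Real.sq_sqrt (by norm_num)]
    field_simp
    ring
  · simp only [hp.left]; norm_num
  · simp only [hp.right]; norm_num

/-- The symmetry-breaking eigenvalue along the branch, through the first integral. -/
lemma mu_branch : mu (-8) lam (branch lam) = 4 * ampEig (firstIntegral lam) - 4 := by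
  rw [branch, mu_scalar, ← (isProfile h).lowest_eq _ fun f => rfl]
  congr 1
  ext g
  refine integral_congr_ae (ae_cell fun x hx => ?_)
  simp only
  rw [prim_branchDer h (Ioo_subset_Icc_self hx), mul_pow √2, Real.sq_sqrt (by norm_num)]
  field_simp
  ring

end

lemma val_branch (lam : ℝ) : val (branch lam).1 =ᵐ[cell] fun _ => (2 / 3 : ℝ) := by
  filter_upwards [val_mkH (2 / 3) 0] with x hx
  rw [branch, cfg, hx, prim_zero_apply, add_zero]

lemma isEE_branch (lam : ℝ) : IsEE (branch lam) := map_zero primH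

/-! ### Monotonicity of the symmetry-breaking eigenvalue -/

/-- The first symmetry-breaking eigenvalue along the branch. -/
def muBranch (lam : ℝ) : ℝ := mu (-8) lam (branch lam)

lemma exists_hasDerivAt_mu {lam : ℝ} (h : 0 < lam) : ∃ m < 0, HasDerivAt muBranch m lam := by
  obtain ⟨d, hd, h1⟩ := exists_hasDerivAt_ampEig (firstIntegral_pos h)
  obtain ⟨d', hd', h2⟩ := exists_hasDerivAt_firstIntegral h
  refine ⟨4 * (d * d'), by nlinarith, ?_⟩
  refine ((((h1.comp lam h2).const_mul 4).sub_const 4)).congr_of_eventuallyEq ?_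
  filter_upwards [lt_mem_nhds h] with l hl
  exact mu_branch hl

lemma mu_strictAnti : StrictAntiOn muBranch (Ioi 0) := by
  intro a ha b hb hab
  have h1 := firstIntegral_strictAnti ha hb hab
  have h2 := ampEig_mono (firstIntegral_pos hb) h1
  rw [muBranch, muBranch, mu_branch ha, mu_branch hb]
  linarith

/-- A lower bound from the Poincaré inequality, positive for small parameters. -/
lemma le_mu {lam : ℝ} (h : 0 < lam) : 1 / (2 * lam ^ 2) - 8 ≤ muBranch lam := by
  rw [muBranch, branch, mu_scalar]
  refine le_lowest fun g hg => ?_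
  have h1 : ∫ x, (2 / lam ^ 2 * g x ^ 2 + -8 * prim g x ^ 2) ∂cell
      = 2 / lam ^ 2 * ‖g‖ ^ 2 + -8 * ‖primL g‖ ^ 2 := by
    rw [integral_add ((integrable_sq g).const_mul _) ((integrable_prim_sq g).const_mul _),
      integral_const_mul, integral_const_mul, norm_sq_eq, norm_primL_sq]
  have h2 : 2 / lam ^ 2 * ‖g‖ ^ 2 + -8 * ‖primL g‖ ^ 2 ≤ ∫ x, (2 / lam ^ 2 * g x ^ 2
      + 2 * ((2 + prim (branchDer lam) x) ^ 2 - 4) * prim g x ^ 2) ∂cell := by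
    rw [← h1]
    refine integral_mono (((integrable_sq g).const_mul _).add ((integrable_prim_sq g).const_mul _))
      (((integrable_sq g).const_mul _).add (integrable_cell (by fun_prop))) fun x => ?_
    simp only
    have := mul_nonneg (sq_nonneg (2 + prim (branchDer lam) x)) (sq_nonneg (prim g x))
    nlinarith
  have h3 := norm_primL_sq_le g
  have h4 : 1 / (2 * lam ^ 2) * ‖primL g‖ ^ 2 ≤ 2 / lam ^ 2 * ‖g‖ ^ 2 := by
    calc 1 / (2 * lam ^ 2) * ‖primL g‖ ^ 2 ≤ 1 / (2 * lam ^ 2) * (4 * ‖g‖ ^ 2) := by gcongr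
      _ = 2 / lam ^ 2 * ‖g‖ ^ 2 := by field_simp; norm_num
  linarith

lemma exists_mu_neg : ∃ lam, 0 < lam ∧ muBranch lam < 0 := by
  have hc : (0 : ℝ) < 1 / 10 := by norm_num
  have h : 0 < halfTime (1 / 10) / √2 := div_pos (halfTime_pos hc) (by positivity)
  refine ⟨_, h, ?_⟩
  rw [muBranch, mu_branch h, firstIntegral_halfTime hc]
  linarith [ampEig_lt_one]

lemma tendsto_mu : ∃ m < 0, Tendsto muBranch atTop (𝓝 m) := by
  obtain ⟨l₀, h₀, hneg⟩ := exists_mu_neg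
  -- freezing the argument below `l₀` makes the function antitone on the whole line
  set F : ℝ → ℝ := fun l => muBranch (max l l₀) with hF
  have hanti : Antitone F := fun a b hab => mu_strictAnti.antitoneOn
    (h₀.trans_le (le_max_right a l₀)) (h₀.trans_le (le_max_right b l₀)) (max_le_max_right l₀ hab)
  have hbdd : BddBelow (range F) := by
    refine ⟨-8, ?_⟩
    rintro _ ⟨l, rfl⟩
    have hpos : 0 < max l l₀ := h₀.trans_le (le_max_right _ _)
    have := le_mu hpos
    have : 0 < 1 / (2 * max l l₀ ^ 2) := by positivity
    simp only [hF]
    linarith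
  have hlim := tendsto_atTop_ciInf hanti hbdd
  refine ⟨⨅ l, F l, (ciInf_le hbdd l₀).trans_lt ?_, hlim.congr' ?_⟩
  · simpa [hF] using hneg
  · filter_upwards [eventually_ge_atTop l₀] with l hl
    simp only [hF, max_eq_left hl]

lemma exists_mu_zero : ∃ l, 0 < l ∧ muBranch l = 0 := by
  obtain ⟨l₀, h₀, hneg⟩ := exists_mu_neg
  have h1 : 0 < muBranch (1 / 8) := by
    have := le_mu (lam := 1 / 8) (by norm_num)
    norm_num at this
    linarith
  have hle : 1 / 8 ≤ l₀ := by
    by_contra! hlt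
    exact absurd (mu_strictAnti h₀ (by norm_num : (1 / 8 : ℝ) ∈ Ioi 0) hlt) (by linarith)
  have hcont : ContinuousOn muBranch (Icc (1 / 8) l₀) := fun l hl => by
    obtain ⟨m, -, hm⟩ := exists_hasDerivAt_mu (lt_of_lt_of_le (by norm_num) hl.1)
    exact hm.continuousAt.continuousWithinAt
  obtain ⟨l, hl, h⟩ := intermediate_value_Icc' hle hcont ⟨hneg.le, h1.le⟩
  exact ⟨l, lt_of_lt_of_le (by norm_num) hl.1, h⟩

/-! ### Stability of the branch under symmetry-preserving perturbations -/

/-- The derivative `u'` is a positive solution of the linearized equation. The Riccati inequality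
for `-u''/u' + e ^ (K x - K)`, with `K` large, therefore has a gap. -/
lemma IsProfile.exists_gap {k c : ℝ} {u ξ : ℝ → ℝ} (hp : IsProfile k c u ξ) :
    ∃ δ > 0, ∀ f ∈ Y, δ * ∫ x, prim f x ^ 2 ∂cell
      ≤ ∫ x, (f x ^ 2 + 2 * k ^ 2 * (3 * u x ^ 2 - 1) * prim f x ^ 2) ∂cell := by
  have hk := hp.k_pos
  have hw : ∀ x, 0 < k * √(slopeSq c (u x)) := fun x =>
    mul_pos hk (Real.sqrt_pos.2 (slopeSq_pos hp.c_pos _))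
  set r : ℝ → ℝ := fun x => 2 * k ^ 2 * (u x * (1 - u x ^ 2)) / (k * √(slopeSq c (u x))) with hr
  have hrc : ContinuousOn r (Icc (-1) 1) :=
    (continuousOn_const.mul (hp.continuousOn.mul
      (continuousOn_const.sub (hp.continuousOn.pow 2)))).div hp.deriv_continuousOn
        fun x _ => (hw x).ne'
  have hrd : ∀ x ∈ Icc (-1 : ℝ) 1, HasDerivAt r (2 * k ^ 2 * (1 - 3 * u x ^ 2) + r x ^ 2) x := by
    intro x hx
    have hu := hp.deriv x hx
    refine ((((hu.mul ((hu.pow 2).const_sub 1)).const_mul (2 * k ^ 2))).div (hp.deriv_two hx)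
      (hw x).ne').congr_deriv ?_
    have := (hw x).ne'
    simp only [hr, Pi.mul_apply, Pi.pow_apply]
    generalize k * √(slopeSq c (u x)) = w at *
    field_simp
    norm_num
    left
    ring
  obtain ⟨R, hR, hRb⟩ := exists_bound_cell hrc
  set K : ℝ := 2 * R + 2 with hK
  set ρ : ℝ → ℝ := fun x => r x + Real.exp (K * x - K) with hρ
  set ρ' : ℝ → ℝ := fun x => 2 * k ^ 2 * (1 - 3 * u x ^ 2) + r x ^ 2 + K * Real.exp (K * x - K)
    with hρ'
  have hρC : IsC1 ρ ρ' := by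
    refine ⟨hrc.add (by fun_prop), ((continuousOn_const.mul (continuousOn_const.sub
      (continuousOn_const.mul (hp.continuousOn.pow 2)))).add (hrc.pow 2)).add (by fun_prop),
      fun x hx => ?_⟩
    refine (hrd x (Ioo_subset_Icc_self hx)).add ?_
    have : HasDerivAt (fun x => K * x - K) K x := by
      simpa using ((hasDerivAt_id x).const_mul K).sub_const K
    exact this.exp.congr_deriv (mul_comm _ _)
  refine ⟨Real.exp (-(2 * K)), Real.exp_pos _, fun f hf => ?_⟩
  have hV : ContinuousOn (fun x => 2 * k ^ 2 * (3 * u x ^ 2 - 1)) (Icc (-1) 1) :=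
    continuousOn_const.mul ((continuousOn_const.mul (hp.continuousOn.pow 2)).sub continuousOn_const)
  have i1 := integrable_weight_prim hV f f
  have hric := riccati hρC hf
  have hle : ∫ x, (Real.exp (-(2 * K)) * prim f x ^ 2
      - 2 * k ^ 2 * (3 * u x ^ 2 - 1) * prim f x ^ 2) ∂cell
      ≤ ∫ x, (ρ' x - ρ x ^ 2) * prim f x ^ 2 ∂cell := by
    refine integral_mono_ae (integrable_cell ?_) (integrable_cell ?_) (ae_cell fun x hx => ?_)
    · exact (continuousOn_const.mul (by fun_prop)).sub (hV.mul (by fun_prop))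
    · exact (hρC.cont'.sub (hρC.cont.pow 2)).mul (by fun_prop)
    · have hx' := Ioo_subset_Icc_self hx
      have hb := abs_le.1 (hRb x hx')
      have e0 := Real.exp_pos (K * x - K)
      have hK0 : 0 < K := by linarith
      have e1 : Real.exp (K * x - K) ≤ 1 := by
        rw [Real.exp_le_one_iff]; nlinarith [hx.2]
      have e2 : Real.exp (-(2 * K)) ≤ Real.exp (K * x - K) := by
        rw [Real.exp_le_exp]; nlinarith [hx.1]
      simp only [hρ, hρ']
      rw [← sub_mul]
      refine mul_le_mul_of_nonneg_right ?_ (sq_nonneg _)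
      -- what remains after cancellation is `e (K - 2 r - e) ≥ e`
      have : Real.exp (K * x - K) * 1
          ≤ Real.exp (K * x - K) * (K - 2 * r x - Real.exp (K * x - K)) :=
        mul_le_mul_of_nonneg_left (by linarith) e0.le
      nlinarith
  have i2 : Integrable (fun x => 2 * k ^ 2 * (3 * u x ^ 2 - 1) * prim f x ^ 2) cell :=
    integrable_cell (hV.mul (by fun_prop))
  rw [integral_sub ((integrable_prim_sq f).const_mul _) i2, integral_const_mul] at hle
  rw [integral_add (integrable_sq f) i2]
  linarith

/-- The coefficient of the linearization of the scalar equation along the branch. -/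
def linPot (lam x : ℝ) : ℝ := lam ^ 2 * (3 * (2 + prim (branchDer lam) x) ^ 2 - 4)

lemma continuous_linPot (lam : ℝ) : Continuous (linPot lam) := by unfold linPot; fun_prop

/-- The form `∫ f g + lam² (3 y² - 4) (prim f) (prim g)` of the linearized scalar equation. -/
def linForm (lam : ℝ) : L2 →L[ℝ] L2 →L[ℝ] ℝ :=
  form (fun _ => 1) (linPot lam) continuousOn_const (continuous_linPot lam).continuousOn

lemma linForm_self (lam : ℝ) (f : L2) :
    linForm lam f f = ∫ x, (f x ^ 2 + linPot lam x * prim f x ^ 2) ∂cell := by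
  rw [linForm, form_apply_self]
  simp only [one_mul]

lemma exists_linForm_gap {lam : ℝ} (h : 0 < lam) :
    ∃ δ > 0, ∀ f ∈ Y, δ * ‖primL f‖ ^ 2 ≤ linForm lam f f := by
  obtain ⟨δ, hδ, hg⟩ := (isProfile h).exists_gap
  refine ⟨δ, hδ, fun f hf => ?_⟩
  rw [norm_primL_sq, linForm_self]
  refine (hg f hf).trans_eq (integral_congr_ae (ae_cell fun x hx => ?_))
  simp only [linPot]
  rw [prim_branchDer h (Ioo_subset_Icc_self hx), mul_pow √2, Real.sq_sqrt (by norm_num)]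
  ring

/-- The linearized form is coercive for the full norm. -/
lemma exists_linForm_coercive {lam : ℝ} (h : 0 < lam) :
    ∃ α > 0, ∀ f ∈ Y, α * ‖f‖ ^ 2 ≤ linForm lam f f := by
  obtain ⟨δ, hδ, hg⟩ := exists_linForm_gap h
  have hM : ∀ f : L2, ‖f‖ ^ 2 - 4 * lam ^ 2 * ‖primL f‖ ^ 2 ≤ linForm lam f f := by
    intro f
    rw [linForm_self, norm_primL_sq, norm_sq_eq, ← integral_const_mul,
      ← integral_sub (integrable_sq f) ((integrable_prim_sq f).const_mul _)]
    refine integral_mono ((integrable_sq f).sub ((integrable_prim_sq f).const_mul _))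
      ((integrable_sq f).add (integrable_cell (((continuous_linPot lam).mul
        ((prim f).continuous.pow 2)).continuousOn))) fun x => ?_
    simp only [linPot]
    have := mul_nonneg (mul_nonneg (sq_nonneg lam) (sq_nonneg (2 + prim (branchDer lam) x)))
      (sq_nonneg (prim f x))
    nlinarith
  have hpos : 0 < δ + 4 * lam ^ 2 := by positivity
  refine ⟨δ / (δ + 4 * lam ^ 2), by positivity, fun f hf => ?_⟩
  have h1 := hg f hf
  have h2 := hM f
  rw [div_mul_eq_mul_div, div_le_iff₀ hpos]
  have h3 := mul_le_mul_of_nonneg_left h1 (by positivity : 0 ≤ 4 * lam ^ 2)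
  have h4 := mul_le_mul_of_nonneg_left h2 hδ.le
  linarith

/-- The component `h₁` only contributes positive terms, and the component `h₂` sees the linearized
scalar equation. -/
lemma nu_branch_pos {lam : ℝ} (h : 0 < lam) : 0 < nu (-8) lam (branch lam) := by
  obtain ⟨δ, hδ, hg⟩ := exists_linForm_gap h
  set m : ℝ := min 24 (2 / lam ^ 2 * δ) with hm
  have hm0 : 0 < m := lt_min (by norm_num) (by positivity)
  refine hm0.trans_le (le_csInf ?_ ?_)
  · obtain ⟨f, hf, h0⟩ := exists_mem_Y_ne_zero
    exact ⟨_, primH f, primH f, isH10_iff.2 ⟨f, hf, rfl⟩, isH10_iff.2 ⟨f, hf, rfl⟩,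
      fun e => h0 (primH_eq_zero.1 (congrArg Prod.fst e)), rfl⟩
  · rintro r ⟨h₁, h₂, k1, k2, hne, rfl⟩
    obtain ⟨g₁, hg₁, rfl⟩ := isH10_iff.1 k1
    obtain ⟨g₂, hg₂, rfl⟩ := isH10_iff.1 k2
    have hne' : g₁ ≠ 0 ∨ g₂ ≠ 0 := by
      by_contra! hcon
      exact hne (by rw [hcon.1, hcon.2, map_zero, Prod.mk_zero_zero])
    have hden : ∫ x, (val (primH g₁) x ^ 2 + val (primH g₂) x ^ 2) ∂cell
        = ‖primL g₁‖ ^ 2 + ‖primL g₂‖ ^ 2 := by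
      rw [norm_primL_sq, norm_primL_sq,
        ← integral_add (integrable_prim_sq g₁) (integrable_prim_sq g₂)]
      refine integral_congr_ae ?_
      filter_upwards [val_primH g₁, val_primH g₂] with x e1 e2
      rw [e1, e2]
    have hnum : 24 * ‖primL g₁‖ ^ 2 + 2 / lam ^ 2 * linForm lam g₂ g₂
        ≤ secondVariation (-8) lam (branch lam) (primH g₁, primH g₂, 0) := by
      have hsv := secondVariation_scalar lam (branchDer lam) g₁ g₂ 0
      rw [map_zero] at hsv
      rw [branch, hsv, linForm_self, norm_primL_sq, ← integral_const_mul, ← integral_const_mul]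
      have i1 : Integrable (fun x => g₂ x ^ 2 + linPot lam x * prim g₂ x ^ 2) cell :=
        (integrable_sq g₂).add (integrable_cell (((continuous_linPot lam).mul
          ((prim g₂).continuous.pow 2)).continuousOn))
      rw [← integral_add ((integrable_prim_sq g₁).const_mul _) (i1.const_mul _)]
      refine integral_mono_ae (((integrable_prim_sq g₁).const_mul _).add (i1.const_mul _))
        (((((integrable_sq g₁).const_mul _).add (integrable_cell (by fun_prop))).add
          (((integrable_sq g₂).const_mul _).add (integrable_cell (by fun_prop)))).add
            (((integrable_sq 0).const_mul _).add (integrable_cell (by fun_prop)))) ?_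
      filter_upwards [Lp.coeFn_zero ℝ 2 cell] with x hx
      simp only [hx, Pi.zero_apply, prim_zero_apply, linPot]
      have e1 : 0 ≤ 6 / lam ^ 2 * g₁ x ^ 2 := by positivity
      have e2 : 0 ≤ 6 * (2 + prim (branchDer lam) x) ^ 2 * prim g₁ x ^ 2 := by positivity
      have e3 : 2 / lam ^ 2 * (g₂ x ^ 2
          + lam ^ 2 * (3 * (2 + prim (branchDer lam) x) ^ 2 - 4) * prim g₂ x ^ 2)
          = 2 / lam ^ 2 * g₂ x ^ 2
            + (6 * (2 + prim (branchDer lam) x) ^ 2 - 8) * prim g₂ x ^ 2 := by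
        field_simp
        ring
      rw [e3]
      linarith
    have hpos : 0 < ‖primL g₁‖ ^ 2 + ‖primL g₂‖ ^ 2 := by
      rcases hne' with h0 | h0
      · exact add_pos_of_pos_of_nonneg (norm_primL_sq_pos h0) (sq_nonneg _)
      · exact add_pos_of_nonneg_of_pos (sq_nonneg _) (norm_primL_sq_pos h0)
    rw [hden, le_div_iff₀ hpos]
    refine le_trans ?_ hnum
    have e1 : m * ‖primL g₁‖ ^ 2 ≤ 24 * ‖primL g₁‖ ^ 2 := by gcongr; exact min_le_left _ _
    have e2 : m * ‖primL g₂‖ ^ 2 ≤ 2 / lam ^ 2 * δ * ‖primL g₂‖ ^ 2 := by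
      gcongr; exact min_le_right _ _
    have e3 := mul_le_mul_of_nonneg_left (hg g₂ hg₂) (by positivity : 0 ≤ 2 / lam ^ 2)
    linarith

/-! ### Uniqueness of critical points -/

/-- The difference of the bulk gradients at `(2/3 + d, y + e, g)` and `(2/3, y, 0)`, tested with
the difference of the arguments. -/
lemma dBulk_diff (y d e g : ℝ) : dBulk (-8) (2 / 3 + d) (y + e) g d e g
      - dBulk (-8) (2 / 3) y 0 d e g
    = 6 * d ^ 2 * (4 + 8 * d + 3 * d ^ 2 + (y + e) ^ 2 + g ^ 2)
      + 2 * e ^ 2 * ((y + e) ^ 2 + (y + e) * y + y ^ 2 - 4)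
      + 2 * e * (y + e) * (g ^ 2 + 3 * d ^ 2)
      + 2 * g ^ 2 * ((y + e) ^ 2 + g ^ 2 - 4 + 3 * d ^ 2) := by
  simp only [dBulk]
  ring

/-- The bulk gradient is one-sided Lipschitz: the negative part of the quartic difference is quadratic,
since the mixed terms are absorbed by completing squares. -/
lemma le_dBulk_diff (y d e g : ℝ) : -14 * (3 * d ^ 2 + e ^ 2 + g ^ 2)
    ≤ dBulk (-8) (2 / 3 + d) (y + e) g d e g - dBulk (-8) (2 / 3) y 0 d e g := by
  rw [dBulk_diff]
  generalize hq : y + e = q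
  have h1 : 0 ≤ (e * q / 2 + 2 * g ^ 2) ^ 2 := sq_nonneg _
  have h2 : 0 ≤ (e * q + 3 * d ^ 2) ^ 2 := sq_nonneg _
  have h3 : 0 ≤ (e * (q / 2 + y)) ^ 2 := sq_nonneg _
  have h4 : 0 ≤ (d * (3 * d + 8)) ^ 2 := sq_nonneg _
  have h5 : 0 ≤ (d * q) ^ 2 := sq_nonneg _
  have h6 : 0 ≤ (g * q) ^ 2 := sq_nonneg _
  have h7 : 0 ≤ (d * g) ^ 2 := sq_nonneg _
  nlinarith [sq_nonneg d, sq_nonneg e, sq_nonneg g, sq_nonneg (e * q), sq_nonneg (g ^ 2)]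

/-- The weak equations of a critical point and of the branch, tested with their difference. -/
lemma weakForm_diff {lam : ℝ} (f₁ f₂ f₃ b : L2) :
    weakForm lam f₁ f₂ f₃ f₁ (f₂ - b) f₃ - weakForm lam 0 b 0 f₁ (f₂ - b) f₃
      = 2 / lam ^ 2 * (3 * ‖f₁‖ ^ 2 + ‖f₂ - b‖ ^ 2 + ‖f₃‖ ^ 2)
        + ∫ x, (dBulk (-8) (2 / 3 + prim f₁ x) (2 + prim b x + prim (f₂ - b) x) (prim f₃ x)
            (prim f₁ x) (prim (f₂ - b) x) (prim f₃ x)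
          - dBulk (-8) (2 / 3) (2 + prim b x) 0
            (prim f₁ x) (prim (f₂ - b) x) (prim f₃ x)) ∂cell := by
  have c1 : ∀ f g h : L2, Integrable (fun x => dBulk (-8) (2 / 3 + prim f x) (2 + prim g x)
      (prim h x) (prim f₁ x) (prim (f₂ - b) x) (prim f₃ x)) cell := fun f g h =>
    integrable_cell (Continuous.continuousOn (by unfold dBulk; fun_prop))
  have c2 : Integrable (fun x => dBulk (-8) (2 / 3 + prim f₁ x) (2 + prim b x + prim (f₂ - b) x)
      (prim f₃ x) (prim f₁ x) (prim (f₂ - b) x) (prim f₃ x)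
      - dBulk (-8) (2 / 3) (2 + prim b x) 0 (prim f₁ x) (prim (f₂ - b) x) (prim f₃ x)) cell :=
    integrable_cell (Continuous.continuousOn (by unfold dBulk; fun_prop))
  have i1 : ∀ f g h : L2, Integrable (fun x => 2 * ((3 * (f x * f₁ x) + g x * (f₂ - b) x
      + h x * f₃ x) / lam ^ 2) + dBulk (-8) (2 / 3 + prim f x) (2 + prim g x)
      (prim h x) (prim f₁ x) (prim (f₂ - b) x) (prim f₃ x)) cell := fun f g h =>
    ((integrable_dirichlet lam f g h f₁ (f₂ - b) f₃).const_mul 2).add (c1 f g h)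
  have j1 : Integrable (fun x => 3 * f₁ x ^ 2 + (f₂ - b) x ^ 2) cell :=
    ((integrable_sq f₁).const_mul 3).add (integrable_sq (f₂ - b))
  have j2 : Integrable (fun x => 3 * f₁ x ^ 2 + (f₂ - b) x ^ 2 + f₃ x ^ 2) cell :=
    j1.add (integrable_sq f₃)
  rw [weakForm, weakForm, ← integral_sub (i1 _ _ _) (i1 _ _ _), norm_sq_eq, norm_sq_eq, norm_sq_eq,
    ← integral_const_mul, ← integral_add ((integrable_sq f₁).const_mul 3) (integrable_sq (f₂ - b)),
    ← integral_add j1 (integrable_sq f₃), ← integral_const_mul,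
    ← integral_add (j2.const_mul _) c2]
  refine integral_congr_ae ?_
  filter_upwards [Lp.coeFn_zero ℝ 2 cell, Lp.coeFn_sub f₂ b] with x h1 h2
  have h3 : 2 + prim b x + prim (f₂ - b) x = 2 + prim f₂ x := by
    rw [map_sub, BoundedContinuousFunction.sub_apply]; ring
  rw [h3]
  simp only [h1, h2, Pi.zero_apply, Pi.sub_apply, prim_zero_apply, add_zero]
  ring

/-- For small parameters the Dirichlet part of the energy dominates, and the branch consists of
the only critical points. -/
lemma eq_branch_of_small {lam : ℝ} (h0 : 0 < lam) (h1 : lam < 1 / 6) {Q : Config}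
    (hQ : IsCriticalPoint (-8) lam Q) : Q = branch lam := by
  obtain ⟨f₁, f₂, f₃, k₁, k₂, k₃, rfl, hw⟩ := hQ.exists_cfg
  have hb := isScalarSol_branchDer h0
  set b := branchDer lam
  have m1 : f₁ ∈ Y := mem_Y.2 k₁
  have m2 : f₂ - b ∈ Y := by
    rw [mem_Y, map_sub, BoundedContinuousFunction.sub_apply, k₂, hb.1, sub_self]
  have m3 : f₃ ∈ Y := mem_Y.2 k₃
  have hd := weakForm_diff (lam := lam) f₁ f₂ f₃ b
  rw [hw _ m1 _ m2 _ m3, weakForm_scalar h0.ne', hb.2 _ m2, mul_zero, sub_zero] at hd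
  have j1 : Integrable (fun x => 3 * prim f₁ x ^ 2 + prim (f₂ - b) x ^ 2) cell :=
    ((integrable_prim_sq f₁).const_mul 3).add (integrable_prim_sq (f₂ - b))
  have hle : -14 * (3 * ‖primL f₁‖ ^ 2 + ‖primL (f₂ - b)‖ ^ 2 + ‖primL f₃‖ ^ 2)
      ≤ ∫ x, (dBulk (-8) (2 / 3 + prim f₁ x) (2 + prim b x + prim (f₂ - b) x) (prim f₃ x)
            (prim f₁ x) (prim (f₂ - b) x) (prim f₃ x)
          - dBulk (-8) (2 / 3) (2 + prim b x) 0
            (prim f₁ x) (prim (f₂ - b) x) (prim f₃ x)) ∂cell := by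
    rw [norm_primL_sq, norm_primL_sq, norm_primL_sq, ← integral_const_mul,
      ← integral_add ((integrable_prim_sq f₁).const_mul 3) (integrable_prim_sq (f₂ - b)),
      ← integral_add j1 (integrable_prim_sq f₃), ← integral_const_mul]
    exact integral_mono ((j1.add (integrable_prim_sq f₃)).const_mul _)
      (integrable_cell (Continuous.continuousOn (by unfold dBulk; fun_prop)))
      fun x => le_dBulk_diff _ _ _ _
  have p1 := norm_primL_sq_le f₁
  have p2 := norm_primL_sq_le (f₂ - b)
  have p3 := norm_primL_sq_le f₃
  -- by the Poincaré inequality the bulk part is at least `-56` times the Dirichlet part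
  have hl : 72 ≤ 2 / lam ^ 2 := by
    rw [le_div_iff₀ (by positivity)]
    nlinarith
  have hA : 72 * (3 * ‖f₁‖ ^ 2 + ‖f₂ - b‖ ^ 2 + ‖f₃‖ ^ 2)
      ≤ 2 / lam ^ 2 * (3 * ‖f₁‖ ^ 2 + ‖f₂ - b‖ ^ 2 + ‖f₃‖ ^ 2) := by gcongr
  have s1 := sq_nonneg ‖f₁‖
  have s2 := sq_nonneg ‖f₂ - b‖
  have s3 := sq_nonneg ‖f₃‖
  have z1 : ‖f₁‖ ^ 2 = 0 := by linarith
  have z2 : ‖f₂ - b‖ ^ 2 = 0 := by linarith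
  have z3 : ‖f₃‖ ^ 2 = 0 := by linarith
  rw [sq_eq_zero_iff, norm_eq_zero] at z1 z2 z3
  rw [branch, z1, z3, sub_eq_zero.1 z2]

/-- Near a stable solution the branch consists of the only eigenvalue exchange solutions. The
coefficient of `(prim (f₂ - b))²` is compared with the linearization at the parameter `lam₀`. -/
lemma eq_branch_of_close {lam₀ δ : ℝ}
    (hg : ∀ f ∈ Y, δ * ‖primL f‖ ^ 2 ≤ linForm lam₀ f f) {lam : ℝ} (h0 : 0 < lam)
    {f₁ f₂ : L2} (hQ : IsCriticalPoint (-8) lam (cfg f₁ f₂ 0)) (k₁ : prim f₁ 1 = 0)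
    (k₂ : prim f₂ 1 = -4) {κ : ℝ} (hκ : κ < δ)
    (hd : ∀ x ∈ Icc (-1 : ℝ) 1, |prim f₁ x| ≤ 1 / 4)
    (he : ∀ x ∈ Icc (-1 : ℝ) 1, |prim f₂ x - prim (branchDer lam) x| ≤ 1)
    (hc : ∀ x ∈ Icc (-1 : ℝ) 1, linPot lam₀ x - κ ≤ lam ^ 2 * ((2 + prim f₂ x) ^ 2
      + (2 + prim f₂ x) * (2 + prim (branchDer lam) x) + (2 + prim (branchDer lam) x) ^ 2 - 4)) :
    cfg f₁ f₂ 0 = branch lam := by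
  have hw := (isCriticalPoint_cfg_iff k₁ k₂ (prim_zero_apply 1)).1 hQ
  have hb := isScalarSol_branchDer h0
  rw [branch]
  set b := branchDer lam
  have m1 : f₁ ∈ Y := mem_Y.2 k₁
  have m2 : f₂ - b ∈ Y := by
    rw [mem_Y, map_sub, BoundedContinuousFunction.sub_apply, k₂, hb.1, sub_self]
  have hd' := weakForm_diff (lam := lam) f₁ f₂ 0 b
  rw [hw _ m1 _ m2 _ Y.zero_mem, weakForm_scalar h0.ne', hb.2 _ m2, mul_zero, sub_zero,
    norm_zero] at hd'
  have i1 : Integrable (fun x => linPot lam₀ x * prim (f₂ - b) x ^ 2) cell :=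
    integrable_cell (((continuous_linPot lam₀).mul
      ((prim (f₂ - b)).continuous.pow 2)).continuousOn)
  have hle : 2 / lam ^ 2 * ((∫ x, linPot lam₀ x * prim (f₂ - b) x ^ 2 ∂cell)
        - κ * ‖primL (f₂ - b)‖ ^ 2)
      ≤ ∫ x, (dBulk (-8) (2 / 3 + prim f₁ x) (2 + prim b x + prim (f₂ - b) x) (prim 0 x)
            (prim f₁ x) (prim (f₂ - b) x) (prim 0 x)
          - dBulk (-8) (2 / 3) (2 + prim b x) 0
            (prim f₁ x) (prim (f₂ - b) x) (prim 0 x)) ∂cell := by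
    rw [norm_primL_sq, ← integral_const_mul,
      ← integral_sub i1 ((integrable_prim_sq (f₂ - b)).const_mul κ), ← integral_const_mul]
    refine integral_mono_ae ((i1.sub ((integrable_prim_sq (f₂ - b)).const_mul κ)).const_mul _)
      (integrable_cell (Continuous.continuousOn (by unfold dBulk; fun_prop)))
      (ae_cell fun x hx => ?_)
    have hx' := Ioo_subset_Icc_self hx
    have e1 : prim (f₂ - b) x = prim f₂ x - prim b x := by
      rw [map_sub, BoundedContinuousFunction.sub_apply]
    have e2 := hc x hx'
    have e3 := abs_le.1 (hd x hx')
    have e4 := abs_le.1 (he x hx')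
    simp only [prim_zero_apply]
    rw [dBulk_diff, e1, ← sub_mul]
    rw [show 2 + prim b x + (prim f₂ x - prim b x) = 2 + prim f₂ x by ring]
    have e5 : 2 / lam ^ 2 * ((linPot lam₀ x - κ) * (prim f₂ x - prim b x) ^ 2)
        ≤ 2 / lam ^ 2 * (lam ^ 2 * ((2 + prim f₂ x) ^ 2 + (2 + prim f₂ x) * (2 + prim b x)
          + (2 + prim b x) ^ 2 - 4) * (prim f₂ x - prim b x) ^ 2) := by gcongr
    have e6 : 2 / lam ^ 2 * (lam ^ 2 * ((2 + prim f₂ x) ^ 2 + (2 + prim f₂ x) * (2 + prim b x)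
          + (2 + prim b x) ^ 2 - 4) * (prim f₂ x - prim b x) ^ 2)
        = 2 * (prim f₂ x - prim b x) ^ 2 * ((2 + prim f₂ x) ^ 2
          + (2 + prim f₂ x) * (2 + prim b x) + (2 + prim b x) ^ 2 - 4) := by
      field_simp
    rw [e6] at e5
    refine e5.trans ?_
    generalize prim f₂ x - prim b x = e at *
    generalize 2 + prim f₂ x = q at *
    generalize prim f₁ x = d at *
    have e7 : 0 ≤ 4 + 8 * d + 3 * d ^ 2 + q ^ 2 + e * q := by
      nlinarith [sq_nonneg (q + e / 2), sq_nonneg d]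
    have e8 : 0 ≤ 6 * d ^ 2 * (4 + 8 * d + 3 * d ^ 2 + q ^ 2 + e * q) := by positivity
    linarith
  have hg' := hg _ m2
  rw [linForm_self, integral_add (integrable_sq _) i1, ← norm_sq_eq] at hg'
  have hl : 0 < 2 / lam ^ 2 := by positivity
  have s1 := sq_nonneg ‖f₁‖
  have s2 := sq_nonneg ‖primL (f₂ - b)‖
  have hT : 0 ≥ 2 / lam ^ 2 * (3 * ‖f₁‖ ^ 2 + (δ - κ) * ‖primL (f₂ - b)‖ ^ 2) := by
    have := mul_le_mul_of_nonneg_left hg' hl.le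
    nlinarith
  have hT' := nonpos_of_mul_nonpos_right hT hl
  have s3 : 0 ≤ (δ - κ) * ‖primL (f₂ - b)‖ ^ 2 := mul_nonneg (sub_nonneg.2 hκ.le) s2
  have z1 : ‖f₁‖ ^ 2 = 0 := by linarith
  have z2 : f₂ - b = 0 := by
    by_contra hne
    have := mul_pos (sub_pos.2 hκ) (norm_primL_sq_pos hne)
    linarith
  rw [sq_eq_zero_iff, norm_eq_zero] at z1
  rw [z1, sub_eq_zero.1 z2]

/-! ### Smoothness of the branch -/

/-- The nonlinearity `y ↦ (y² - 4) y` at `y = 2 + p`, as a map of bounded continuous functions. -/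
def cubic (p : BoundedContinuousFunction ℝ ℝ) : BoundedContinuousFunction ℝ ℝ :=
  (BoundedContinuousFunction.const ℝ 2 + p) ^ 3
    - (4 : ℝ) • (BoundedContinuousFunction.const ℝ 2 + p)

lemma cubic_apply (p : BoundedContinuousFunction ℝ ℝ) (x : ℝ) :
    cubic p x = ((2 + p x) ^ 2 - 4) * (2 + p x) := by
  simp only [cubic, BoundedContinuousFunction.sub_apply, BoundedContinuousFunction.pow_apply,
    BoundedContinuousFunction.add_apply, BoundedContinuousFunction.const_apply,
    BoundedContinuousFunction.smul_apply, smul_eq_mul]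
  ring

lemma contDiff_cubic : ContDiff ℝ ∞ cubic := by unfold cubic; fun_prop

lemma hasDerivAt_cubic (p k : BoundedContinuousFunction ℝ ℝ) :
    HasDerivAt (fun t : ℝ => cubic (p + t • k))
      (3 * (BoundedContinuousFunction.const ℝ 2 + p) ^ 2 * k - (4 : ℝ) • k) 0 := by
  have h1 : HasDerivAt (fun t : ℝ => BoundedContinuousFunction.const ℝ 2 + (p + t • k)) k 0 := by
    simpa using (((hasDerivAt_id (0 : ℝ)).smul_const k).const_add p).const_add
      (BoundedContinuousFunction.const ℝ 2)
  refine ((h1.pow 3).sub (h1.const_smul (4 : ℝ))).congr_deriv ?_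
  simp

/-- The embedding of bounded continuous functions into `L²(-1, 1)`, followed by the adjoint of
the primitive: the pairing with `g` is `∫ p (prim g)`. -/
def potL : BoundedContinuousFunction ℝ ℝ →L[ℝ] L2 :=
  (ContinuousLinearMap.adjoint primL).comp (BoundedContinuousFunction.toLp (E := ℝ) 2 cell ℝ)

lemma inner_potL (p : BoundedContinuousFunction ℝ ℝ) (g : L2) :
    inner ℝ (potL p) g = ∫ x, p x * prim g x ∂cell := by
  rw [potL, ContinuousLinearMap.comp_apply, ContinuousLinearMap.adjoint_inner_left, inner_eq]
  refine integral_congr_ae ?_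
  filter_upwards [BoundedContinuousFunction.coeFn_toLp (E := ℝ) 2 cell ℝ p, coe_primL g]
    with x h1 h2
  rw [h1, h2]

/-- The residual of the weak scalar equation near `b`: it vanishes at `(lam, g)` exactly when
`b + g` is a weak solution with parameter `lam`. -/
def residual (b : L2) (v : ℝ × Y) : Y :=
  ContinuousLinearMap.adjoint Y.subtypeL
    (b + Y.subtypeL v.2 + v.1 ^ 2 • potL (cubic (prim (b + Y.subtypeL v.2))))

lemma contDiff_residual (b : L2) : ContDiff ℝ ∞ (residual b) := by
  unfold residual
  have := contDiff_cubic
  fun_prop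

lemma inner_residual (b : L2) (v : ℝ × Y) (k : Y) : inner ℝ (residual b v) k
    = ∫ x, ((b + v.2 : L2) x * (k : L2) x + v.1 ^ 2 * (((2 + prim (b + v.2) x) ^ 2 - 4)
      * (2 + prim (b + v.2) x)) * prim k x) ∂cell := by
  rw [residual, ContinuousLinearMap.adjoint_inner_left, inner_add_left, inner_eq,
    real_inner_smul_left, inner_potL, ← integral_const_mul, ← integral_add]
  · refine integral_congr_ae (ae_of_all _ fun x => ?_)
    simp only [cubic_apply, Submodule.subtypeL_apply]
    ring
  · exact integrable_mul_coe _ _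
  · exact integrable_cell (by fun_prop)

lemma residual_eq_zero {lam : ℝ} {b : L2} {g : Y} (h : IsScalarSol lam (b + g)) :
    residual b (lam, g) = 0 := by
  refine ext_inner_right ℝ fun k => ?_
  rw [inner_residual, inner_zero_left]
  exact h.2 k k.2

/-- The partial derivative of the residual is invertible by the Lax–Milgram theorem. -/
lemma isInvertible_residual {lam : ℝ} (h : 0 < lam) :
    (fderiv ℝ (residual (branchDer lam)) (lam, 0) ∘L
      ContinuousLinearMap.inr ℝ ℝ Y).IsInvertible := by
  obtain ⟨α, hα, hB⟩ := exists_linForm_coercive h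
  set B : Y →L[ℝ] Y →L[ℝ] ℝ := (linForm lam).bilinearComp Y.subtypeL Y.subtypeL with hBdef
  have hco : IsCoercive B := ⟨α, hα, fun g => by
    rw [mul_assoc, ← sq]
    exact hB g g.2⟩
  refine ⟨hco.continuousLinearEquivOfBilin, ?_⟩
  ext1 k
  refine ext_inner_right ℝ fun k' => ?_
  rw [ContinuousLinearEquiv.coe_coe, hco.continuousLinearEquivOfBilin_apply]
  set b := branchDer lam
  have hline : HasDerivAt (fun t : ℝ => ((lam, t • k) : ℝ × Y)) (0, k) 0 := by
    have h2 : HasDerivAt (fun t : ℝ => t • k) k 0 := by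
      simpa using (hasDerivAt_id (0 : ℝ)).smul_const k
    exact (hasDerivAt_const (0 : ℝ) lam).prodMk h2
  have hd : HasFDerivAt (residual b) (fderiv ℝ (residual b) (lam, 0)) (lam, (0 : ℝ) • k) := by
    rw [zero_smul]
    exact ((contDiff_residual b).differentiable (by simp)).differentiableAt.hasFDerivAt
  have e1 := hd.comp_hasDerivAt (0 : ℝ) hline
  have e2 : HasDerivAt (fun t : ℝ => residual b (lam, t • k))
      (ContinuousLinearMap.adjoint Y.subtypeL ((k : L2) + lam ^ 2 • potL
        (3 * (BoundedContinuousFunction.const ℝ 2 + prim b) ^ 2 * prim k - (4 : ℝ) • prim k)))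
      0 := by
    refine HasFDerivAt.comp_hasDerivAt (0 : ℝ)
      (ContinuousLinearMap.adjoint Y.subtypeL).hasFDerivAt ?_
    refine HasDerivAt.add ?_ (HasDerivAt.const_smul (lam ^ 2) ?_)
    · simpa using ((hasDerivAt_id (0 : ℝ)).smul_const (k : L2)).const_add b
    · refine HasFDerivAt.comp_hasDerivAt (0 : ℝ) potL.hasFDerivAt ?_
      simpa using hasDerivAt_cubic (prim b) (prim k)
  have e3 := e1.unique e2
  rw [ContinuousLinearMap.comp_apply, ContinuousLinearMap.inr_apply, e3,
    ContinuousLinearMap.adjoint_inner_left, inner_add_left, real_inner_smul_left, inner_eq,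
    inner_potL, hBdef, ContinuousLinearMap.bilinearComp_apply, linForm, form_apply,
    ← integral_const_mul]
  congr 1
  · simp only [one_mul, Submodule.subtypeL_apply]
  · refine integral_congr_ae (ae_of_all _ fun x => ?_)
    simp only [linPot, Submodule.subtypeL_apply, BoundedContinuousFunction.sub_apply,
      BoundedContinuousFunction.mul_apply, BoundedContinuousFunction.pow_apply,
      BoundedContinuousFunction.add_apply, BoundedContinuousFunction.const_apply,
      BoundedContinuousFunction.smul_apply, smul_eq_mul]
    rw [show (3 : BoundedContinuousFunction ℝ ℝ) x = 3 from rfl]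
    ring

/-- Continuity of the branch in `H¹`: the equations for two parameters, tested with the
difference of the solutions, bound the energy norm by the uniform norm. -/
lemma tendsto_branchDer {lam₀ : ℝ} (h₀ : 0 < lam₀) :
    Tendsto branchDer (𝓝 lam₀) (𝓝 (branchDer lam₀)) := by
  rw [tendsto_iff_norm_sub_tendsto_zero]
  have key : ∀ ε > 0, ∀ᶠ l in 𝓝 lam₀, ‖branchDer l - branchDer lam₀‖ ^ 2
      ≤ 32 * (l ^ 2 + lam₀ ^ 2) * ε := by
    intro ε hε
    filter_upwards [profile_tendsto h₀ hε, lt_mem_nhds h₀] with l hl hl0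
    have s := isScalarSol_branchDer hl0
    have s₀ := isScalarSol_branchDer h₀
    set e := branchDer l - branchDer lam₀ with he
    have hm : e ∈ Y := by
      rw [mem_Y, he, map_sub, BoundedContinuousFunction.sub_apply, s.1, s₀.1, sub_self]
    have i1 : ∀ (m : ℝ) (f : L2), Integrable (fun x => f x * e x
        + m ^ 2 * (((2 + prim f x) ^ 2 - 4) * (2 + prim f x)) * prim e x) cell := fun m f =>
      (integrable_mul_coe f e).add (integrable_cell (by fun_prop))
    have e1 := s.2 e hm
    have e2 := s₀.2 e hm
    have e3 : ‖e‖ ^ 2 = ∫ x, (lam₀ ^ 2 * (((2 + prim (branchDer lam₀) x) ^ 2 - 4)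
          * (2 + prim (branchDer lam₀) x)) - l ^ 2 * (((2 + prim (branchDer l) x) ^ 2 - 4)
          * (2 + prim (branchDer l) x))) * prim e x ∂cell := by
      rw [norm_sq_eq, ← sub_eq_zero, ← integral_sub (integrable_sq e)
        (integrable_cell (by fun_prop)), ← sub_self (0 : ℝ)]
      nth_rewrite 1 [← e1]
      rw [← e2, ← integral_sub (i1 l _) (i1 lam₀ _)]
      refine integral_congr_ae ?_
      filter_upwards [Lp.coeFn_sub (branchDer l) (branchDer lam₀)] with x hx
      rw [he, hx, Pi.sub_apply]
      ring
    rw [e3, integral_cell]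
    have hb : ∀ x ∈ uIoc (-1 : ℝ) 1, ‖(lam₀ ^ 2 * (((2 + prim (branchDer lam₀) x) ^ 2 - 4)
          * (2 + prim (branchDer lam₀) x)) - l ^ 2 * (((2 + prim (branchDer l) x) ^ 2 - 4)
          * (2 + prim (branchDer l) x))) * prim e x‖ ≤ 16 * (l ^ 2 + lam₀ ^ 2) * ε := by
      intro x hx
      rw [uIoc_of_le (by norm_num)] at hx
      have hx' : x ∈ Icc (-1 : ℝ) 1 := Ioc_subset_Icc_self hx
      have p1 := prim_branchDer hl0 hx'
      have p2 := prim_branchDer h₀ hx'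
      have p3 : prim e x = -2 * (profile l x - profile lam₀ x) := by
        rw [he, map_sub, BoundedContinuousFunction.sub_apply]
        linarith
      have q : ∀ v ∈ Icc (-1 : ℝ) 1, |((-2 * v) ^ 2 - 4) * (-2 * v)| ≤ 8 := by
        intro v hv
        rw [abs_mul]
        have a1 : |(-2 * v) ^ 2 - 4| ≤ 4 := abs_le.2 ⟨by nlinarith [sq_nonneg v], by
          nlinarith [hv.1, hv.2]⟩
        have a2 : |-2 * v| ≤ 2 := abs_le.2 ⟨by linarith [hv.2], by linarith [hv.1]⟩
        calc _ ≤ 4 * 2 := mul_le_mul a1 a2 (abs_nonneg _) (by norm_num)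
          _ = 8 := by norm_num
      have q1 := q _ ((isProfile hl0).mem x hx')
      have q2 := q _ ((isProfile h₀).mem x hx')
      rw [p1, p2, p3, Real.norm_eq_abs, abs_mul, abs_mul (-2 : ℝ)]
      have r1 : |lam₀ ^ 2 * (((-2 * profile lam₀ x) ^ 2 - 4) * (-2 * profile lam₀ x))
          - l ^ 2 * (((-2 * profile l x) ^ 2 - 4) * (-2 * profile l x))|
          ≤ lam₀ ^ 2 * 8 + l ^ 2 * 8 := by
        refine (abs_sub _ _).trans ?_
        rw [abs_mul, abs_mul (l ^ 2), abs_of_nonneg (sq_nonneg lam₀), abs_of_nonneg (sq_nonneg l)]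
        gcongr
      have r2 : |(-2 : ℝ)| * |profile l x - profile lam₀ x| ≤ 2 * ε := by
        rw [abs_neg, abs_two]
        exact mul_le_mul_of_nonneg_left (hl x hx') (by norm_num)
      calc _ ≤ (lam₀ ^ 2 * 8 + l ^ 2 * 8) * (2 * ε) :=
            mul_le_mul r1 r2 (by positivity) (by positivity)
        _ = 16 * (l ^ 2 + lam₀ ^ 2) * ε := by ring
    have := intervalIntegral.norm_integral_le_of_norm_le_const hb
    refine (le_abs_self _).trans (this.trans_eq ?_)
    norm_num
    ring
  have hsq : Tendsto (fun l => ‖branchDer l - branchDer lam₀‖ ^ 2) (𝓝 lam₀) (𝓝 0) := by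
    rw [Metric.tendsto_nhds]
    intro ε hε
    set M := 32 * ((lam₀ + 1) ^ 2 + lam₀ ^ 2) with hM
    have hM0 : 0 < M := by positivity
    filter_upwards [key (ε / (2 * M)) (by positivity), lt_mem_nhds h₀,
      gt_mem_nhds (show lam₀ < lam₀ + 1 by linarith)] with l h1 h2 h3
    rw [Real.dist_0_eq_abs, abs_of_nonneg (sq_nonneg _)]
    have h4 : 32 * (l ^ 2 + lam₀ ^ 2) ≤ M := by rw [hM]; gcongr
    calc _ ≤ 32 * (l ^ 2 + lam₀ ^ 2) * (ε / (2 * M)) := h1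
      _ ≤ M * (ε / (2 * M)) := by gcongr
      _ = ε / 2 := by field_simp
      _ < ε := by linarith
  have := hsq.sqrt
  simpa using this

/-- By continuity the branch is the implicit function of `residual = 0`. -/
lemma contDiffAt_branchDer {lam₀ : ℝ} (h₀ : 0 < lam₀) : ContDiffAt ℝ ∞ branchDer lam₀ := by
  set b := branchDer lam₀ with hb
  have s₀ := isScalarSol_branchDer h₀
  have cdf : ContDiffAt ℝ ∞ (residual b) (lam₀, 0) := (contDiff_residual b).contDiffAt
  have hinv := isInvertible_residual h₀
  have hn : (∞ : WithTop ℕ∞) ≠ 0 := by simp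
  set ψ := cdf.implicitFunction hn hinv with hψ
  have hψs : ContDiffAt ℝ ∞ ψ lam₀ := cdf.contDiffAt_implicitFunction hn hinv
  -- the adjoint of the inclusion is the orthogonal projection; it fixes `branchDer l - b`
  set G : ℝ → Y := fun l => ContinuousLinearMap.adjoint Y.subtypeL (branchDer l - b) with hG
  have hGt : Tendsto (fun l => (l, G l)) (𝓝 lam₀) (𝓝 (lam₀, 0)) := by
    rw [nhds_prod_eq]
    refine tendsto_id.prodMk ?_
    have h1 : Tendsto (fun l => branchDer l - b) (𝓝 lam₀) (𝓝 0) := by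
      rw [← sub_self b]
      exact (tendsto_branchDer h₀).sub_const b
    have h2 := ((ContinuousLinearMap.adjoint Y.subtypeL).continuous.tendsto 0).comp h1
    rwa [map_zero] at h2
  have hGe : ∀ l, 0 < l → b + (G l : L2) = branchDer l := by
    intro l hl
    have hm : branchDer l - b ∈ Y := by
      rw [mem_Y, map_sub, BoundedContinuousFunction.sub_apply, (isScalarSol_branchDer hl).1, s₀.1,
        sub_self]
    have : G l = ⟨branchDer l - b, hm⟩ := by
      refine ext_inner_right ℝ fun k => ?_
      rw [hG, ContinuousLinearMap.adjoint_inner_left]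
      rfl
    rw [this]
    exact add_sub_cancel b _
  have hzero : residual b (lam₀, 0) = 0 := residual_eq_zero (by simpa using s₀)
  have hev := hGt.eventually (cdf.eventually_apply_eq_iff_implicitFunction hn hinv)
  have hs : ContDiffAt ℝ ∞ (fun l => b + Y.subtypeL (ψ l)) lam₀ :=
    contDiffAt_const.add (Y.subtypeL.contDiff.contDiffAt.comp lam₀ hψs)
  refine hs.congr_of_eventuallyEq ?_
  filter_upwards [hev, lt_mem_nhds h₀] with l h1 h2
  have h3 : ψ l = G l := h1.1 (by
    rw [hzero]
    exact residual_eq_zero (by rw [hGe l h2]; exact isScalarSol_branchDer h2))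
  rw [h3]
  exact (hGe l h2).symm

lemma contDiffOn_branch : ContDiffOn ℝ ∞ branch (Ioi 0) := by
  intro l hl
  have h := contDiffAt_branchDer hl
  have : ContDiffAt ℝ ∞ branch l := by
    unfold branch cfg mkH
    fun_prop
  exact this.contDiffWithinAt

/-! ### Uniqueness of the branch -/

lemma snd_mkH (a : ℝ) (f : L2) : (mkH a f).1.snd = f := Lp.ext (der_mkH a f)

/-- A continuous family of eigenvalue exchange solutions that meets the branch stays on it. -/
lemma eventuallyEq_branch {ψ : ℝ → Config} {lam₀ : ℝ} (h₀ : 0 < lam₀) (hc : ContinuousAt ψ lam₀)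
    (hψ : ∀ᶠ l in 𝓝 lam₀, IsCriticalPoint (-8) l (ψ l) ∧ IsEE (ψ l))
    (he : ψ lam₀ = branch lam₀) : ψ =ᶠ[𝓝 lam₀] branch := by
  obtain ⟨δ, hδ, hg⟩ := exists_linForm_gap h₀
  set F₁ : ℝ → L2 := fun l => (ψ l).1.1.snd with hF₁
  set F₂ : ℝ → L2 := fun l => (ψ l).2.1.1.snd with hF₂
  have c₁ : ContinuousAt F₁ lam₀ := by rw [hF₁]; fun_prop
  have c₂ : ContinuousAt F₂ lam₀ := by rw [hF₂]; fun_prop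
  have v₁ : F₁ lam₀ = 0 := by simp only [hF₁, he, branch, cfg, snd_mkH]
  have v₂ : F₂ lam₀ = branchDer lam₀ := by simp only [hF₂, he, branch, cfg, snd_mkH]
  have cb : ContinuousAt branchDer lam₀ := tendsto_branchDer h₀
  set q : ℝ → BoundedContinuousFunction ℝ ℝ :=
    fun l => BoundedContinuousFunction.const ℝ 2 + prim (F₂ l) with hq
  set y : ℝ → BoundedContinuousFunction ℝ ℝ :=
    fun l => BoundedContinuousFunction.const ℝ 2 + prim (branchDer l) with hy
  set C : ℝ → BoundedContinuousFunction ℝ ℝ :=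
    fun l => l ^ 2 • (q l ^ 2 + q l * y l + y l ^ 2 - BoundedContinuousFunction.const ℝ 4) with hC
  have cC : ContinuousAt C lam₀ := by
    simp only [hC, hq, hy]
    fun_prop
  have vC : ∀ x, C lam₀ x = linPot lam₀ x := by
    intro x
    simp only [hC, hq, hy, v₂, linPot, BoundedContinuousFunction.sub_apply,
      BoundedContinuousFunction.mul_apply, BoundedContinuousFunction.pow_apply,
      BoundedContinuousFunction.add_apply, BoundedContinuousFunction.const_apply,
      BoundedContinuousFunction.smul_apply, smul_eq_mul]
    ring
  have n₁ : ∀ᶠ l in 𝓝 lam₀, ‖prim (F₁ l)‖ < 1 / 4 := by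
    have : ContinuousAt (fun l => ‖prim (F₁ l)‖) lam₀ := by fun_prop
    exact this.eventually (gt_mem_nhds (by simp only [v₁, map_zero, norm_zero]; norm_num))
  have n₂ : ∀ᶠ l in 𝓝 lam₀, ‖prim (F₂ l) - prim (branchDer l)‖ < 1 := by
    have : ContinuousAt (fun l => ‖prim (F₂ l) - prim (branchDer l)‖) lam₀ := by fun_prop
    exact this.eventually (gt_mem_nhds (by simp only [v₂, sub_self, norm_zero]; norm_num))
  have n₃ : ∀ᶠ l in 𝓝 lam₀, ‖C l - C lam₀‖ < δ / 2 := by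
    have : ContinuousAt (fun l => ‖C l - C lam₀‖) lam₀ := by fun_prop
    exact this.eventually (gt_mem_nhds (by simp only [sub_self, norm_zero]; positivity))
  filter_upwards [hψ, n₁, n₂, n₃, lt_mem_nhds h₀] with l hl m₁ m₂ m₃ hl0
  obtain ⟨f₁, f₂, f₃, k₁, k₂, -, hQ, -⟩ := hl.1.exists_cfg
  have hf₃ : f₃ = 0 := by
    have := hl.2
    rw [IsEE, hQ] at this
    exact primH_eq_zero.1 this
  rw [hf₃] at hQ
  have w₁ : F₁ l = f₁ := by simp only [hF₁, hQ, cfg, snd_mkH]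
  have w₂ : F₂ l = f₂ := by simp only [hF₂, hQ, cfg, snd_mkH]
  rw [w₁] at m₁
  rw [w₂] at m₂
  rw [hQ]
  refine eq_branch_of_close hg hl0 (hQ ▸ hl.1) k₁ k₂ (half_lt_self hδ) (fun x _ => ?_)
    (fun x _ => ?_) (fun x _ => ?_)
  · exact ((prim f₁).norm_coe_le_norm x).trans m₁.le
  · exact ((prim f₂ - prim (branchDer l)).norm_coe_le_norm x).trans m₂.le
  · have h1 := abs_le.1 (((C l - C lam₀).norm_coe_le_norm x).trans m₃.le)
    rw [BoundedContinuousFunction.sub_apply, vC] at h1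
    have h2 : C l x = l ^ 2 * ((2 + prim f₂ x) ^ 2
        + (2 + prim f₂ x) * (2 + prim (branchDer l) x) + (2 + prim (branchDer l) x) ^ 2 - 4) := by
      simp only [hC, hq, hy, w₂, BoundedContinuousFunction.sub_apply,
        BoundedContinuousFunction.mul_apply, BoundedContinuousFunction.pow_apply,
        BoundedContinuousFunction.add_apply, BoundedContinuousFunction.const_apply,
        BoundedContinuousFunction.smul_apply, smul_eq_mul]
    linarith [h1.1]

/-- The parameters near which `ψ` agrees with the branch form a nonempty, relatively open and closed
subset of the interval of definition of `ψ`. -/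
lemma eq_branch_of_isEEBranch {L : EReal} {ψ : ℝ → Config} (hψ : IsEEBranch (-8) L ψ) {lam : ℝ}
    (h0 : 0 < lam) (hL : (lam : EReal) < L) : ψ lam = branch lam := by
  set S : Set ℝ := {l : ℝ | 0 < l ∧ (l : EReal) < L} with hS
  have hSo : IsOpen S :=
    (isOpen_lt continuous_const continuous_id).inter
      (isOpen_lt continuous_coe_real_ereal continuous_const)
  have hSc : IsPreconnected S := by
    refine Set.OrdConnected.isPreconnected ⟨fun a ha b hb c hc => ⟨ha.1.trans_le hc.1, ?_⟩⟩
    exact (EReal.coe_le_coe_iff.2 hc.2).trans_lt hb.2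
  have hSm : ∀ l ∈ S, S ∈ 𝓝 l := fun l hl => hSo.mem_nhds hl
  have hcr : ∀ l ∈ S, ∀ᶠ l' in 𝓝 l, IsCriticalPoint (-8) l' (ψ l') ∧ IsEE (ψ l') := fun l hl => by
    filter_upwards [hSm l hl] with l' hl'
    exact hψ.2 l' hl'.1 hl'.2
  have hψc : ∀ l ∈ S, ContinuousAt ψ l := fun l hl =>
    (hψ.1.continuousOn.continuousWithinAt hl).continuousAt (hSm l hl)
  have hbc : ∀ l ∈ S, ContinuousAt branch l := fun l hl =>
    (contDiffOn_branch.continuousOn.continuousWithinAt hl.1).continuousAt (Ioi_mem_nhds hl.1)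
  set U : Set ℝ := {l | ψ =ᶠ[𝓝 l] branch} with hU
  have hUo : IsOpen U := isOpen_setOfPred_eventually_nhds
  have hne : (S ∩ U).Nonempty := by
    have hpos : 0 < min lam (1 / 6) := lt_min h0 (by norm_num)
    have hlt : min lam (1 / 6) / 2 < min lam (1 / 6) := half_lt_self hpos
    have hmem : min lam (1 / 6) / 2 ∈ S := ⟨half_pos hpos,
      (EReal.coe_lt_coe_iff.2 (hlt.trans_le (min_le_left _ _))).trans hL⟩
    refine ⟨_, hmem, ?_⟩
    filter_upwards [hSm _ hmem, gt_mem_nhds (hlt.trans_le (min_le_right _ _))] with l h1 h2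
    exact eq_branch_of_small h1.1 h2 (hψ.2 l h1.1 h1.2).1
  have hcl : closure U ∩ S ⊆ U := by
    rintro l ⟨hl, hlS⟩
    refine eventuallyEq_branch hlS.1 (hψc l hlS) (hcr l hlS) ?_
    have : (𝓝[U] l).NeBot := mem_closure_iff_nhdsWithin_neBot.1 hl
    refine tendsto_nhds_unique_of_eventuallyEq (l := 𝓝[U] l)
      ((hψc l hlS).tendsto.mono_left nhdsWithin_le_nhds)
      ((hbc l hlS).tendsto.mono_left nhdsWithin_le_nhds) ?_
    filter_upwards [self_mem_nhdsWithin] with l' hl'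
    exact hl'.self_of_nhds
  exact (hSc.subset_of_closure_inter_subset hUo hne hcl ⟨h0, hL⟩ : lam ∈ U).self_of_nhds

lemma isEEBranch_branch : IsEEBranch (-8) ⊤ branch :=
  ⟨contDiffOn_branch.mono fun _ h => h.1,
    fun lam h _ => ⟨isCriticalPoint_branch h, isEE_branch lam⟩⟩

end Nematic

end

theorem mainTheorem2 :
    Nematic.lambdaStar (-8) = ⊤ ∧
    ∃ χ : ℝ → Nematic.Config,
      -- a smooth branch of eigenvalue exchange solutions on the whole half-line
      Nematic.IsEEBranch (-8) ⊤ χ ∧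
      -- it extends the unique critical point for small parameters
      (∃ lam₀ : ℝ, 0 < lam₀ ∧ ∀ lam ∈ Ioo 0 lam₀, ∀ Q : Nematic.Config,
        Nematic.IsCriticalPoint (-8) lam Q → Q = χ lam) ∧
      -- it is the only such branch
      (∀ (L : EReal) (ψ : ℝ → Nematic.Config), Nematic.IsEEBranch (-8) L ψ →
        ∀ lam : ℝ, 0 < lam → (lam : EReal) < L → ψ lam = χ lam) ∧
      (∀ lam : ℝ, 0 < lam → 0 < Nematic.nu (-8) lam (χ lam)) ∧
      (∀ lam : ℝ, 0 < lam →
        (Nematic.val (χ lam).1 =ᵐ[Nematic.cell] fun _ => (2 / 3 : ℝ)) ∧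
        Nematic.SolvesScalarBVP lam (χ lam).2.1) ∧
      (∀ lam : ℝ, 0 < lam →
        DifferentiableAt ℝ (fun l : ℝ => Nematic.mu (-8) l (χ l)) lam ∧
        deriv (fun l : ℝ => Nematic.mu (-8) l (χ l)) lam < 0) ∧
      (∃ m : ℝ, m < 0 ∧ Tendsto (fun l : ℝ => Nematic.mu (-8) l (χ l)) atTop (𝓝 m)) ∧
      (∃! lamc : ℝ, 0 < lamc ∧
        (∀ lam ∈ Ioo 0 lamc, 0 < Nematic.mu (-8) lam (χ lam)) ∧
        Nematic.mu (-8) lamc (χ lamc) = 0 ∧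
        deriv (fun l : ℝ => Nematic.mu (-8) l (χ l)) lamc < 0) := by
  refine ⟨top_le_iff.1 (le_sSup ⟨Nematic.branch, Nematic.isEEBranch_branch,
    fun _ h _ => Nematic.nu_branch_pos h⟩), Nematic.branch, Nematic.isEEBranch_branch,
    ⟨1 / 6, by norm_num, fun _ h _ hQ => Nematic.eq_branch_of_small h.1 h.2 hQ⟩,
    fun _ _ hψ _ h hL => Nematic.eq_branch_of_isEEBranch hψ h hL,
    fun _ h => Nematic.nu_branch_pos h,
    fun lam h => ⟨Nematic.val_branch lam, Nematic.solvesScalarBVP_branch h⟩, ?_,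
    Nematic.tendsto_mu, ?_⟩
  · intro lam h
    obtain ⟨m, hm, hd⟩ := Nematic.exists_hasDerivAt_mu h
    exact ⟨hd.differentiableAt, hd.deriv.trans_lt hm⟩
  · obtain ⟨l, h0, hl⟩ := Nematic.exists_mu_zero
    obtain ⟨m, hm, hd⟩ := Nematic.exists_hasDerivAt_mu h0
    refine ⟨l, ⟨h0, fun a ha => ?_, hl, hd.deriv.trans_lt hm⟩, fun b hb => ?_⟩
    · exact hl.symm.trans_lt (Nematic.mu_strictAnti ha.1 h0 ha.2)
    · exact Nematic.mu_strictAnti.injOn hb.1 h0 (hb.2.2.1.trans hl.symm)
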